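/- **Theorem 1.1.** Let $\{s_{ij}: i,j=1,2,\dots\}$ be i.i.d. complex random variables with $\mathbb{E}s_{11}=0$, $\mathbb{E}|s_{11}|^2=1$, and put $\mathbf{s}_k=\mathbf{s}_k(N)=(s_{1k},\dots,s_{Nk})^T$. Let $K=K(N)$ with $K/N\to c>0$ as $N\to\infty$, let $L\ge 1$ be a fixed integer and $\sigma^2>0$. For each $N$ let $T_k=T_k^N\ge 0$ and $\gamma_k(\ell)=\gamma_k^N(\ell)\in\mathbb{C}$ ($1\le k\le K$, $1\le \ell\le L$) be random variables such that the family of all of them is independent of $(\mathbf{s}_1(N),\dots,\mathbf{s}_K(N))$. Put $\boldsymbol{\alpha}_k=\boldsymbol{\alpha}_k^N=\sqrt{T_k}\,(\gamma_k(1),\dots,\gamma_k(L))^T$ and assume that, almost surely, the empirical distribution of $\boldsymbol{\alpha}_1,\dots,\boldsymbol{\alpha}_K$ converges weakly, as $N\to\infty$, to a (nonrandom) probability distribution $H$ on $\mathbb{C}^L$. Define $$\boldsymbol{\beta}_k=\sqrt{T_k}\,(\gamma_k(1)\mathbf{s}_k^T,\dots,\gamma_k(L)\mathbf{s}_k^T)^T\in\mathbb{C}^{NL},\qquad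 C=\frac1N\sum_{k=2}^K\boldsymbol{\beta}_k\boldsymbol{\beta}_k^*,\qquad \mathrm{SIR}_1=\frac1N\boldsymbol{\beta}_1^*(C+\sigma^2 I)^{-1}\boldsymbol{\beta}_1 .$$ Then there is exactly one Hermitian positive definite $L\times L$ matrix $A=(a_{\ell\ell'})$ with $$A=\Big(c\,\mathbb{E}\,\frac{\boldsymbol{\alpha}\boldsymbol{\alpha}^*}{1+\boldsymbol{\alpha}^*A\boldsymbol{\alpha}}+\sigma^2 I_L\Big)^{-1},\qquad \boldsymbol{\alpha}\sim H,$$ and, with this nonrandom $A$, the following holds with probability one. 1. If $T_1^N\to T_1$ and $\gamma_1^N(\ell)\to\gamma_1(\ell)$ for all $\ell$ as $N\to\infty$ (in particular if $T_1$ and $\gamma_1(\ell)$ do not depend on $N$), then $$\lim_{N\to\infty}\mathrm{SIR}_1=T_1\sum_{\ell,\ell'=1}^L\bar\gamma_1(\ell)\,\gamma_1(\ell')\,a_{\ell\ell'} .$$ 2. More generally, if the sequence $(\boldsymbol{\alpha}_1^N)_N$ is bounded, then $$\lim_{N\to\infty}\Big(\mathrm{SIR}_1-T_1^N\sum_{\ell,\ell'=1}^L\overline{\gamma_1^N(\ell)}\,\gamma_1^N(\ell')\,a_{\ell\ell'}\Big)=0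 .$$ -/

import Mathlib

open MeasureTheory ProbabilityTheory Filter Topology
open scoped NNReal ComplexConjugate ComplexOrder

noncomputable section

namespace CDMA

/-! Users and signature coordinates are numbered from `0`: the distinguished first user is user `0`,
its interferers are the users `1, …, K - 1`, and `s i k` is coordinate `i` of the signature of
user `k`. All definitions in this group are for one realization. -/

/-- The vector `α = √T (γ(1), …, γ(L))ᵀ` of a user with transmit power `T` and gains `γ`. -/
def gainVec {L : ℕ} (T : ℝ) (γ : Fin L → ℂ) : Fin L → ℂ :=
  fun l => (Real.sqrt T : ℂ) * γ l

/-- The vector `β = √T (γ(1) sᵀ, …, γ(L) sᵀ)ᵀ ∈ ℂ^{NL}`; the coordinate `(l, i)` is the `i`-th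
coordinate of the `l`-th block. -/
def beta {L N : ℕ} (T : ℝ) (γ : Fin L → ℂ) (s : Fin N → ℂ) : Fin L × Fin N → ℂ :=
  fun p => (Real.sqrt T : ℂ) * (γ p.1 * s p.2)

/-- The vector `β_k(N)` of user `k`, whose signature is the first `N` entries of column `k`. -/
def userBeta {L : ℕ} (N : ℕ) (T : ℕ → ℝ) (γ : ℕ → Fin L → ℂ) (s : ℕ → ℕ → ℂ) (k : ℕ) :
    Fin L × Fin N → ℂ :=
  beta (T k) (γ k) (fun i : Fin N => s i k)

/-- The interference matrix `C = (1/N) ∑ β_k β_k^*`, over all users except the first one. -/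
def interference {L : ℕ} (N K : ℕ) (T : ℕ → ℝ) (γ : ℕ → Fin L → ℂ) (s : ℕ → ℕ → ℂ) :
    Matrix (Fin L × Fin N) (Fin L × Fin N) ℂ :=
  (1 / (N : ℂ)) • ∑ k ∈ Finset.Ico 1 K,
    Matrix.vecMulVec (userBeta N T γ s k) (star (userBeta N T γ s k))

/-- `SIR = (1/N) β^* (C + σ² I)⁻¹ β`, with `β` the vector of the first user. -/
def sir {L : ℕ} (N K : ℕ) (σ : ℝ) (T : ℕ → ℝ) (γ : ℕ → Fin L → ℂ) (s : ℕ → ℕ → ℂ) : ℂ :=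
  (1 / (N : ℂ)) *
    (star (userBeta N T γ s 0) ⬝ᵥ
      ((interference N K T γ s +
        ((σ ^ 2 : ℝ) : ℂ) • (1 : Matrix (Fin L × Fin N) (Fin L × Fin N) ℂ))⁻¹.mulVec
          (userBeta N T γ s 0)))

/-- The empirical distribution `(1/K) ∑_{k < K} δ_{α k}` of `K` points of `ℂ^L` (a probability
measure as soon as `K ≠ 0`). -/
def empiricalDist {L : ℕ} (K : ℕ) (α : ℕ → Fin L → ℂ) : FiniteMeasure (Fin L → ℂ) :=
  (K : ℝ≥0)⁻¹ • ∑ k ∈ Finset.range K, (diracProba (α k)).toFiniteMeasure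

/-- The matrix `E [α α^* / (1 + α^* A α)]`, where `α` has distribution `H`. For positive definite `A`
the integrands are bounded and continuous. -/
def expMatrix {L : ℕ} (H : ProbabilityMeasure (Fin L → ℂ)) (A : Matrix (Fin L) (Fin L) ℂ) :
    Matrix (Fin L) (Fin L) ℂ :=
  Matrix.of fun l l' =>
    ∫ α : Fin L → ℂ, α l * conj (α l') / (1 + star α ⬝ᵥ A.mulVec α) ∂(H : Measure (Fin L → ℂ))

/-- `A` is Hermitian positive definite and `A = (c E [α α^* / (1 + α^* A α)] + σ² I)⁻¹`. -/
def IsSolution {L : ℕ} (c σ : ℝ) (H : ProbabilityMeasure (Fin L → ℂ))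
    (A : Matrix (Fin L) (Fin L) ℂ) : Prop :=
  A.PosDef ∧
    A = ((c : ℂ) • expMatrix H A +
      ((σ ^ 2 : ℝ) : ℂ) • (1 : Matrix (Fin L) (Fin L) ℂ))⁻¹

/-- The deterministic expression `T ∑_{l, l'} conj(γ(l)) γ(l') a_{l l'}`. -/
def limitValue {L : ℕ} (T : ℝ) (γ : Fin L → ℂ) (A : Matrix (Fin L) (Fin L) ℂ) : ℂ :=
  (T : ℂ) * ∑ l, ∑ l', conj (γ l) * γ l' * A l l'

end CDMA

end

noncomputable section

namespace CDMA

open Matrix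
open scoped ENNReal

/-! ### Squared norms and quadratic forms -/

section Basic

variable {ι : Type*} [Fintype ι]

/-! The ratio equals `α₁^* B α₁` exactly, where `α₁` is the gain vector of the first user and `B` is
the `L × L` matrix of normalized quadratic forms of the first signature in the blocks of `(C + σ²
I)⁻¹` (`sir_eq`). It remains to show that, almost surely, `B` tends to the solution of the fixed
point equation.

At finite `N`, take normalized block traces in `D⁻¹ D = 1` and remove each user from the resolvent
it meets by Sherman–Morrison. The result, `one_eq_resTrace_add`, is the fixed point equation, except
that in the term of user `k` the trace matrix is replaced by the form of its signature in the
resolvent of the other users. That resolvent is independent of the signature, so the form is close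
to the trace. Since the entries only have two moments, this closeness is proved in mean
(`lintegral_form_sub_trace_le`), and so the expected defect of the traces in the equation vanishes
(`norm_integral_defect_le`). Replacing one signature moves the defect by `O(1/N)`; a martingale
argument gives a centred fourth moment `O(N⁻²)` (`fourth_moment_bddDiff`), which is summable. Hence
the defect vanishes almost surely (`ae_tendsto_defect`).

These estimates need bounded gain vectors, whereas `H` may have no moments. The gains are therefore
cut off at level `M`. Removing a user changes the block traces by `O(1/N)` however large its gains
are, so the cutoff costs at most a multiple of the proportion of large gains, which weak convergence
controls.

The rest of the limit is deterministic. The traces are bounded by `1/σ²`, so a subsequence converges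
for all `M` at once, and each cutoff limit solves the equation with cut off gains. A lower bound on
these solutions, uniform in `M` (`nsq_le_of_fixRHS`), dominates the integrands as `M → ∞`, so the
limit of the traces without cutoff is a solution (`exists_cluster_isSolution`). Solutions are unique
because matrix inversion reverses order and the term `σ² I` makes a comparison of two solutions
improve itself (`IsSolution.unique`). Thus the whole sequence converges. Existence of `A` is read
off from one good realization, and uniqueness makes the limit nonrandom.

For the first user the comparison of form and trace is needed almost surely. Its signature is an
initial segment of one fixed column, so after truncation of the entries fourth moments handle the
bounded part and the strong law handles the remainder (`ae_tendsto_blockForm_sub_resTrace`). -/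

/-- The squared Euclidean norm. -/
def nsq (x : ι → ℂ) : ℝ := ∑ i, ‖x i‖ ^ 2

lemma nsq_nonneg (x : ι → ℂ) : 0 ≤ nsq x := Finset.sum_nonneg fun _ _ => sq_nonneg _

lemma star_dotProduct_self (x : ι → ℂ) : star x ⬝ᵥ x = (nsq x : ℂ) := by
  simp only [dotProduct, nsq, Pi.star_apply, Complex.ofReal_sum, Complex.ofReal_pow]
  exact Finset.sum_congr rfl fun i _ => by
    rw [← Complex.conj_mul']; rfl

lemma sq_norm_dotProduct_le (x y : ι → ℂ) : ‖x ⬝ᵥ y‖ ^ 2 ≤ nsq x * nsq y := by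
  have h : ‖x ⬝ᵥ y‖ ≤ ∑ i, ‖x i‖ * ‖y i‖ :=
    (norm_sum_le _ _).trans_eq (Finset.sum_congr rfl fun i _ => norm_mul _ _)
  calc ‖x ⬝ᵥ y‖ ^ 2 ≤ (∑ i, ‖x i‖ * ‖y i‖) ^ 2 := by gcongr
    _ ≤ _ := Finset.sum_mul_sq_le_sq_mul_sq _ _ _

lemma norm_dotProduct_le (x y : ι → ℂ) : ‖x ⬝ᵥ y‖ ≤ √(nsq x) * √(nsq y) := by
  rw [← Real.sqrt_mul (nsq_nonneg x)]
  exact Real.le_sqrt_of_sq_le (sq_norm_dotProduct_le x y)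

@[simp] lemma nsq_star (x : ι → ℂ) : nsq (star x) = nsq x := by simp [nsq]

lemma nsq_smul (c : ℂ) (x : ι → ℂ) : nsq (c • x) = ‖c‖ ^ 2 * nsq x := by
  simp [nsq, mul_pow, Finset.mul_sum]

lemma norm_sq_le_nsq (x : ι → ℂ) (i : ι) : ‖x i‖ ^ 2 ≤ nsq x :=
  Finset.single_le_sum (f := fun i => ‖x i‖ ^ 2) (fun _ _ => sq_nonneg _) (Finset.mem_univ i)

/-- The real part of the quadratic form `v ↦ v^* A v`. -/
def qf (A : Matrix ι ι ℂ) (v : ι → ℂ) : ℝ := (star v ⬝ᵥ A *ᵥ v).re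

lemma qf_add (A B : Matrix ι ι ℂ) (v : ι → ℂ) : qf (A + B) v = qf A v + qf B v := by
  simp [qf, add_mulVec]

lemma qf_sub (A B : Matrix ι ι ℂ) (v : ι → ℂ) : qf (A - B) v = qf A v - qf B v := by
  simp [qf, sub_mulVec]

lemma qf_smul (r : ℝ) (A : Matrix ι ι ℂ) (v : ι → ℂ) : qf ((r : ℂ) • A) v = r * qf A v := by
  simp [qf, smul_mulVec]

lemma qf_one [DecidableEq ι] (v : ι → ℂ) : qf (1 : Matrix ι ι ℂ) v = nsq v := by
  simp [qf, star_dotProduct_self]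

lemma star_dotProduct_mulVec_comm {A : Matrix ι ι ℂ} (hA : A.IsHermitian) (v w : ι → ℂ) :
    star v ⬝ᵥ A *ᵥ w = conj (star w ⬝ᵥ A *ᵥ v) := by
  rw [starRingEnd_apply, star_dotProduct, star_mulVec, hA.eq, dotProduct_mulVec]

lemma IsHermitian.dotProduct_eq_qf {A : Matrix ι ι ℂ} (hA : A.IsHermitian) (v : ι → ℂ) :
    star v ⬝ᵥ A *ᵥ v = (qf A v : ℂ) := by
  have := star_dotProduct_mulVec_comm hA v v
  exact (Complex.conj_eq_iff_re.1 this.symm).symm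

lemma qf_nonneg {A : Matrix ι ι ℂ} (hA : A.PosSemidef) (v : ι → ℂ) : 0 ≤ qf A v :=
  (Complex.le_def.1 (hA.dotProduct_mulVec_nonneg v)).1

lemma posSemidef_of_qf {A : Matrix ι ι ℂ} (hA : A.IsHermitian) (h : ∀ v, 0 ≤ qf A v) :
    A.PosSemidef :=
  .of_dotProduct_mulVec_nonneg hA fun v => by
    rw [IsHermitian.dotProduct_eq_qf hA]; exact_mod_cast h v

/-- Complex polarization: the forms at `v + w` and `v + I • w` recover the sesquilinear form. -/
lemma eq_of_qf_eq {A B : Matrix ι ι ℂ} (hA : A.IsHermitian) (hB : B.IsHermitian)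
    (h : ∀ v, qf A v = qf B v) : A = B := by
  classical
  have key : ∀ v w, star v ⬝ᵥ (A - B) *ᵥ w = 0 := by
    intro v w
    set X := A - B
    have hX : X.IsHermitian := hA.sub hB
    have h0 : ∀ v, star v ⬝ᵥ X *ᵥ v = 0 := fun v => by
      rw [IsHermitian.dotProduct_eq_qf hX, qf_sub, h, sub_self, Complex.ofReal_zero]
    have h1 := h0 (v + w)
    have h2 := h0 (v + Complex.I • w)
    simp only [star_add, star_smul, mulVec_add, mulVec_smul, add_dotProduct, dotProduct_add,
      smul_dotProduct, dotProduct_smul, h0, smul_eq_mul, zero_add, add_zero, mul_zero] at h1 h2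
    have h3 : star Complex.I = -Complex.I := Complex.conj_I
    rw [h3] at h2
    linear_combination (1/2 : ℂ) * h1 - (Complex.I / 2) * h2 + (1/2 : ℂ) * (star v ⬝ᵥ X *ᵥ w - star w ⬝ᵥ X *ᵥ v) * Complex.I_sq
  ext i j
  have := key (Pi.single i 1) (Pi.single j 1)
  simpa [sub_eq_zero] using this

end Basic

/-! ### Inverses of coercive matrices and rank one perturbations -/

section Coercive

variable {ι : Type*} [Fintype ι]

lemma posDef_of_coercive {D : Matrix ι ι ℂ} {τ : ℝ} (hD : D.IsHermitian) (hτ : 0 < τ) (h : ∀ v, τ * nsq v ≤ qf D v) :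
    D.PosDef :=
  .of_dotProduct_mulVec_pos hD fun {v} hv => by
    rw [IsHermitian.dotProduct_eq_qf hD]
    have : 0 < nsq v := by
      refine lt_of_le_of_ne (nsq_nonneg v) fun h0 => hv ?_
      rw [nsq, eq_comm, Finset.sum_eq_zero_iff_of_nonneg fun _ _ => sq_nonneg _] at h0
      ext i
      simpa using h0 i (Finset.mem_univ i)
    exact_mod_cast (mul_pos hτ this).trans_le (h v)

variable [DecidableEq ι] {D : Matrix ι ι ℂ} {τ : ℝ}

lemma PosDef.mul_inv_self (hD : D.PosDef) : D * D⁻¹ = 1 :=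
  mul_nonsing_inv _ ((isUnit_iff_isUnit_det _).1 hD.isUnit)

lemma PosDef.inv_mul_self (hD : D.PosDef) : D⁻¹ * D = 1 :=
  nonsing_inv_mul _ ((isUnit_iff_isUnit_det _).1 hD.isUnit)

/-- With `w = D⁻¹ v`, coercivity and Cauchy–Schwarz give `τ |w|² ≤ |w| |v|`. This is the operator
norm bound for the inverse. -/
lemma nsq_inv_mulVec_le (hD : D.IsHermitian) (hτ : 0 < τ) (h : ∀ v, τ * nsq v ≤ qf D v)
    (v : ι → ℂ) : nsq (D⁻¹ *ᵥ v) ≤ (1 / τ) ^ 2 * nsq v := by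
  set w := D⁻¹ *ᵥ v
  have hw : D *ᵥ w = v := by
    rw [mulVec_mulVec, PosDef.mul_inv_self (posDef_of_coercive hD hτ h), one_mulVec]
  have h1 : τ * nsq w ≤ √(nsq w) * √(nsq v) := by
    refine (h w).trans ?_
    rw [qf, hw]
    refine (Complex.re_le_norm _).trans ((norm_dotProduct_le _ _).trans_eq ?_)
    rw [nsq_star]
  have h2 : τ * √(nsq w) ≤ √(nsq v) := by
    rcases (Real.sqrt_nonneg (nsq w)).eq_or_lt with h0 | h0
    · rw [← h0, mul_zero]; exact Real.sqrt_nonneg _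
    · nth_rw 1 [← Real.mul_self_sqrt (nsq_nonneg w)] at h1
      nlinarith
  have h3 : (τ * √(nsq w)) ^ 2 ≤ √(nsq v) ^ 2 := by gcongr
  rw [mul_pow, Real.sq_sqrt (nsq_nonneg _), Real.sq_sqrt (nsq_nonneg _)] at h3
  rw [div_pow, one_pow, one_div, ← div_eq_inv_mul, le_div_iff₀ (by positivity)]
  linarith

lemma sum_norm_sq_inv_col_le (hD : D.IsHermitian) (hτ : 0 < τ) (h : ∀ v, τ * nsq v ≤ qf D v)
    (q : ι) : ∑ p, ‖D⁻¹ p q‖ ^ 2 ≤ (1 / τ) ^ 2 := by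
  have := nsq_inv_mulVec_le hD hτ h (Pi.single q 1)
  have h1 : nsq (Pi.single q 1 : ι → ℂ) = 1 := by
    rw [nsq, Finset.sum_eq_single q] <;> simp +contextual
  rw [h1, mul_one] at this
  simpa [nsq] using this

lemma sum_norm_sq_inv_row_le (hD : D.IsHermitian) (hτ : 0 < τ) (h : ∀ v, τ * nsq v ≤ qf D v)
    (p : ι) : ∑ q, ‖D⁻¹ p q‖ ^ 2 ≤ (1 / τ) ^ 2 := by
  refine le_trans (le_of_eq ?_) (sum_norm_sq_inv_col_le hD hτ h p)
  refine Finset.sum_congr rfl fun q _ => ?_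
  rw [← hD.inv.apply p q, norm_star]

lemma norm_inv_apply_le (hD : D.IsHermitian) (hτ : 0 < τ) (h : ∀ v, τ * nsq v ≤ qf D v)
    (p q : ι) : ‖D⁻¹ p q‖ ≤ 1 / τ := by
  refine le_of_sq_le_sq ?_ (by positivity)
  exact (Finset.single_le_sum (f := fun q => ‖D⁻¹ p q‖ ^ 2) (fun _ _ => sq_nonneg _)
    (Finset.mem_univ q)).trans (sum_norm_sq_inv_row_le hD hτ h p)

/-- Sherman–Morrison: `E` maps `D⁻¹ b` to a multiple of `b`. -/
lemma rankOne_inv_mulVec {E : Matrix ι ι ℂ} (hD : D.PosDef) (hE : E.PosDef) {b : ι → ℂ} {r : ℝ}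
    (hr : 0 ≤ r) (h : E = D + (r : ℂ) • vecMulVec b (star b)) :
    E⁻¹ *ᵥ b = (1 + ((r * qf D⁻¹ b : ℝ) : ℂ))⁻¹ • (D⁻¹ *ᵥ b) := by
  have hq : (1 + ((r * qf D⁻¹ b : ℝ) : ℂ)) ≠ 0 := by
    have : 0 ≤ r * qf D⁻¹ b := mul_nonneg hr (qf_nonneg hD.inv.posSemidef b)
    exact_mod_cast (by linarith : (1 + r * qf D⁻¹ b) ≠ 0)
  have h1 : E *ᵥ (D⁻¹ *ᵥ b) = (1 + ((r * qf D⁻¹ b : ℝ) : ℂ)) • b := by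
    rw [h, add_mulVec, mulVec_mulVec, PosDef.mul_inv_self hD, one_mulVec, smul_mulVec,
      vecMulVec_mulVec, IsHermitian.dotProduct_eq_qf hD.inv.isHermitian, add_smul, one_smul]
    ext i
    simp [mul_comm, mul_left_comm]
  have h2 : D⁻¹ *ᵥ b = (1 + ((r * qf D⁻¹ b : ℝ) : ℂ)) • (E⁻¹ *ᵥ b) := by
    rw [← mulVec_smul, ← h1, mulVec_mulVec, PosDef.inv_mul_self hE, one_mulVec]
  rw [h2, smul_smul, inv_mul_cancel₀ hq, one_smul]

lemma inv_sub_rankOne_inv {E : Matrix ι ι ℂ} (hD : D.PosDef) (hE : E.PosDef) {b : ι → ℂ} {r : ℝ}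
    (hr : 0 ≤ r) (h : E = D + (r : ℂ) • vecMulVec b (star b)) :
    D⁻¹ - E⁻¹ = ((r * (1 + r * qf D⁻¹ b)⁻¹ : ℝ) : ℂ) •
      vecMulVec (D⁻¹ *ᵥ b) (star (D⁻¹ *ᵥ b)) := by
  have h1 : D⁻¹ - E⁻¹ = E⁻¹ * (E - D) * D⁻¹ := by
    rw [mul_sub, sub_mul, PosDef.inv_mul_self hE, one_mul, mul_assoc, PosDef.mul_inv_self hD,
      mul_one]
  have h2 : E - D = (r : ℂ) • vecMulVec b (star b) := by rw [h, add_sub_cancel_left]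
  rw [h1, h2, mul_smul_comm, smul_mul_assoc, mul_vecMulVec, vecMulVec_mul,
    rankOne_inv_mulVec hD hE hr h, star_mulVec, hD.inv.isHermitian.eq, smul_vecMulVec, smul_smul]
  push_cast
  rfl

/-- Coercivity at `D⁻¹ b` gives `τ |D⁻¹ b|² ≤ b^* D⁻¹ b`, so the denominator absorbs the numerator.
The bound does not depend on `b`: users with huge gains cost no more than others. -/
lemma rankOne_coeff_mul_nsq_le (hD : D.IsHermitian) (hτ : 0 < τ) (h : ∀ v, τ * nsq v ≤ qf D v)
    (b : ι → ℂ) {r : ℝ} (hr : 0 ≤ r) :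
    r * (1 + r * qf D⁻¹ b)⁻¹ * nsq (D⁻¹ *ᵥ b) ≤ 1 / τ := by
  have hP := posDef_of_coercive hD hτ h
  have h0 := qf_nonneg hP.inv.posSemidef b
  have h1 : τ * nsq (D⁻¹ *ᵥ b) ≤ qf D⁻¹ b := by
    refine (h _).trans_eq ?_
    rw [qf, mulVec_mulVec, PosDef.mul_inv_self hP, one_mulVec, star_mulVec, hP.inv.isHermitian.eq,
      ← dotProduct_mulVec, qf]
  have h2 : 0 < 1 + r * qf D⁻¹ b := by positivity
  have h3 := nsq_nonneg (D⁻¹ *ᵥ b)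
  rw [mul_right_comm, ← div_eq_mul_inv, div_le_div_iff₀ h2 hτ]
  nlinarith [mul_le_mul_of_nonneg_left h1 hr]

end Coercive

/-! ### The normalized resolvent of the interference matrix -/

section Resolvent

variable {L N : ℕ} {κ : Type*} [Fintype κ]

/-- The tensor product of a gain vector and a signature. -/
def bvec (a : Fin L → ℂ) (x : Fin N → ℂ) : Fin L × Fin N → ℂ := fun p => a p.1 * x p.2

/-- The covariance matrix of a system with gain vectors `a k` and signatures `x k`. -/
def cov (σ : ℝ) (a : κ → Fin L → ℂ) (x : κ → Fin N → ℂ) :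
    Matrix (Fin L × Fin N) (Fin L × Fin N) ℂ :=
  ((1 / (N : ℝ) : ℝ) : ℂ) • ∑ k, vecMulVec (bvec (a k) (x k)) (star (bvec (a k) (x k))) +
    ((σ ^ 2 : ℝ) : ℂ) • (1 : Matrix (Fin L × Fin N) (Fin L × Fin N) ℂ)

/-- The block `(l, m)` of a matrix. -/
def block (R : Matrix (Fin L × Fin N) (Fin L × Fin N) ℂ) (l m : Fin L) : Matrix (Fin N) (Fin N) ℂ :=
  Matrix.of fun i j => R (l, i) (m, j)

/-- The matrix of the normalized traces of the blocks. -/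
def blockTrace (R : Matrix (Fin L × Fin N) (Fin L × Fin N) ℂ) : Matrix (Fin L) (Fin L) ℂ :=
  Matrix.of fun l m => ((1 / (N : ℝ) : ℝ) : ℂ) * ∑ i, R (l, i) (m, i)

/-- The matrix of the normalized quadratic forms of the blocks. -/
def blockForm (R : Matrix (Fin L × Fin N) (Fin L × Fin N) ℂ) (y : Fin N → ℂ) :
    Matrix (Fin L) (Fin L) ℂ :=
  Matrix.of fun l m => ((1 / (N : ℝ) : ℝ) : ℂ) * (star y ⬝ᵥ block R l m *ᵥ y)

lemma cov_isHermitian (σ : ℝ) (a : κ → Fin L → ℂ) (x : κ → Fin N → ℂ) :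
    (cov σ a x).IsHermitian := by
  refine IsHermitian.add (IsHermitian.smul ?_ ?_) (IsHermitian.smul isHermitian_one ?_)
  · exact (posSemidef_sum _ fun k _ => posSemidef_vecMulVec_self_star _).isHermitian
  · exact Complex.conj_ofReal _
  · exact Complex.conj_ofReal _

lemma qf_sum {ι : Type*} [Fintype ι] {κ : Type*} (S : Finset κ) (A : κ → Matrix ι ι ℂ) (v : ι → ℂ) :
    qf (∑ k ∈ S, A k) v = ∑ k ∈ S, qf (A k) v := by
  simp [qf, sum_mulVec, dotProduct_sum]

lemma cov_coercive (σ : ℝ) (a : κ → Fin L → ℂ) (x : κ → Fin N → ℂ) (v : Fin L × Fin N → ℂ) :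
    σ ^ 2 * nsq v ≤ qf (cov σ a x) v := by
  rw [cov, qf_add, qf_smul, qf_smul, qf_one, qf_sum]
  have : 0 ≤ ∑ k, qf (vecMulVec (bvec (a k) (x k)) (star (bvec (a k) (x k)))) v :=
    Finset.sum_nonneg fun k _ => qf_nonneg (posSemidef_vecMulVec_self_star _) v
  have h2 : 0 ≤ 1 / (N : ℝ) * ∑ k, qf (vecMulVec (bvec (a k) (x k)) (star (bvec (a k) (x k)))) v := by
    positivity
  linarith

lemma cov_posDef {σ : ℝ} (hσ : 0 < σ) (a : κ → Fin L → ℂ) (x : κ → Fin N → ℂ) :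
    (cov σ a x).PosDef :=
  posDef_of_coercive (cov_isHermitian σ a x) (by positivity) (cov_coercive σ a x)

lemma bvec_zero (x : Fin N → ℂ) : bvec (0 : Fin L → ℂ) x = 0 := by
  ext; simp [bvec]

/-- A user is removed by setting its gain vector to zero, which leaves the index type unchanged. -/
lemma cov_eq_update_add [DecidableEq κ] (σ : ℝ) (a : κ → Fin L → ℂ) (x : κ → Fin N → ℂ) (k : κ) :
    cov σ a x = cov σ (Function.update a k 0) x +
      ((1 / (N : ℝ) : ℝ) : ℂ) • vecMulVec (bvec (a k) (x k)) (star (bvec (a k) (x k))) := by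
  simp only [cov]
  rw [add_right_comm, ← smul_add]
  congr 2
  rw [← Finset.add_sum_erase _ _ (Finset.mem_univ k), ← Finset.add_sum_erase _ (a := k) _ (Finset.mem_univ k),
    Function.update_self, bvec_zero]
  simp only [star_zero, vecMulVec_zero, zero_add]
  rw [add_comm]
  congr 1
  refine Finset.sum_congr rfl fun j hj => ?_
  rw [Function.update_of_ne (Finset.ne_of_mem_erase hj)]

lemma cov_congr {σ : ℝ} {a a' : κ → Fin L → ℂ} {x x' : κ → Fin N → ℂ}
    (h : ∀ k, bvec (a k) (x k) = bvec (a' k) (x' k)) : cov σ a x = cov σ a' x' := by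
  simp only [cov, h]

/-- This is how independence enters: the matrix without user `k` does not see the signature `x k`,
which can then be integrated alone. -/
lemma cov_update_zero [DecidableEq κ] (σ : ℝ) (a : κ → Fin L → ℂ) (x : κ → Fin N → ℂ) (k : κ)
    (y : Fin N → ℂ) :
    cov σ (Function.update a k 0) (Function.update x k y) = cov σ (Function.update a k 0) x := by
  refine cov_congr fun j => ?_
  by_cases hj : j = k
  · subst hj; simp [bvec_zero]
  · simp [hj]

lemma norm_block_sum_le (w : Fin L × Fin N → ℂ) (l m : Fin L) :
    ‖∑ i, w (l, i) * star (w (m, i))‖ ≤ nsq w := by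
  have h : ∀ i, ‖w (l, i) * star (w (m, i))‖ ≤ ‖w (l, i)‖ ^ 2 / 2 + ‖w (m, i)‖ ^ 2 / 2 := fun i => by
    rw [norm_mul, norm_star]
    nlinarith [sq_nonneg (‖w (l, i)‖ - ‖w (m, i)‖)]
  have h2 : ∀ l, ∑ i, ‖w (l, i)‖ ^ 2 ≤ nsq w := fun l => by
    rw [nsq, Fintype.sum_prod_type]
    exact Finset.single_le_sum (f := fun l => ∑ i, ‖w (l, i)‖ ^ 2)
      (fun _ _ => Finset.sum_nonneg fun _ _ => sq_nonneg _) (Finset.mem_univ l)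
  refine (norm_sum_le _ _).trans ((Finset.sum_le_sum fun i _ => h i).trans ?_)
  rw [Finset.sum_add_distrib, ← Finset.sum_div, ← Finset.sum_div]
  linarith [h2 l, h2 m]

/-- The matrix of normalized block traces of the resolvent. -/
def resTrace (σ : ℝ) (a : κ → Fin L → ℂ) (x : κ → Fin N → ℂ) : Matrix (Fin L) (Fin L) ℂ :=
  blockTrace (cov σ a x)⁻¹

/-- The difference of the inverses has rank one, and the sums over its blocks are controlled by
`rankOne_coeff_mul_nsq_le`. -/
lemma norm_resTrace_sub_update_le [DecidableEq κ] {σ : ℝ} (hσ : 0 < σ) (a : κ → Fin L → ℂ)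
    (x : κ → Fin N → ℂ) (k : κ) (l m : Fin L) :
    ‖resTrace σ (Function.update a k 0) x l m - resTrace σ a x l m‖ ≤ 1 / (N * σ ^ 2) := by
  set D := cov σ (Function.update a k 0) x
  set b := bvec (a k) (x k)
  have hr : 0 ≤ 1 / (N : ℝ) := by positivity
  have h := inv_sub_rankOne_inv (cov_posDef hσ (Function.update a k 0) x) (cov_posDef hσ a x) hr
    (cov_eq_update_add σ a x k)
  have h2 := rankOne_coeff_mul_nsq_le (cov_isHermitian σ (Function.update a k 0) x)
    (by positivity : 0 < σ ^ 2) (cov_coercive σ _ x) b hr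
  have h3 : resTrace σ (Function.update a k 0) x l m - resTrace σ a x l m =
      ((1 / (N : ℝ) : ℝ) : ℂ) * (((1 / (N : ℝ) * (1 + 1 / (N : ℝ) * qf D⁻¹ b)⁻¹ : ℝ) : ℂ) *
        ∑ i, (D⁻¹ *ᵥ b) (l, i) * star ((D⁻¹ *ᵥ b) (m, i))) := by
    simp only [resTrace, blockTrace, of_apply]
    rw [← mul_sub, ← Finset.sum_sub_distrib, Finset.mul_sum _ _ (((1 / (N : ℝ) * _ : ℝ) : ℂ))]
    congr 1
    refine Finset.sum_congr rfl fun i _ => ?_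
    rw [← Matrix.sub_apply, h]
    rfl
  have h0 := qf_nonneg (cov_posDef hσ (Function.update a k 0) x).inv.posSemidef b
  rw [h3, norm_mul, norm_mul, Complex.norm_real, Complex.norm_real, Real.norm_of_nonneg hr,
    Real.norm_of_nonneg (by positivity)]
  calc _ ≤ 1 / (N : ℝ) * (1 / (N : ℝ) * (1 + 1 / (N : ℝ) * qf D⁻¹ b)⁻¹ * nsq (D⁻¹ *ᵥ b)) := by
        gcongr
        exact norm_block_sum_le _ l m
    _ ≤ 1 / (N : ℝ) * (1 / σ ^ 2) := by gcongr
    _ = _ := by rw [one_div_mul_one_div]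

/-- The users in `S` are deleted one at a time from both systems, whence the factor 2; what remains
is the same matrix. -/
lemma norm_resTrace_sub_le {σ : ℝ} (hσ : 0 < σ) (S : Finset κ) {a a' : κ → Fin L → ℂ}
    {x x' : κ → Fin N → ℂ} (h : ∀ k ∉ S, bvec (a k) (x k) = bvec (a' k) (x' k)) (l m : Fin L) :
    ‖resTrace σ a x l m - resTrace σ a' x' l m‖ ≤ S.card * (2 / (N * σ ^ 2)) := by
  classical
  induction S using Finset.induction_on generalizing a a' with
  | empty =>
    rw [resTrace, resTrace, cov_congr fun k => h k (Finset.notMem_empty k)]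
    simp
  | insert k S hk ih =>
    have h1 := norm_resTrace_sub_update_le hσ a x k l m
    have h2 := norm_resTrace_sub_update_le hσ a' x' k l m
    have h3 := @ih (Function.update a k 0) (Function.update a' k 0) fun j hj => by
      by_cases hjk : j = k
      · subst hjk; simp [bvec_zero]
      · simpa [hjk] using h j (by simp [hjk, hj])
    rw [norm_sub_rev] at h1
    rw [Finset.card_insert_of_notMem hk]
    push_cast
    have h4 := norm_add₃_le (a := resTrace σ a x l m - resTrace σ (Function.update a k 0) x l m)
      (b := resTrace σ (Function.update a k 0) x l m - resTrace σ (Function.update a' k 0) x' l m)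
      (c := resTrace σ (Function.update a' k 0) x' l m - resTrace σ a' x' l m)
    have h5 : 2 / ((N : ℝ) * σ ^ 2) = 1 / (N * σ ^ 2) + 1 / (N * σ ^ 2) := by ring
    calc _ = ‖_‖ := by congr 1; ring
      _ ≤ _ := h4
      _ ≤ _ := by rw [add_mul, one_mul]; linarith

lemma norm_resTrace_le {σ : ℝ} (hσ : 0 < σ) (a : κ → Fin L → ℂ) (x : κ → Fin N → ℂ) (l m : Fin L) :
    ‖resTrace σ a x l m‖ ≤ 1 / σ ^ 2 := by
  have h : ‖∑ i : Fin N, (cov σ a x)⁻¹ (l, i) (m, i)‖ ≤ N * (1 / σ ^ 2) := by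
    refine (norm_sum_le_of_le _ fun i _ => norm_inv_apply_le (cov_isHermitian σ a x)
      (by positivity : 0 < σ ^ 2) (cov_coercive σ a x) (l, i) (m, i)).trans_eq ?_
    simp
  simp only [resTrace, blockTrace, of_apply]
  rw [norm_mul, Complex.norm_real, Real.norm_of_nonneg (by positivity)]
  rcases Nat.eq_zero_or_pos N with rfl | hN
  · simp; positivity
  · have : (0 : ℝ) < N := by exact_mod_cast hN
    calc _ ≤ 1 / (N : ℝ) * (N * (1 / σ ^ 2)) := by gcongr
      _ = _ := by field_simp

lemma bvec_dotProduct_mulVec (R : Matrix (Fin L × Fin N) (Fin L × Fin N) ℂ) (y : Fin N → ℂ)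
    (α : Fin L → ℂ) :
    ((1 / (N : ℝ) : ℝ) : ℂ) * (star (bvec α y) ⬝ᵥ R *ᵥ bvec α y) =
      star α ⬝ᵥ blockForm R y *ᵥ α := by
  simp only [blockForm, of_apply, Fintype.sum_prod_type, dotProduct, mulVec, block, Pi.star_apply,
    bvec, star_mul', Finset.mul_sum, Finset.sum_mul]
  refine Finset.sum_congr rfl fun l _ => ?_
  rw [Finset.sum_comm]
  refine Finset.sum_congr rfl fun m _ => ?_
  refine Finset.sum_congr rfl fun i _ => ?_
  refine Finset.sum_congr rfl fun j _ => ?_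
  ring

lemma blockForm_isHermitian {R : Matrix (Fin L × Fin N) (Fin L × Fin N) ℂ} (hR : R.IsHermitian)
    (y : Fin N → ℂ) : (blockForm R y).IsHermitian := by
  ext l m
  have h : (block R m l)ᴴ = block R l m := by
    ext i j
    exact hR.apply (l, i) (m, j)
  rw [conjTranspose_apply]
  simp only [blockForm, of_apply]
  rw [star_mul', ← h, star_dotProduct, star_mulVec, dotProduct_mulVec, star_star]
  congr 1
  exact Complex.conj_ofReal _

lemma blockForm_posSemidef {R : Matrix (Fin L × Fin N) (Fin L × Fin N) ℂ} (hR : R.PosSemidef)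
    (y : Fin N → ℂ) : (blockForm R y).PosSemidef := by
  refine .of_dotProduct_mulVec_nonneg (blockForm_isHermitian hR.isHermitian y) fun α => ?_
  rw [← bvec_dotProduct_mulVec]
  refine mul_nonneg ?_ (hR.dotProduct_mulVec_nonneg _)
  rw [Complex.zero_le_real]; positivity

lemma blockTrace_posSemidef {R : Matrix (Fin L × Fin N) (Fin L × Fin N) ℂ} (hR : R.PosSemidef) :
    (blockTrace R).PosSemidef := by
  have h : blockTrace R = ((1 / (N : ℝ) : ℝ) : ℂ) • ∑ i, R.submatrix (fun l => (l, i)) (fun l => (l, i)) := by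
    ext l m
    simp [blockTrace, Matrix.sum_apply]
  rw [h]
  refine PosSemidef.smul (posSemidef_sum _ fun i _ => hR.submatrix _) ?_
  rw [Complex.zero_le_real]; positivity

lemma resTrace_posSemidef {σ : ℝ} (hσ : 0 < σ) (a : κ → Fin L → ℂ) (x : κ → Fin N → ℂ) :
    (resTrace σ a x).PosSemidef :=
  blockTrace_posSemidef (cov_posDef hσ a x).inv.posSemidef

/-! ### The approximate fixed point equation -/

/-- The matrix `A α α^* / (1 + α^* A α)`. -/
def rankOneTerm (A : Matrix (Fin L) (Fin L) ℂ) (α : Fin L → ℂ) : Matrix (Fin L) (Fin L) ℂ :=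
  (1 + star α ⬝ᵥ A *ᵥ α)⁻¹ • vecMulVec (A *ᵥ α) (star α)

/-- The defect of `A` in the fixed point equation of the gain vectors `a k`. -/
def defect (σ : ℝ) (N : ℕ) (a : κ → Fin L → ℂ) (A : Matrix (Fin L) (Fin L) ℂ) :
    Matrix (Fin L) (Fin L) ℂ :=
  1 - ((σ ^ 2 : ℝ) : ℂ) • A - ((1 / (N : ℝ) : ℝ) : ℂ) • ∑ k, rankOneTerm A (a k)

/-- The matrix of quadratic forms of user `k` in the resolvent of the other users. -/
def userForm [DecidableEq κ] (σ : ℝ) (a : κ → Fin L → ℂ) (x : κ → Fin N → ℂ) (k : κ) :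
    Matrix (Fin L) (Fin L) ℂ :=
  blockForm (cov σ (Function.update a k 0) x)⁻¹ (x k)

lemma userForm_posSemidef [DecidableEq κ] {σ : ℝ} (hσ : 0 < σ) (a : κ → Fin L → ℂ)
    (x : κ → Fin N → ℂ) (k : κ) : (userForm σ a x k).PosSemidef :=
  blockForm_posSemidef (cov_posDef hσ _ x).inv.posSemidef _

lemma blockTrace_add (R S : Matrix (Fin L × Fin N) (Fin L × Fin N) ℂ) :
    blockTrace (R + S) = blockTrace R + blockTrace S := by
  ext l m
  simp [blockTrace, Finset.sum_add_distrib, mul_add]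

lemma blockTrace_smul (c : ℂ) (R : Matrix (Fin L × Fin N) (Fin L × Fin N) ℂ) :
    blockTrace (c • R) = c • blockTrace R := by
  ext l m
  simp [blockTrace, Finset.mul_sum, mul_left_comm]

lemma blockTrace_sum (R : κ → Matrix (Fin L × Fin N) (Fin L × Fin N) ℂ) :
    blockTrace (∑ k, R k) = ∑ k, blockTrace (R k) := by
  ext l m
  simp only [blockTrace, of_apply, Matrix.sum_apply]
  rw [Finset.sum_comm, Finset.mul_sum]

lemma blockTrace_one (hN : N ≠ 0) :
    blockTrace (1 : Matrix (Fin L × Fin N) (Fin L × Fin N) ℂ) = 1 := by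
  ext l m
  simp only [blockTrace, of_apply, one_apply, Prod.mk.injEq, and_true, Finset.sum_const,
    Finset.card_univ, Fintype.card_fin]
  have : (N : ℂ) ≠ 0 := by exact_mod_cast hN
  split_ifs <;> simp [this]

lemma blockTrace_vecMulVec_bvec (R : Matrix (Fin L × Fin N) (Fin L × Fin N) ℂ) (α : Fin L → ℂ)
    (y : Fin N → ℂ) : blockTrace (vecMulVec (R *ᵥ bvec α y) (star (bvec α y))) =
      vecMulVec (blockForm R y *ᵥ α) (star α) := by
  ext l m
  simp only [blockTrace, blockForm, of_apply, Fintype.sum_prod_type, dotProduct, mulVec, block,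
    Pi.star_apply, vecMulVec_apply, bvec, star_mul', Finset.mul_sum, Finset.sum_mul]
  rw [Finset.sum_comm]
  refine Finset.sum_congr rfl fun n _ => ?_
  refine Finset.sum_congr rfl fun i _ => ?_
  refine Finset.sum_congr rfl fun j _ => ?_
  ring

/-- Block traces of `D⁻¹ D = 1`: the identity part of `D` gives the trace matrix, and
Sherman–Morrison turns each rank one part into a term involving only the resolvent without that
user. -/
lemma one_eq_resTrace_add [DecidableEq κ] {σ : ℝ} (hσ : 0 < σ) (hN : N ≠ 0) (a : κ → Fin L → ℂ)
    (x : κ → Fin N → ℂ) :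
    (1 : Matrix (Fin L) (Fin L) ℂ) = ((σ ^ 2 : ℝ) : ℂ) • resTrace σ a x +
      ((1 / (N : ℝ) : ℝ) : ℂ) • ∑ k, rankOneTerm (userForm σ a x k) (a k) := by
  set D := cov σ a x with hDdef
  have h1 : D⁻¹ * D = 1 := PosDef.inv_mul_self (cov_posDef hσ a x)
  nth_rw 2 [hDdef] at h1
  rw [cov, mul_add, mul_smul_comm, mul_smul_comm, mul_one, Finset.mul_sum] at h1
  have h2 := congrArg blockTrace h1
  rw [blockTrace_one hN, blockTrace_add, blockTrace_smul, blockTrace_smul, blockTrace_sum] at h2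
  rw [← h2, add_comm]
  congr 2
  refine Finset.sum_congr rfl fun k _ => ?_
  have hr : 0 ≤ 1 / (N : ℝ) := by positivity
  have hP := cov_posDef hσ (Function.update a k 0) x
  rw [mul_vecMulVec, rankOne_inv_mulVec hP (cov_posDef hσ a x) hr (cov_eq_update_add σ a x k),
    smul_vecMulVec, blockTrace_smul, blockTrace_vecMulVec_bvec, Complex.ofReal_mul,
    ← IsHermitian.dotProduct_eq_qf hP.inv.isHermitian, bvec_dotProduct_mulVec]
  rfl

lemma norm_mulVec_le {A : Matrix (Fin L) (Fin L) ℂ} {α : Fin L → ℂ} {δ M : ℝ}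
    (hA : ∀ l m, ‖A l m‖ ≤ δ) (hα : ∀ l, ‖α l‖ ≤ M) (hδ : 0 ≤ δ) (l : Fin L) :
    ‖(A *ᵥ α) l‖ ≤ L * (δ * M) := by
  refine (norm_sum_le_of_le _ fun m _ => ?_).trans_eq (b := ∑ _m : Fin L, δ * M) ?_
  · rw [norm_mul]; exact mul_le_mul (hA l m) (hα m) (norm_nonneg _) hδ
  · simp

lemma norm_star_dotProduct_mulVec_le {A : Matrix (Fin L) (Fin L) ℂ} {α : Fin L → ℂ} {δ M : ℝ}
    (hA : ∀ l m, ‖A l m‖ ≤ δ) (hα : ∀ l, ‖α l‖ ≤ M) (hδ : 0 ≤ δ) (hM : 0 ≤ M) :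
    ‖star α ⬝ᵥ A *ᵥ α‖ ≤ L * (M * (L * (δ * M))) := by
  refine (norm_sum_le_of_le _ fun m _ => ?_).trans_eq (b := ∑ _m : Fin L, M * (L * (δ * M))) ?_
  · rw [norm_mul, Pi.star_apply, norm_star]
    exact mul_le_mul (hα m) (norm_mulVec_le hA hα hδ m) (norm_nonneg _) hM
  · simp

lemma rankOneTerm_apply (A : Matrix (Fin L) (Fin L) ℂ) (α : Fin L → ℂ) (l m : Fin L) :
    rankOneTerm A α l m = (A *ᵥ α) l * conj (α m) / (1 + star α ⬝ᵥ A *ᵥ α) := by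
  simp [rankOneTerm, vecMulVec_apply, div_eq_inv_mul]

lemma one_le_norm_denom {A : Matrix (Fin L) (Fin L) ℂ} (hA : A.PosSemidef) (α : Fin L → ℂ) :
    1 ≤ ‖1 + star α ⬝ᵥ A *ᵥ α‖ := by
  have h := qf_nonneg hA α
  rw [IsHermitian.dotProduct_eq_qf hA.isHermitian, ← Complex.ofReal_one, ← Complex.ofReal_add,
    Complex.norm_real, Real.norm_of_nonneg (by positivity)]
  linarith

lemma denom_ne_zero {A : Matrix (Fin L) (Fin L) ℂ} (hA : A.PosSemidef) (α : Fin L → ℂ) :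
    1 + star α ⬝ᵥ A *ᵥ α ≠ 0 :=
  norm_pos_iff.1 (one_pos.trans_le (one_le_norm_denom hA α))

lemma norm_rankOneTerm_le {A : Matrix (Fin L) (Fin L) ℂ} (hA : A.PosSemidef) {α : Fin L → ℂ}
    {τ M : ℝ} (hτ : 0 ≤ τ) (hM : 0 ≤ M) (hAτ : ∀ l m, ‖A l m‖ ≤ τ) (hα : ∀ l, ‖α l‖ ≤ M)
    (l m : Fin L) : ‖rankOneTerm A α l m‖ ≤ L * (τ * M) * M := by
  rw [rankOneTerm_apply, norm_div, norm_mul, RCLike.norm_conj]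
  refine (div_le_self (by positivity) (one_le_norm_denom hA α)).trans ?_
  exact mul_le_mul (norm_mulVec_le hAτ hα hτ l) (hα m) (norm_nonneg _) (by positivity)

/-- A Lipschitz constant of `rankOneTerm · α` for the entrywise maximum norm. -/
def lipConst (L : ℕ) (τ M : ℝ) : ℝ := L * M * M + L * (τ * M) * M * (L * (M * (L * M)))

lemma lipConst_nonneg (L : ℕ) {τ M : ℝ} (hτ : 0 ≤ τ) (hM : 0 ≤ M) : 0 ≤ lipConst L τ M := by
  unfold lipConst; positivity

/-- Semidefiniteness keeps both denominators at least 1 in modulus. Only `B` needs an entrywise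
bound; `A` enters through the difference, as it must, since the user forms are not bounded. -/
lemma norm_rankOneTerm_sub_le {A B : Matrix (Fin L) (Fin L) ℂ} (hA : A.PosSemidef)
    (hB : B.PosSemidef) {α : Fin L → ℂ} {τ M δ : ℝ} (hτ : 0 ≤ τ) (hM : 0 ≤ M) (hδ : 0 ≤ δ)
    (hBτ : ∀ l m, ‖B l m‖ ≤ τ) (hα : ∀ l, ‖α l‖ ≤ M) (hAB : ∀ l m, ‖A l m - B l m‖ ≤ δ)
    (l m : Fin L) : ‖rankOneTerm A α l m - rankOneTerm B α l m‖ ≤ lipConst L τ M * δ := by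
  set p := star α ⬝ᵥ A *ᵥ α
  set q := star α ⬝ᵥ B *ᵥ α
  have hp := one_le_norm_denom hA α
  have hq := one_le_norm_denom hB α
  have hp0 : 1 + p ≠ 0 := denom_ne_zero hA α
  have hq0 : 1 + q ≠ 0 := denom_ne_zero hB α
  have h1 : ‖((A - B) *ᵥ α) l‖ ≤ L * (δ * M) := norm_mulVec_le hAB hα hδ l
  have h2 : ‖q - p‖ ≤ L * (M * (L * (δ * M))) := by
    rw [norm_sub_rev, ← dotProduct_sub, ← sub_mulVec]
    exact norm_star_dotProduct_mulVec_le hAB hα hδ hM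
  have h3 : ‖(B *ᵥ α) l‖ ≤ L * (τ * M) := norm_mulVec_le hBτ hα hτ l
  have h4 : rankOneTerm A α l m - rankOneTerm B α l m =
      ((A - B) *ᵥ α) l * conj (α m) / (1 + p) +
        (B *ᵥ α) l * conj (α m) * (q - p) / ((1 + p) * (1 + q)) := by
    rw [rankOneTerm_apply, rankOneTerm_apply, sub_mulVec, Pi.sub_apply]
    change _ / (1 + p) - _ / (1 + q) = _
    field_simp
    ring
  rw [h4]
  refine (norm_add_le _ _).trans ?_
  have e1 : ‖((A - B) *ᵥ α) l * conj (α m) / (1 + p)‖ ≤ L * (δ * M) * M := by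
    rw [norm_div, norm_mul, RCLike.norm_conj]
    refine (div_le_self (by positivity) hp).trans ?_
    exact mul_le_mul h1 (hα m) (norm_nonneg _) (by positivity)
  have e2 : ‖(B *ᵥ α) l * conj (α m) * (q - p) / ((1 + p) * (1 + q))‖ ≤
      L * (τ * M) * M * (L * (M * (L * (δ * M)))) := by
    rw [norm_div, norm_mul, norm_mul, norm_mul, RCLike.norm_conj]
    refine (div_le_self (by positivity) (one_le_mul_of_one_le_of_one_le hp hq)).trans ?_
    exact mul_le_mul (mul_le_mul h3 (hα m) (norm_nonneg _) (by positivity)) h2 (norm_nonneg _)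
      (by positivity)
  refine (add_le_add e1 e2).trans_eq ?_
  unfold lipConst
  ring

end Resolvent

/-! ### The limiting fixed point equation -/

section Antitone

variable {ι : Type*} [Fintype ι]

/-- Completing the square: the form of `A⁻¹` is nonnegative at `θ B v - A v`, and the hypothesis at
`B v` bounds its quadratic term. -/
lemma qf_inv_antitone [DecidableEq ι] {A B : Matrix ι ι ℂ} (hA : A.PosDef) (hB : B.PosDef) {θ : ℝ} (hθ : 0 ≤ θ)
    (h : ∀ v, θ * qf A⁻¹ v ≤ qf B⁻¹ v) (v : ι → ℂ) : θ * qf B v ≤ qf A v := by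
  set w := B *ᵥ v with hw
  have h1 : qf B⁻¹ w = qf B v := by
    rw [qf, hw, mulVec_mulVec, PosDef.inv_mul_self hB, one_mulVec, star_mulVec,
      hB.isHermitian.eq, ← dotProduct_mulVec, qf]
  have h2 : (star v ⬝ᵥ w).re = qf B v := rfl
  have h3 : (star w ⬝ᵥ v).re = qf B v := by
    rw [hw, star_mulVec, hB.isHermitian.eq, ← dotProduct_mulVec, qf]
  have h4 : A⁻¹ *ᵥ (A *ᵥ v) = v := by
    rw [mulVec_mulVec, PosDef.inv_mul_self hA, one_mulVec]
  have h5 : star (A *ᵥ v) ⬝ᵥ A⁻¹ *ᵥ w = star v ⬝ᵥ w := by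
    rw [star_mulVec, hA.isHermitian.eq, ← dotProduct_mulVec, mulVec_mulVec,
      PosDef.mul_inv_self hA, one_mulVec]
  have h6 : (star (A *ᵥ v) ⬝ᵥ v).re = qf A v := by
    rw [star_mulVec, hA.isHermitian.eq, ← dotProduct_mulVec, qf]
  have h7 : qf A⁻¹ ((θ : ℂ) • w - A *ᵥ v) = θ ^ 2 * qf A⁻¹ w - 2 * θ * qf B v + qf A v := by
    have : star (θ : ℂ) = θ := Complex.conj_ofReal θ
    simp only [qf, mulVec_sub, mulVec_smul, star_sub, star_smul, sub_dotProduct, dotProduct_sub,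
      smul_dotProduct, dotProduct_smul, h4, h5, this, smul_eq_mul, Complex.sub_re,
      Complex.re_ofReal_mul, h2, h3, h6]
    ring
  have h8 := qf_nonneg hA.inv.posSemidef ((θ : ℂ) • w - A *ᵥ v)
  have h9 := mul_le_mul_of_nonneg_left (h w) hθ
  rw [h1] at h9
  nlinarith

lemma qf_le_sum_mul_nsq (A : Matrix ι ι ℂ) (v : ι → ℂ) :
    qf A v ≤ (∑ i, ∑ j, ‖A i j‖) * nsq v := by
  refine (Complex.re_le_norm _).trans ?_
  simp only [dotProduct, mulVec, Finset.mul_sum, Finset.sum_mul]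
  refine norm_sum_le_of_le _ fun i _ => norm_sum_le_of_le _ fun j _ => ?_
  rw [norm_mul, norm_mul, Pi.star_apply, norm_star]
  have h1 := norm_sq_le_nsq v i
  have h2 := norm_sq_le_nsq v j
  have h3 : ‖v i‖ * ‖v j‖ ≤ nsq v := by nlinarith [sq_nonneg (‖v i‖ - ‖v j‖)]
  calc _ = ‖A i j‖ * (‖v i‖ * ‖v j‖) := by ring
    _ ≤ _ := by gcongr

/-- A lower eigenvalue bound without spectral theory: bound `A⁻¹` above by its entries and invert
the order. The `+ 1` keeps the constant positive even for an empty index type. -/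
lemma PosDef.exists_nsq_le [DecidableEq ι] {A : Matrix ι ι ℂ} (hA : A.PosDef) :
    ∃ κ > 0, ∀ v, nsq v ≤ κ * qf A v := by
  set s := ∑ i, ∑ j, ‖A⁻¹ i j‖
  have hs : 0 ≤ s := Finset.sum_nonneg fun _ _ => Finset.sum_nonneg fun _ _ => norm_nonneg _
  refine ⟨s + 1, by positivity, fun v => ?_⟩
  have h := qf_inv_antitone hA PosDef.one (θ := (s + 1)⁻¹) (by positivity) (fun v => ?_) v
  · rw [qf_one, inv_mul_le_iff₀ (by positivity)] at h
    exact h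
  · rw [inv_one, qf_one, inv_mul_le_iff₀ (by positivity)]
    have := qf_le_sum_mul_nsq A⁻¹ v
    have := nsq_nonneg v
    nlinarith

end Antitone

/-! ### The right-hand side of the equation, uniqueness and lower bounds -/

section FixedPoint

variable {L : ℕ} {H : ProbabilityMeasure (Fin L → ℂ)} {g : (Fin L → ℂ) → Fin L → ℂ}
  {A : Matrix (Fin L) (Fin L) ℂ} {c σ : ℝ}

/-- The integrand `g(α) g(α)^* / (1 + g(α)^* A g(α))`, entrywise. -/
def kernelFun (g : (Fin L → ℂ) → Fin L → ℂ) (A : Matrix (Fin L) (Fin L) ℂ) (l m : Fin L)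
    (α : Fin L → ℂ) : ℂ :=
  g α l * conj (g α m) / (1 + star (g α) ⬝ᵥ A *ᵥ g α)

/-- The matrix `c E [g(α) g(α)^* / (1 + g(α)^* A g(α))] + σ² I`. -/
def fixRHS (c σ : ℝ) (H : ProbabilityMeasure (Fin L → ℂ)) (g : (Fin L → ℂ) → Fin L → ℂ)
    (A : Matrix (Fin L) (Fin L) ℂ) : Matrix (Fin L) (Fin L) ℂ :=
  (c : ℂ) • Matrix.of (fun l m => ∫ α, kernelFun g A l m α ∂(H : Measure (Fin L → ℂ))) +
    ((σ ^ 2 : ℝ) : ℂ) • 1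

lemma isSolution_iff : IsSolution c σ H A ↔ A.PosDef ∧ A = (fixRHS c σ H id A)⁻¹ := Iff.rfl

lemma continuous_kernelFun (hg : Continuous g) (hA : A.PosSemidef) (l m : Fin L) :
    Continuous (kernelFun g A l m) := by
  unfold kernelFun
  refine Continuous.div ?_ ?_ fun α => denom_ne_zero hA (g α)
  · fun_prop
  · refine continuous_const.add (Continuous.dotProduct ?_ (Continuous.matrix_mulVec continuous_const hg))
    exact continuous_star.comp hg

/-- All integrands `kernelFun g A l m` are bounded. -/
def KernelBounded (g : (Fin L → ℂ) → Fin L → ℂ) (A : Matrix (Fin L) (Fin L) ℂ) : Prop :=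
  ∃ C, ∀ l m α, ‖kernelFun g A l m α‖ ≤ C

lemma integrable_kernelFun (hg : Continuous g) (hA : A.PosSemidef) (hb : KernelBounded g A)
    (l m : Fin L) : Integrable (kernelFun g A l m) (H : Measure (Fin L → ℂ)) := by
  obtain ⟨C, hC⟩ := hb
  exact .of_bound (continuous_kernelFun hg hA l m).aestronglyMeasurable C
    (Eventually.of_forall fun α => hC l m α)

lemma norm_mul_conj_le_nsq (v : Fin L → ℂ) (l m : Fin L) : ‖v l * conj (v m)‖ ≤ nsq v := by
  rw [norm_mul, RCLike.norm_conj]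
  nlinarith [norm_sq_le_nsq v l, norm_sq_le_nsq v m, sq_nonneg (‖v l‖ - ‖v m‖)]

lemma norm_denom_eq (hA : A.PosSemidef) (v : Fin L → ℂ) :
    ‖1 + star v ⬝ᵥ A *ᵥ v‖ = 1 + qf A v := by
  have h := qf_nonneg hA v
  rw [IsHermitian.dotProduct_eq_qf hA.isHermitian, ← Complex.ofReal_one, ← Complex.ofReal_add,
    Complex.norm_real, Real.norm_of_nonneg (by positivity)]

/-- The numerator is at most `|g α|²`, which the form in the denominator absorbs. This is why no
moments of `H` are needed, and `κ` serves later as a dominating constant. -/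
lemma norm_kernelFun_le {κ : ℝ} (hA : A.PosSemidef) (hκ : ∀ v, nsq v ≤ κ * qf A v) (hκ0 : 0 ≤ κ)
    (l m : Fin L) (α : Fin L → ℂ) : ‖kernelFun g A l m α‖ ≤ κ := by
  have h := qf_nonneg hA (g α)
  rw [kernelFun, norm_div, norm_denom_eq hA, div_le_iff₀ (by positivity)]
  refine (norm_mul_conj_le_nsq _ _ _).trans ((hκ _).trans ?_)
  nlinarith

lemma PosDef.kernelBounded (hA : A.PosDef) : KernelBounded g A := by
  obtain ⟨κ, hκ0, hκ⟩ := PosDef.exists_nsq_le hA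
  exact ⟨κ, norm_kernelFun_le hA.posSemidef hκ hκ0.le⟩

lemma kernelBounded_of_norm_le (hA : A.PosSemidef) {M : ℝ} (hM : 0 ≤ M)
    (hg : ∀ α l, ‖g α l‖ ≤ M) : KernelBounded g A := by
  refine ⟨M * M, fun l m α => ?_⟩
  rw [kernelFun, norm_div, norm_mul, RCLike.norm_conj]
  refine (div_le_self (by positivity) (one_le_norm_denom hA _)).trans ?_
  exact mul_le_mul (hg α l) (hg α m) (norm_nonneg _) hM

lemma fixRHS_isHermitian (hA : A.PosSemidef) : (fixRHS c σ H g A).IsHermitian := by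
  refine IsHermitian.add (IsHermitian.smul ?_ (Complex.conj_ofReal _))
    (IsHermitian.smul isHermitian_one (Complex.conj_ofReal _))
  ext l m
  rw [conjTranspose_apply, of_apply, of_apply, ← starRingEnd_apply, ← integral_conj]
  refine integral_congr_ae (Eventually.of_forall fun α => ?_)
  simp only [kernelFun, IsHermitian.dotProduct_eq_qf hA.isHermitian]
  simp [mul_comm]

lemma re_dotProduct_kernelFun (hA : A.PosSemidef) (v α : Fin L → ℂ) :
    (∑ l, ∑ m, star (v l) * kernelFun g A l m α * v m) =
      ((‖star (g α) ⬝ᵥ v‖ ^ 2 / (1 + qf A (g α)) : ℝ) : ℂ) := by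
  have h1 : star v ⬝ᵥ g α = conj (star (g α) ⬝ᵥ v) := by
    rw [starRingEnd_apply, star_dotProduct]
  rw [Complex.ofReal_div, Complex.ofReal_pow, ← Complex.conj_mul', ← h1, Complex.ofReal_add,
    ← IsHermitian.dotProduct_eq_qf hA.isHermitian]
  simp only [kernelFun, dotProduct, Finset.sum_mul_sum, Finset.sum_div, Pi.star_apply]
  refine Finset.sum_congr rfl fun l _ => Finset.sum_congr rfl fun m _ => ?_
  rw [Complex.ofReal_one, starRingEnd_apply]
  ring

/-- In this scalar form `A` occurs only in the denominator, so monotonicity in `A` is visible. -/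
lemma qf_fixRHS (hg : Continuous g) (hA : A.PosSemidef) (hb : KernelBounded g A)
    (v : Fin L → ℂ) : qf (fixRHS c σ H g A) v =
      c * ∫ α, ‖star (g α) ⬝ᵥ v‖ ^ 2 / (1 + qf A (g α)) ∂(H : Measure (Fin L → ℂ)) +
        σ ^ 2 * nsq v := by
  rw [fixRHS, qf_add, qf_smul, qf_smul, qf_one]
  congr 2
  have hi := integrable_kernelFun (H := H) hg hA hb
  have h : star v ⬝ᵥ Matrix.of (fun l m => ∫ α, kernelFun g A l m α ∂(H : Measure (Fin L → ℂ))) *ᵥ v =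
      ∫ α, ((‖star (g α) ⬝ᵥ v‖ ^ 2 / (1 + qf A (g α)) : ℝ) : ℂ) ∂(H : Measure (Fin L → ℂ)) := by
    simp_rw [← re_dotProduct_kernelFun hA]
    rw [integral_finsetSum _ fun l _ => integrable_finsetSum _ fun m _ =>
      ((hi l m).const_mul _).mul_const _]
    simp only [dotProduct, mulVec, of_apply, Finset.mul_sum, Pi.star_apply]
    refine Finset.sum_congr rfl fun l _ => ?_
    rw [integral_finsetSum _ fun m _ => ((hi l m).const_mul _).mul_const _]
    refine Finset.sum_congr rfl fun m _ => ?_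
    rw [integral_mul_const, integral_const_mul, mul_assoc]
  rw [qf, h, integral_complex_ofReal, Complex.ofReal_re]

lemma integrable_qfKernel (hg : Continuous g) (hA : A.PosSemidef) (hb : KernelBounded g A)
    (v : Fin L → ℂ) : Integrable (fun α => ‖star (g α) ⬝ᵥ v‖ ^ 2 / (1 + qf A (g α)))
      (H : Measure (Fin L → ℂ)) := by
  have hi := integrable_kernelFun (H := H) hg hA hb
  have h : Integrable (fun α => ((‖star (g α) ⬝ᵥ v‖ ^ 2 / (1 + qf A (g α)) : ℝ) : ℂ))
      (H : Measure (Fin L → ℂ)) := by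
    simp_rw [← re_dotProduct_kernelFun hA]
    exact integrable_finsetSum _ fun l _ => integrable_finsetSum _ fun m _ =>
      ((hi l m).const_mul _).mul_const _
  simpa only [RCLike.re_eq_complex_re, Complex.ofReal_re] using h.re

lemma fixRHS_posDef (hc : 0 ≤ c) (hσ : 0 < σ) (hg : Continuous g) (hA : A.PosSemidef)
    (hb : KernelBounded g A) : (fixRHS c σ H g A).PosDef := by
  refine posDef_of_coercive (fixRHS_isHermitian hA) (by positivity : 0 < σ ^ 2) fun v => ?_
  rw [qf_fixRHS hg hA hb]
  refine le_add_of_nonneg_left (mul_nonneg hc (integral_nonneg fun α => ?_))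
  have := qf_nonneg hA (g α)
  positivity

lemma inv_eq_fixRHS (hc : 0 ≤ c) (hσ : 0 < σ) (hg : Continuous g) (hA : A.PosSemidef)
    (hb : KernelBounded g A) (h : A = (fixRHS c σ H g A)⁻¹) : A⁻¹ = fixRHS c σ H g A := by
  rw [inv_eq_right_inv]
  nth_rw 1 [h]
  exact PosDef.inv_mul_self (fixRHS_posDef hc hσ hg hA hb)

/-! #### Uniqueness -/

/-- The hypothesis inverts to `θ B ≤ A`, so for `θ ≤ 1` the integral for `B` is at least `θ` times
that for `A`. The term `σ² I` is common to both equations and loses no factor; its surplus `(1 - θ)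
σ² |v|²` improves `θ`. -/
lemma qf_mul_le_of_isSolution (hc : 0 ≤ c) (hσ : 0 < σ) {B : Matrix (Fin L) (Fin L) ℂ}
    (hA : IsSolution c σ H A) (hB : IsSolution c σ H B) {θ ρ : ℝ} (hθ : 0 < θ) (hθ1 : θ ≤ 1)
    (hρ : ∀ v, ρ * qf A⁻¹ v ≤ σ ^ 2 * nsq v) (h : ∀ v, θ * qf A⁻¹ v ≤ qf B⁻¹ v)
    (v : Fin L → ℂ) : (θ + (1 - θ) * ρ) * qf A⁻¹ v ≤ qf B⁻¹ v := by
  have h1 := qf_inv_antitone hA.1 hB.1 hθ.le h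
  have hAb : KernelBounded id A := PosDef.kernelBounded hA.1
  have hBb : KernelBounded id B := PosDef.kernelBounded hB.1
  have eA := inv_eq_fixRHS hc hσ continuous_id hA.1.posSemidef hAb hA.2
  have eB := inv_eq_fixRHS hc hσ continuous_id hB.1.posSemidef hBb hB.2
  have qA := qf_fixRHS (c := c) (σ := σ) (H := H) continuous_id hA.1.posSemidef hAb v
  have qB := qf_fixRHS (c := c) (σ := σ) (H := H) continuous_id hB.1.posSemidef hBb v
  rw [← eA] at qA
  rw [← eB] at qB
  have hi : θ * ∫ α, ‖star (id α) ⬝ᵥ v‖ ^ 2 / (1 + qf A (id α)) ∂(H : Measure (Fin L → ℂ)) ≤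
      ∫ α, ‖star (id α) ⬝ᵥ v‖ ^ 2 / (1 + qf B (id α)) ∂(H : Measure (Fin L → ℂ)) := by
    rw [← integral_const_mul]
    refine integral_mono ((integrable_qfKernel continuous_id hA.1.posSemidef hAb v).const_mul θ)
      (integrable_qfKernel continuous_id hB.1.posSemidef hBb v) fun α => ?_
    have a0 := qf_nonneg hA.1.posSemidef (id α)
    have b0 := qf_nonneg hB.1.posSemidef (id α)
    have ab := h1 (id α)
    simp only
    rw [← mul_div_assoc, div_le_div_iff₀ (by positivity) (by positivity)]
    have : θ * (1 + qf B (id α)) ≤ 1 + qf A (id α) := by nlinarith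
    calc _ = ‖star (id α) ⬝ᵥ v‖ ^ 2 * (θ * (1 + qf B (id α))) := by ring
      _ ≤ _ := by gcongr
  have hi2 := mul_le_mul_of_nonneg_left hi hc
  have h2 := mul_le_mul_of_nonneg_left (hρ v) (sub_nonneg.2 hθ1)
  rw [qB]
  nlinarith

lemma qf_inv_le_of_isSolution (hc : 0 ≤ c) (hσ : 0 < σ) {B : Matrix (Fin L) (Fin L) ℂ}
    (hA : IsSolution c σ H A) (hB : IsSolution c σ H B) (v : Fin L → ℂ) :
    qf A⁻¹ v ≤ qf B⁻¹ v := by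
  have hAb : KernelBounded id A := PosDef.kernelBounded hA.1
  have hBb : KernelBounded id B := PosDef.kernelBounded hB.1
  set s := ∑ i, ∑ j, ‖A⁻¹ i j‖
  have hs : 0 ≤ s := Finset.sum_nonneg fun _ _ => Finset.sum_nonneg fun _ _ => norm_nonneg _
  -- Since `A⁻¹ ≤ s`, this gives `ρ A⁻¹ ≤ σ²`; the extra `σ ^ 2` in the denominator ensures `0 < ρ ≤
  -- 1`.
  set ρ := σ ^ 2 / (s + σ ^ 2) with hρdef
  have hρ0 : 0 < ρ := by positivity
  have hρ1 : ρ ≤ 1 := by rw [hρdef, div_le_one (by positivity)]; linarith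
  have hρ : ∀ v, ρ * qf A⁻¹ v ≤ σ ^ 2 * nsq v := fun v => by
    have h1 := qf_le_sum_mul_nsq A⁻¹ v
    have h0 := nsq_nonneg v
    rw [hρdef, div_mul_eq_mul_div, div_le_iff₀ (by positivity), mul_assoc]
    have : qf A⁻¹ v ≤ nsq v * (s + σ ^ 2) := by nlinarith [sq_nonneg σ, mul_nonneg h0 (sq_nonneg σ)]
    gcongr
  have hB0 : ∀ v, ρ * qf A⁻¹ v ≤ qf B⁻¹ v := fun v => by
    refine (hρ v).trans ?_
    rw [inv_eq_fixRHS hc hσ continuous_id hB.1.posSemidef hBb hB.2,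
      qf_fixRHS continuous_id hB.1.posSemidef hBb]
    refine le_add_of_nonneg_left (mul_nonneg hc (integral_nonneg fun α => ?_))
    have := qf_nonneg hB.1.posSemidef (id α)
    positivity
  -- Each application multiplies the gap `1 - θ` by `1 - ρ`. The exponent starts at 1, that is at `θ
  -- = ρ`, because the improvement step needs `θ > 0`.
  have hn : ∀ n : ℕ, ∀ v, (1 - (1 - ρ) ^ (n + 1)) * qf A⁻¹ v ≤ qf B⁻¹ v := by
    intro n
    induction n with
    | zero => intro v; simpa using hB0 v
    | succ n ih =>
      intro v
      have p1 : (1 - ρ) ^ (n + 1) ≤ 1 - ρ := by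
        rw [pow_succ]
        exact mul_le_of_le_one_left (by linarith) (pow_le_one₀ (by linarith) (by linarith))
      have p0 : 0 ≤ (1 - ρ) ^ (n + 1) := pow_nonneg (by linarith) _
      have := qf_mul_le_of_isSolution hc hσ hA hB (by linarith) (by linarith) hρ ih v
      refine le_trans (le_of_eq ?_) this
      ring
  have hlim : Tendsto (fun n : ℕ => (1 - (1 - ρ) ^ (n + 1)) * qf A⁻¹ v) atTop
      (𝓝 ((1 - 0) * qf A⁻¹ v)) := by
    refine Tendsto.mul_const _ (tendsto_const_nhds.sub ?_)
    exact (tendsto_pow_atTop_nhds_zero_of_lt_one (by linarith) (by linarith)).comp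
      (tendsto_add_atTop_nat 1)
  rw [sub_zero, one_mul] at hlim
  exact le_of_tendsto hlim (Eventually.of_forall fun n => hn n v)

theorem IsSolution.unique (hc : 0 ≤ c) (hσ : 0 < σ) {B : Matrix (Fin L) (Fin L) ℂ}
    (hA : IsSolution c σ H A) (hB : IsSolution c σ H B) : A = B := by
  have h : A⁻¹ = B⁻¹ := eq_of_qf_eq hA.1.inv.isHermitian hB.1.inv.isHermitian fun v =>
    le_antisymm (qf_inv_le_of_isSolution hc hσ hA hB v) (qf_inv_le_of_isSolution hc hσ hB hA v)
  have hu : IsUnit A.det := (isUnit_iff_isUnit_det _).1 hA.1.isUnit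
  have hv : IsUnit B.det := (isUnit_iff_isUnit_det _).1 hB.1.isUnit
  rw [← nonsing_inv_nonsing_inv A hu, h, nonsing_inv_nonsing_inv B hv]

/-! #### A lower bound for solutions -/

/-- Both terms vanish as the constant grows, the integral by dominated convergence with bound 1. The
value `1 / 2` makes each bootstrap step in the next lemma halve the constant. -/
lemma exists_lowerConst (c σ : ℝ) (H : ProbabilityMeasure (Fin L → ℂ)) :
    ∃ κ > 0, σ ^ 2 / κ + c * ∫ α, nsq α / (κ + nsq α) ∂(H : Measure (Fin L → ℂ)) ≤ 1 / 2 := by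
  have hm : Continuous (nsq : (Fin L → ℂ) → ℝ) := by unfold nsq; fun_prop
  have h1 : Tendsto (fun n : ℕ => ∫ α, nsq α / (((n : ℝ) + 1) + nsq α) ∂(H : Measure (Fin L → ℂ)))
      atTop (𝓝 (∫ _, (0 : ℝ) ∂(H : Measure (Fin L → ℂ)))) := by
    refine tendsto_integral_of_dominated_convergence (fun _ => 1) (fun n => ?_)
      (integrable_const _) (fun n => Eventually.of_forall fun α => ?_)
      (Eventually.of_forall fun α => ?_)
    · refine Continuous.aestronglyMeasurable (hm.div (continuous_const.add hm) fun α => ?_)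
      have := nsq_nonneg α
      positivity
    · have := nsq_nonneg α
      rw [Real.norm_of_nonneg (by positivity), div_le_one (by positivity)]
      have : (0 : ℝ) ≤ n := Nat.cast_nonneg n
      linarith
    · refine Tendsto.div_atTop tendsto_const_nhds (tendsto_atTop_add_const_right _ _ ?_)
      exact tendsto_atTop_add_const_right _ _ tendsto_natCast_atTop_atTop
  have h2 : Tendsto (fun n : ℕ => σ ^ 2 / ((n : ℝ) + 1)) atTop (𝓝 0) :=
    Tendsto.div_atTop tendsto_const_nhds
      (tendsto_atTop_add_const_right _ _ tendsto_natCast_atTop_atTop)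
  have h3 := h2.add (h1.const_mul c)
  simp only [integral_zero, mul_zero, add_zero] at h3
  obtain ⟨n, hn⟩ := (h3.eventually (ge_mem_nhds (by norm_num : (0 : ℝ) < 1 / 2))).exists
  exact ⟨n + 1, by positivity, hn⟩

/-- If the bound holds with some `κ ≥ κ₀`, the equation yields `A⁻¹ ≤ κ / 2`, hence the bound with
`κ / 2`. Starting from any constant for the given `A`, halving leads down to `κ₀`, which does not
depend on `g`; this makes the bound uniform over all cutoffs. -/
lemma nsq_le_of_fixRHS (hc : 0 ≤ c) (hσ : 0 < σ) {κ₀ : ℝ} (hκ₀ : 0 < κ₀)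
    (h₀ : σ ^ 2 / κ₀ + c * ∫ α, nsq α / (κ₀ + nsq α) ∂(H : Measure (Fin L → ℂ)) ≤ 1 / 2)
    (hg : Continuous g) (hgn : ∀ α, nsq (g α) ≤ nsq α) (hA : A.PosDef)
    (h : A = (fixRHS c σ H g A)⁻¹) (v : Fin L → ℂ) : nsq v ≤ κ₀ * qf A v := by
  have hb : KernelBounded g A := PosDef.kernelBounded hA
  have hinv := inv_eq_fixRHS hc hσ hg hA.posSemidef hb h
  have hm : Continuous (nsq : (Fin L → ℂ) → ℝ) := by unfold nsq; fun_prop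
  have step : ∀ κ, κ₀ ≤ κ → (∀ v, nsq v ≤ κ * qf A v) → ∀ v, nsq v ≤ κ / 2 * qf A v := by
    intro κ hκ hv
    have hκp : 0 < κ := hκ₀.trans_le hκ
    have key : ∀ v, qf A⁻¹ v ≤ κ / 2 * nsq v := fun v => by
      rw [hinv, qf_fixRHS hg hA.posSemidef hb]
      have hi : ∫ α, ‖star (g α) ⬝ᵥ v‖ ^ 2 / (1 + qf A (g α)) ∂(H : Measure (Fin L → ℂ)) ≤
          κ * nsq v * ∫ α, nsq α / (κ₀ + nsq α) ∂(H : Measure (Fin L → ℂ)) := by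
        rw [← integral_const_mul]
        have hi0 : Integrable (fun α => nsq α / (κ₀ + nsq α)) (H : Measure (Fin L → ℂ)) := by
          refine .of_bound (Continuous.aestronglyMeasurable (hm.div (continuous_const.add hm)
            fun α => ?_)) 1 (Eventually.of_forall fun α => ?_)
          · have := nsq_nonneg α
            positivity
          · have := nsq_nonneg α
            rw [Real.norm_of_nonneg (by positivity), div_le_one (by positivity)]
            linarith
        refine integral_mono (integrable_qfKernel hg hA.posSemidef hb v) (hi0.const_mul _)
          fun α => ?_
        · have n1 := nsq_nonneg α
          have n2 := nsq_nonneg (g α)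
          have n3 := nsq_nonneg v
          have q0 := qf_nonneg hA.posSemidef (g α)
          have e1 : ‖star (g α) ⬝ᵥ v‖ ^ 2 ≤ nsq (g α) * nsq v := by
            simpa using sq_norm_dotProduct_le (star (g α)) v
          -- By `hv` the left side is at most `κ t / (κ + t)` at `t = nsq (g α)`; this increases
          -- with `t`, and replacing `κ` by the smaller `κ₀` in the denominator increases it.
          have e2 : nsq (g α) / (1 + qf A (g α)) ≤ κ * (nsq α / (κ₀ + nsq α)) := by
            have := hv (g α)
            have := hgn α
            rw [← mul_div_assoc, div_le_div_iff₀ (by positivity) (by positivity)]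
            nlinarith [mul_le_mul_of_nonneg_left (hv (g α)) n1, mul_le_mul hκ (hgn α) n2 hκp.le]
          calc _ ≤ nsq (g α) * nsq v / (1 + qf A (g α)) := by gcongr
            _ = nsq v * (nsq (g α) / (1 + qf A (g α))) := by ring
            _ ≤ nsq v * (κ * (nsq α / (κ₀ + nsq α))) := by gcongr
            _ = _ := by ring
      set I := ∫ α, nsq α / (κ₀ + nsq α) ∂(H : Measure (Fin L → ℂ))
      have n3 := nsq_nonneg v
      have e3 : σ ^ 2 ≤ κ * (σ ^ 2 / κ₀) := by
        rw [← mul_div_assoc, le_div_iff₀ hκ₀, mul_comm κ]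
        gcongr
      calc _ ≤ c * (κ * nsq v * I) + κ * (σ ^ 2 / κ₀) * nsq v := by gcongr
        _ = κ * nsq v * (σ ^ 2 / κ₀ + c * I) := by ring
        _ ≤ κ * nsq v * (1 / 2) := by gcongr
        _ = _ := by ring
    intro v
    have := qf_inv_antitone hA PosDef.one (θ := (κ / 2)⁻¹) (by positivity) (fun v => ?_) v
    · rwa [qf_one, inv_mul_le_iff₀ (by positivity)] at this
    · rw [inv_one, qf_one, inv_mul_le_iff₀ (by positivity)]
      exact key v
  -- At most `n` halvings are needed; they stop as soon as the constant is below `κ₀`, where `step`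
  -- no longer applies.
  have hn : ∀ n : ℕ, ∀ κ, κ ≤ 2 ^ n * κ₀ → (∀ v, nsq v ≤ κ * qf A v) →
      ∀ v, nsq v ≤ κ₀ * qf A v := by
    intro n
    induction n with
    | zero =>
      intro κ hκ hv v
      have := qf_nonneg hA.posSemidef v
      rw [pow_zero, one_mul] at hκ
      exact (hv v).trans (by gcongr)
    | succ n ih =>
      intro κ hκ hv
      rcases le_total κ κ₀ with h1 | h1
      · intro v
        have := qf_nonneg hA.posSemidef v
        exact (hv v).trans (by gcongr)
      · refine ih (κ / 2) ?_ (step κ h1 hv)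
        rw [pow_succ] at hκ
        linarith
  obtain ⟨κ, hκ0, hκ⟩ := PosDef.exists_nsq_le hA
  obtain ⟨n, hn'⟩ := pow_unbounded_of_one_lt (κ / κ₀) (one_lt_two)
  exact hn n κ ((div_lt_iff₀ hκ₀).1 hn').le hκ v

end FixedPoint

/-! ### Passage to the limit for one realization -/

section Cutoff

variable {L : ℕ}

/-- A continuous cutoff: the identity on the ball of radius `M + 1`, zero off the ball of radius
`M + 2`. -/
def cutoff (M : ℕ) (α : Fin L → ℂ) : Fin L → ℂ :=
  ((max 0 (min 1 ((M : ℝ) + 2 - ‖α‖)) : ℝ) : ℂ) • α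

/-- A continuous function that is one wherever the cutoff is not the identity. -/
def tailFun (M : ℕ) (α : Fin L → ℂ) : ℝ := min 1 (max 0 (‖α‖ - M))

lemma continuous_cutoff (M : ℕ) : Continuous (cutoff M : (Fin L → ℂ) → Fin L → ℂ) := by
  unfold cutoff
  refine Continuous.smul (Complex.continuous_ofReal.comp ?_) continuous_id
  fun_prop

lemma continuous_tailFun (M : ℕ) : Continuous (tailFun M : (Fin L → ℂ) → ℝ) := by
  unfold tailFun
  fun_prop

lemma cutoff_eq_self {M : ℕ} {α : Fin L → ℂ} (h : ‖α‖ ≤ M + 1) : cutoff M α = α := by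
  rw [cutoff, min_eq_left (by linarith), max_eq_right zero_le_one, Complex.ofReal_one, one_smul]

lemma norm_cutoff_coeff_le (M : ℕ) (α : Fin L → ℂ) :
    ‖((max 0 (min 1 ((M : ℝ) + 2 - ‖α‖)) : ℝ) : ℂ)‖ ≤ 1 := by
  rw [Complex.norm_real, Real.norm_of_nonneg (le_max_left _ _)]
  exact max_le zero_le_one (min_le_left _ _)

lemma norm_cutoff_apply_le (M : ℕ) (α : Fin L → ℂ) (l : Fin L) : ‖cutoff M α l‖ ≤ M + 2 := by
  refine (norm_le_pi_norm _ l).trans ?_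
  rcases le_total ‖α‖ (M + 2) with h | h
  · rw [cutoff, norm_smul]
    exact (mul_le_of_le_one_left (norm_nonneg _) (norm_cutoff_coeff_le M α)).trans h
  · rw [cutoff, max_eq_left ((min_le_right _ _).trans (by linarith))]
    simp only [Complex.ofReal_zero, zero_smul, norm_zero]
    positivity

lemma nsq_cutoff_le (M : ℕ) (α : Fin L → ℂ) : nsq (cutoff M α) ≤ nsq α := by
  rw [cutoff, nsq_smul]
  refine mul_le_of_le_one_left (nsq_nonneg α) ?_
  exact pow_le_one₀ (norm_nonneg _) (norm_cutoff_coeff_le M α)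

lemma tailFun_nonneg (M : ℕ) (α : Fin L → ℂ) : 0 ≤ tailFun M α :=
  le_min zero_le_one (le_max_left _ _)

lemma tailFun_le_one (M : ℕ) (α : Fin L → ℂ) : tailFun M α ≤ 1 := min_le_left _ _

/-- A continuous majorant of the indicator of the altered gains; continuity is what allows weak
convergence to count them. -/
lemma one_le_tailFun {M : ℕ} {α : Fin L → ℂ} (h : cutoff M α ≠ α) : 1 ≤ tailFun M α := by
  have : (M : ℝ) + 1 < ‖α‖ := by
    by_contra hn
    exact h (cutoff_eq_self (not_lt.1 hn))
  exact le_min le_rfl (le_max_of_le_right (by linarith))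

lemma tendsto_integral_tailFun (H : ProbabilityMeasure (Fin L → ℂ)) :
    Tendsto (fun M : ℕ => ∫ α, tailFun M α ∂(H : Measure (Fin L → ℂ))) atTop (𝓝 0) := by
  have h : Tendsto (fun M : ℕ => ∫ α, tailFun M α ∂(H : Measure (Fin L → ℂ)))
      atTop (𝓝 (∫ _, (0 : ℝ) ∂(H : Measure (Fin L → ℂ)))) := by
    refine tendsto_integral_of_dominated_convergence (fun _ => 1)
      (fun n => (continuous_tailFun n).aestronglyMeasurable) (integrable_const _)
      (fun n => Eventually.of_forall fun α => ?_) (Eventually.of_forall fun α => ?_)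
    · rw [Real.norm_of_nonneg (tailFun_nonneg n α)]
      exact tailFun_le_one n α
    · refine tendsto_const_nhds.congr' ?_
      obtain ⟨n, hn⟩ := exists_nat_ge ‖α‖
      filter_upwards [eventually_ge_atTop n] with m hm
      have : (n : ℝ) ≤ m := by exact_mod_cast hm
      rw [tailFun, max_eq_left (by linarith), min_eq_right zero_le_one]
  simpa using h

end Cutoff

/-! ### Cluster points of approximate solutions -/

section Limit

variable {L : ℕ} {H : ProbabilityMeasure (Fin L → ℂ)} {c σ : ℝ} {K : ℕ → ℕ}
  {α : ∀ N, Fin (K N) → Fin L → ℂ}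

/-- Empirical averages, normalized by `N`, of bounded continuous functions of the gain vectors
converge to `c` times the expectation. -/
def AveragesTendsto (c : ℝ) (H : ProbabilityMeasure (Fin L → ℂ))
    (α : ∀ N, Fin (K N) → Fin L → ℂ) : Prop :=
  ∀ f : (Fin L → ℂ) → ℂ, Continuous f → (∃ C, ∀ x, ‖f x‖ ≤ C) →
    Tendsto (fun N : ℕ => ((1 / (N : ℝ) : ℝ) : ℂ) * ∑ k, f (α N k)) atTop
      (𝓝 ((c : ℂ) * ∫ x, f x ∂(H : Measure (Fin L → ℂ))))

lemma AveragesTendsto.real (h : AveragesTendsto c H α) {f : (Fin L → ℂ) → ℝ} (hf : Continuous f)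
    {C : ℝ} (hC : ∀ x, |f x| ≤ C) : Tendsto (fun N : ℕ => 1 / (N : ℝ) * ∑ k, f (α N k)) atTop
      (𝓝 (c * ∫ x, f x ∂(H : Measure (Fin L → ℂ)))) := by
  have h1 := h (fun x => (f x : ℂ)) (Complex.continuous_ofReal.comp hf) ⟨C, fun x => by
    rw [Complex.norm_real]; exact hC x⟩
  rw [integral_complex_ofReal] at h1
  have h2 := (Complex.continuous_re.tendsto _).comp h1
  refine (h2.congr fun N => ?_).trans_eq ?_
  · simp only [Function.comp]
    rw [← Complex.ofReal_sum, ← Complex.ofReal_mul, Complex.ofReal_re]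
  · rw [← Complex.ofReal_mul, Complex.ofReal_re]

lemma AveragesTendsto.ratio (h : AveragesTendsto c H α) :
    Tendsto (fun N : ℕ => (K N : ℝ) / N) atTop (𝓝 c) := by
  have := h.real (f := fun _ => 1) continuous_const (C := 1) (by simp)
  simpa [div_eq_inv_mul] using this

lemma rankOneTerm_eq_sum_kernelFun (A : Matrix (Fin L) (Fin L) ℂ)
    (g : (Fin L → ℂ) → Fin L → ℂ) (x : Fin L → ℂ) (l m : Fin L) :
    rankOneTerm A (g x) l m = ∑ n, A l n * kernelFun g A n m x := by
  rw [rankOneTerm_apply]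
  simp only [kernelFun, mulVec, dotProduct, Finset.sum_mul, Finset.sum_div]
  refine Finset.sum_congr rfl fun n _ => ?_
  ring

lemma tendsto_entry {ι : Type*} {F : Filter ι} {A : ι → Matrix (Fin L) (Fin L) ℂ}
    {B : Matrix (Fin L) (Fin L) ℂ} (h : Tendsto A F (𝓝 B)) (l m : Fin L) :
    Tendsto (fun i => A i l m) F (𝓝 (B l m)) :=
  tendsto_pi_nhds.1 (tendsto_pi_nhds.1 h l) m

lemma tendsto_of_entry {ι : Type*} {F : Filter ι} {A : ι → Matrix (Fin L) (Fin L) ℂ}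
    {B : Matrix (Fin L) (Fin L) ℂ} (h : ∀ l m, Tendsto (fun i => A i l m) F (𝓝 (B l m))) :
    Tendsto A F (𝓝 B) :=
  tendsto_pi_nhds.2 fun l => tendsto_pi_nhds.2 fun m => h l m

lemma tendsto_qf {ι : Type*} {F : Filter ι} {A : ι → Matrix (Fin L) (Fin L) ℂ}
    {B : Matrix (Fin L) (Fin L) ℂ} (h : Tendsto A F (𝓝 B)) (v : Fin L → ℂ) :
    Tendsto (fun i => qf (A i) v) F (𝓝 (qf B v)) := by
  have : Continuous fun A : Matrix (Fin L) (Fin L) ℂ => qf A v := by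
    unfold qf
    exact Complex.continuous_re.comp
      (Continuous.dotProduct continuous_const (continuous_id.matrix_mulVec continuous_const))
  exact (this.tendsto B).comp h

lemma posSemidef_of_tendsto {ι : Type*} {F : Filter ι} [F.NeBot]
    {A : ι → Matrix (Fin L) (Fin L) ℂ} {B : Matrix (Fin L) (Fin L) ℂ} (h : Tendsto A F (𝓝 B))
    (hA : ∀ i, (A i).PosSemidef) : B.PosSemidef := by
  refine posSemidef_of_qf ?_ fun v => ge_of_tendsto' (tendsto_qf h v) fun i => qf_nonneg (hA i) v
  have h1 : Tendsto (fun i => (A i)ᴴ) F (𝓝 Bᴴ) :=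
    ((continuous_id.matrix_conjTranspose).tendsto B).comp h
  exact tendsto_nhds_unique (h1.congr fun i => (hA i).isHermitian) h

/-- In the vanishing defect, replace `Ah` by its limit, using the Lipschitz bound and the
boundedness of `K/N`, and then the empirical average by the integral. The cutoff makes the test
function bounded. Positive definiteness follows since `A` is the inverse of a positive definite
matrix. -/
lemma isSolution_cutoff {M : ℕ} {Ah : ℕ → Matrix (Fin L) (Fin L) ℂ}
    {A : Matrix (Fin L) (Fin L) ℂ} {ns : ℕ → ℕ} (hc : 0 ≤ c) (hσ : 0 < σ)
    (hav : AveragesTendsto c H α) (hns : Tendsto ns atTop atTop)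
    (hpsd : ∀ N, (Ah N).PosSemidef) (hlim : Tendsto (fun j => Ah (ns j)) atTop (𝓝 A))
    (herr : ∀ l m, Tendsto (fun N => defect σ N (fun k => cutoff M (α N k)) (Ah N) l m) atTop
      (𝓝 0)) : A.PosDef ∧ A * fixRHS c σ H (cutoff M) A = 1 := by
  have hA : A.PosSemidef := posSemidef_of_tendsto hlim fun j => hpsd _
  have hM : (0 : ℝ) ≤ (M : ℝ) + 2 := by positivity
  have hb : KernelBounded (cutoff M) A := kernelBounded_of_norm_le hA hM (norm_cutoff_apply_le M)
  have hgc : Continuous (cutoff M : (Fin L → ℂ) → Fin L → ℂ) := continuous_cutoff M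
  have hi := integrable_kernelFun (H := H) hgc hA hb
  set τ := ∑ l, ∑ m, ‖A l m‖
  have hτ : 0 ≤ τ := Finset.sum_nonneg fun _ _ => Finset.sum_nonneg fun _ _ => norm_nonneg _
  have single : ∀ (f : Fin L → Fin L → ℝ), (∀ l m, 0 ≤ f l m) → ∀ l m, f l m ≤ ∑ l, ∑ m, f l m :=
    fun f hf l m => (Finset.single_le_sum (f := f l) (fun m _ => hf l m) (Finset.mem_univ m)).trans
      (Finset.single_le_sum (f := fun l => ∑ m, f l m)
        (fun l _ => Finset.sum_nonneg fun m _ => hf l m) (Finset.mem_univ l))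
  have hAτ : ∀ l m, ‖A l m‖ ≤ τ := single (fun l m => ‖A l m‖) fun _ _ => norm_nonneg _
  have hmain : A * fixRHS c σ H (cutoff M) A = 1 := by
    ext l m
    have hker : ∫ x, rankOneTerm A (cutoff M x) l m ∂(H : Measure (Fin L → ℂ)) =
        ∑ n, A l n * ∫ x, kernelFun (cutoff M) A n m x ∂(H : Measure (Fin L → ℂ)) := by
      simp_rw [rankOneTerm_eq_sum_kernelFun]
      rw [integral_finsetSum _ fun n _ => (hi n m).const_mul _]
      exact Finset.sum_congr rfl fun n _ => integral_const_mul _ _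
    have hcont : Continuous fun x => rankOneTerm A (cutoff M x) l m := by
      simp_rw [rankOneTerm_eq_sum_kernelFun]
      exact continuous_finsetSum _ fun n _ =>
        continuous_const.mul (continuous_kernelFun hgc hA n m)
    have h1 := (hav (fun x => rankOneTerm A (cutoff M x) l m) hcont
      ⟨_, fun x => norm_rankOneTerm_le hA hτ hM hAτ (norm_cutoff_apply_le M x) l m⟩).comp hns
    rw [hker] at h1
    have hδ : Tendsto (fun j => ∑ l, ∑ m, ‖Ah (ns j) l m - A l m‖) atTop (𝓝 0) := by
      have : Tendsto (fun j => ∑ l, ∑ m, ‖Ah (ns j) l m - A l m‖) atTop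
          (𝓝 (∑ _l : Fin L, ∑ _m : Fin L, ‖(0 : ℂ)‖)) := by
        refine tendsto_finsetSum _ fun l _ => tendsto_finsetSum _ fun m _ => Tendsto.norm ?_
        simpa using (tendsto_entry hlim l m).sub_const (A l m)
      simpa using this
    have h2 : Tendsto (fun j => ((1 / (ns j : ℝ) : ℝ) : ℂ) *
        ∑ k, rankOneTerm (Ah (ns j)) (cutoff M (α (ns j) k)) l m -
        ((1 / (ns j : ℝ) : ℝ) : ℂ) * ∑ k, rankOneTerm A (cutoff M (α (ns j) k)) l m)
        atTop (𝓝 0) := by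
      have hr := ((hav.ratio.comp hns).mul hδ).mul_const (lipConst L τ (M + 2))
      rw [mul_zero, zero_mul] at hr
      refine squeeze_zero_norm (fun j => ?_) hr
      rw [← mul_sub, ← Finset.sum_sub_distrib, norm_mul, Complex.norm_real,
        Real.norm_of_nonneg (by positivity)]
      set δ := ∑ l, ∑ m, ‖Ah (ns j) l m - A l m‖
      have hδ0 : 0 ≤ δ := Finset.sum_nonneg fun _ _ => Finset.sum_nonneg fun _ _ => norm_nonneg _
      have := norm_sum_le_of_le Finset.univ (fun k _ => norm_rankOneTerm_sub_le (hpsd (ns j)) hA hτ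
        hM hδ0 hAτ (norm_cutoff_apply_le M (α (ns j) k))
        (single (fun l m => ‖Ah (ns j) l m - A l m‖) fun _ _ => norm_nonneg _) l m)
      rw [Finset.sum_const, Finset.card_univ, Fintype.card_fin, nsmul_eq_mul] at this
      calc _ ≤ 1 / (ns j : ℝ) * (K (ns j) * (lipConst L τ (M + 2) * δ)) := by gcongr
        _ = _ := by simp only [Function.comp]; ring
    have h3 := (herr l m).comp hns
    have h4 : Tendsto (fun j => ((σ ^ 2 : ℝ) : ℂ) * Ah (ns j) l m) atTop
        (𝓝 (((σ ^ 2 : ℝ) : ℂ) * A l m)) := (tendsto_entry hlim l m).const_mul _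
    have h5 := ((h3.add h4).add h2).add h1
    have h6 : ∀ j, (1 : Matrix (Fin L) (Fin L) ℂ) l m =
        ((fun N => defect σ N (fun k => cutoff M (α N k)) (Ah N) l m) ∘ ns) j +
        ((σ ^ 2 : ℝ) : ℂ) * Ah (ns j) l m + (((1 / (ns j : ℝ) : ℝ) : ℂ) *
        ∑ k, rankOneTerm (Ah (ns j)) (cutoff M (α (ns j) k)) l m -
        ((1 / (ns j : ℝ) : ℝ) : ℂ) * ∑ k, rankOneTerm A (cutoff M (α (ns j) k)) l m) +
        ((fun N : ℕ => ((1 / (N : ℝ) : ℝ) : ℂ) * ∑ k, rankOneTerm A (cutoff M (α N k)) l m) ∘ ns) j := by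
      intro j
      simp only [Function.comp, defect, Matrix.sub_apply, Matrix.smul_apply, Matrix.sum_apply,
        smul_eq_mul]
      ring
    have h7 := tendsto_nhds_unique (h5.congr fun j => (h6 j).symm) tendsto_const_nhds
    rw [← h7, fixRHS, mul_add, mul_smul_comm, mul_smul_comm, mul_one, Matrix.add_apply,
      Matrix.smul_apply, Matrix.smul_apply, mul_apply]
    simp only [of_apply, smul_eq_mul]
    ring
  refine ⟨?_, hmain⟩
  have hX := fixRHS_posDef (H := H) hc hσ hgc hA hb
  rw [← inv_eq_left_inv hmain]
  exact hX.inv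

/-- The cutoff limits `Al M` solve the equation with cut off gains and differ from `A` by at most a
multiple of the tail of `H`, so `Al M → A`. The uniform lower bound then provides the dominating
constant for letting `M → ∞` in the equation. -/
lemma exists_cluster_isSolution {Ah : ℕ → ℕ → Matrix (Fin L) (Fin L) ℂ}
    {B : ℕ → Matrix (Fin L) (Fin L) ℂ} (hc : 0 ≤ c) (hσ : 0 < σ)
    (hav : AveragesTendsto c H α) (hpsd : ∀ M N, (Ah M N).PosSemidef)
    (hBpsd : ∀ N, (B N).PosSemidef) {τ : ℝ} (hAτ : ∀ M N l m, ‖Ah M N l m‖ ≤ τ)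
    (hBτ : ∀ N l m, ‖B N l m‖ ≤ τ)
    (herr : ∀ M l m, Tendsto (fun N => defect σ N (fun k => cutoff M (α N k)) (Ah M N) l m) atTop
      (𝓝 0)) {C : ℝ}
    (hAB : ∀ M N l m, ‖Ah M N l m - B N l m‖ ≤ (∑ k, tailFun M (α N k) + 1) * (C * (1 / (N : ℝ))))
    {ns : ℕ → ℕ} (hns : Tendsto ns atTop atTop) :
    ∃ (A : Matrix (Fin L) (Fin L) ℂ) (φ : ℕ → ℕ), StrictMono φ ∧ IsSolution c σ H A ∧
      Tendsto (fun j => B (ns (φ j))) atTop (𝓝 A) := by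
  let S : Set (Matrix (Fin L) (Fin L) ℂ) :=
    Set.univ.pi fun _ => Set.univ.pi fun _ => Metric.closedBall (0 : ℂ) τ
  have hS : IsCompact S := isCompact_univ_pi fun _ => isCompact_univ_pi fun _ =>
    isCompact_closedBall _ _
  have hmem : ∀ X : Matrix (Fin L) (Fin L) ℂ, (∀ l m, ‖X l m‖ ≤ τ) → X ∈ S := fun X hX l _ m _ => by
    simpa using hX l m
  -- Compactness of the countable product replaces a diagonal extraction: one subsequence serves
  -- every `M` and `B` together.
  have hcomp : IsCompact ((Set.univ.pi fun _ : ℕ => S) ×ˢ S) := (isCompact_univ_pi fun _ => hS).prod hS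
  have : FirstCountableTopology (Matrix (Fin L) (Fin L) ℂ) :=
    inferInstanceAs (FirstCountableTopology (Fin L → Fin L → ℂ))
  obtain ⟨⟨Al, A⟩, -, φ, hφ, hlim⟩ := hcomp.tendsto_subseq
    (x := fun j => ((fun M => Ah M (ns j)), B (ns j)))
    fun j => ⟨fun M _ => hmem _ (hAτ M (ns j)), hmem _ (hBτ (ns j))⟩
  rw [nhds_prod_eq, tendsto_prod_iff'] at hlim
  obtain ⟨hl1, hl2⟩ := hlim
  have hl1 : ∀ M, Tendsto (fun j => Ah M (ns (φ j))) atTop (𝓝 (Al M)) := fun M =>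
    tendsto_pi_nhds.1 hl1 M
  have hl2 : Tendsto (fun j => B (ns (φ j))) atTop (𝓝 A) := hl2
  have hnφ : Tendsto (fun j => ns (φ j)) atTop atTop := hns.comp hφ.tendsto_atTop
  refine ⟨A, φ, hφ, ?_, hl2⟩
  have hsol := fun M => isSolution_cutoff hc hσ hav hnφ (hpsd M) (hl1 M) (herr M)
  obtain ⟨κ, hκ0, hκ⟩ := exists_lowerConst c σ H
  have hlow : ∀ M v, nsq v ≤ κ * qf (Al M) v := fun M v =>
    nsq_le_of_fixRHS hc hσ hκ0 hκ (continuous_cutoff M) (nsq_cutoff_le M) (hsol M).1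
      (inv_eq_left_inv (hsol M).2).symm v
  have hdist : ∀ M l m, ‖Al M l m - A l m‖ ≤
      c * (∫ x, tailFun M x ∂(H : Measure (Fin L → ℂ))) * C := fun M l m => by
    have t1 := (hav.real (continuous_tailFun M) (C := 1) fun x => by
      rw [abs_of_nonneg (tailFun_nonneg M x)]; exact tailFun_le_one M x).comp hnφ
    have t2 : Tendsto (fun j => 1 / ((ns (φ j) : ℕ) : ℝ)) atTop (𝓝 0) :=
      tendsto_one_div_atTop_nhds_zero_nat.comp hnφ
    have t3 := (t1.add t2).mul_const C
    rw [add_zero] at t3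
    refine le_of_tendsto_of_tendsto' ((tendsto_entry (hl1 M) l m).sub
      (tendsto_entry hl2 l m)).norm t3 fun j => ?_
    refine (hAB M (ns (φ j)) l m).trans_eq ?_
    simp only [Function.comp]
    ring
  have hAlim : Tendsto Al atTop (𝓝 A) := tendsto_of_entry fun l m => by
    rw [tendsto_iff_norm_sub_tendsto_zero]
    refine squeeze_zero (fun _ => norm_nonneg _) (fun M => hdist M l m) ?_
    simpa using ((tendsto_integral_tailFun H).const_mul c).mul_const C
  have hA : A.PosSemidef := posSemidef_of_tendsto hl2 fun j => hBpsd _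
  have hlowA : ∀ v, nsq v ≤ κ * qf A v := fun v =>
    ge_of_tendsto' ((tendsto_qf hAlim v).const_mul κ) fun M => hlow M v
  have hb : KernelBounded id A := ⟨κ, norm_kernelFun_le hA hlowA hκ0.le⟩
  have hker : ∀ l m, Tendsto (fun M => ∫ x, kernelFun (cutoff M) (Al M) l m x
      ∂(H : Measure (Fin L → ℂ))) atTop
      (𝓝 (∫ x, kernelFun id A l m x ∂(H : Measure (Fin L → ℂ)))) := fun l m => by
    refine tendsto_integral_of_dominated_convergence (fun _ => κ) (fun M =>
      (continuous_kernelFun (continuous_cutoff M) (hsol M).1.posSemidef l m).aestronglyMeasurable)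
      (integrable_const _) (fun M => Eventually.of_forall fun x =>
        norm_kernelFun_le (hsol M).1.posSemidef (hlow M) hκ0.le l m x)
      (Eventually.of_forall fun x => ?_)
    have hx : Tendsto (fun M => kernelFun id (Al M) l m x) atTop (𝓝 (kernelFun id A l m x)) := by
      refine Tendsto.div tendsto_const_nhds (tendsto_const_nhds.add ?_) (denom_ne_zero hA _)
      have : Continuous fun X : Matrix (Fin L) (Fin L) ℂ => star (id x) ⬝ᵥ X *ᵥ (id x) :=
        Continuous.dotProduct continuous_const (continuous_id.matrix_mulVec continuous_const)
      exact (this.tendsto A).comp hAlim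
    refine hx.congr' ?_
    obtain ⟨n, hn⟩ := exists_nat_ge ‖x‖
    filter_upwards [eventually_ge_atTop n] with M hM
    have : (n : ℝ) ≤ M := by exact_mod_cast hM
    rw [kernelFun, kernelFun, cutoff_eq_self (by linarith), id]
  have hfix : Tendsto (fun M => fixRHS c σ H (cutoff M) (Al M)) atTop (𝓝 (fixRHS c σ H id A)) := by
    refine Tendsto.add (Tendsto.const_smul (tendsto_of_entry fun l m => ?_) _) tendsto_const_nhds
    exact hker l m
  have hone : A * fixRHS c σ H id A = 1 := by
    have hmul : Tendsto (fun M => Al M * fixRHS c σ H (cutoff M) (Al M)) atTop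
        (𝓝 (A * fixRHS c σ H id A)) := hAlim.mul hfix
    exact tendsto_nhds_unique hmul (tendsto_const_nhds.congr fun M => ((hsol M).2).symm)
  have hX := fixRHS_posDef (H := H) hc hσ continuous_id hA hb
  rw [isSolution_iff]
  have h := inv_eq_left_inv hone
  exact ⟨h ▸ hX.inv, h.symm⟩

/-- Every subsequence has a further one tending to a solution, and by uniqueness always to the same
one. -/
theorem exists_isSolution_tendsto {Ah : ℕ → ℕ → Matrix (Fin L) (Fin L) ℂ}
    {B : ℕ → Matrix (Fin L) (Fin L) ℂ} (hc : 0 ≤ c) (hσ : 0 < σ)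
    (hav : AveragesTendsto c H α) (hpsd : ∀ M N, (Ah M N).PosSemidef)
    (hBpsd : ∀ N, (B N).PosSemidef) {τ : ℝ} (hAτ : ∀ M N l m, ‖Ah M N l m‖ ≤ τ)
    (hBτ : ∀ N l m, ‖B N l m‖ ≤ τ)
    (herr : ∀ M l m, Tendsto (fun N => defect σ N (fun k => cutoff M (α N k)) (Ah M N) l m) atTop
      (𝓝 0)) {C : ℝ}
    (hAB : ∀ M N l m, ‖Ah M N l m - B N l m‖ ≤ (∑ k, tailFun M (α N k) + 1) * (C * (1 / (N : ℝ)))) :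
    ∃ A : Matrix (Fin L) (Fin L) ℂ, IsSolution c σ H A ∧ Tendsto B atTop (𝓝 A) := by
  obtain ⟨A, -, -, hA, -⟩ := exists_cluster_isSolution hc hσ hav hpsd hBpsd hAτ hBτ herr hAB
    tendsto_id
  refine ⟨A, hA, tendsto_of_subseq_tendsto fun ns hns => ?_⟩
  obtain ⟨A', φ, -, hA', hlim⟩ :=
    exists_cluster_isSolution hc hσ hav hpsd hBpsd hAτ hBτ herr hAB hns
  exact ⟨φ, IsSolution.unique hc hσ hA' hA ▸ hlim⟩

end Limit

/-! ### Fourth moments -/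

section FourthMoment

/-- The term linear in `d` is kept exactly, because it integrates to zero for martingale increments.
The cubic term in `d` is absorbed into its neighbours. -/
lemma norm_add_pow_four_le (S d : ℂ) :
    ‖S + d‖ ^ 4 ≤ ‖S‖ ^ 4 + 4 * (‖S‖ ^ 2 * (conj S * d).re) + 8 * (‖S‖ ^ 2 * ‖d‖ ^ 2) +
      3 * ‖d‖ ^ 4 := by
  have h1 : ‖S + d‖ ^ 2 = ‖S‖ ^ 2 + 2 * (conj S * d).re + ‖d‖ ^ 2 := by
    rw [Complex.sq_norm, Complex.sq_norm, Complex.sq_norm, Complex.normSq_add]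
    have : (S * conj d).re = (conj S * d).re := by simp
    rw [this]; ring
  have h2 : |(conj S * d).re| ≤ ‖S‖ * ‖d‖ := by
    refine (Complex.abs_re_le_norm _).trans_eq ?_
    rw [norm_mul, RCLike.norm_conj]
  set r := (conj S * d).re
  have hS := norm_nonneg S
  have hd := norm_nonneg d
  have h3 : r ≤ ‖S‖ * ‖d‖ := (le_abs_self r).trans h2
  have h4 : r ^ 2 ≤ ‖S‖ ^ 2 * ‖d‖ ^ 2 := by
    rw [← mul_pow, ← sq_abs r]
    gcongr
  have h5 : r * ‖d‖ ^ 2 ≤ ‖S‖ * ‖d‖ * ‖d‖ ^ 2 := by gcongr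
  have h6 : 2 * (‖S‖ * ‖d‖ * ‖d‖ ^ 2) ≤ ‖S‖ ^ 2 * ‖d‖ ^ 2 + ‖d‖ ^ 4 := by
    nlinarith [sq_nonneg (‖S‖ * ‖d‖ - ‖d‖ ^ 2)]
  have h7 : ‖S + d‖ ^ 4 = (‖S + d‖ ^ 2) ^ 2 := by ring
  rw [h7, h1]
  nlinarith

lemma integral_add_three {Ω : Type*} [MeasurableSpace Ω] {P : Measure Ω} {F : Type*} [NormedAddCommGroup F] [NormedSpace ℝ F] {f g h : Ω → F}
    (hf : Integrable f P) (hg : Integrable g P) (hh : Integrable h P) :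
    ∫ ω, (f ω + g ω + h ω) ∂P = ∫ ω, f ω ∂P + ∫ ω, g ω ∂P + ∫ ω, h ω ∂P := by
  have h1 : ∫ ω, (f ω + g ω + h ω) ∂P = ∫ ω, (f ω + g ω) ∂P + ∫ ω, h ω ∂P :=
    integral_add (hf.add hg) hh
  rw [h1, integral_add hf hg]

variable {Ω : Type*} [MeasurableSpace Ω] {P : Measure Ω} [IsProbabilityMeasure P]

lemma integral_mul_le_sqrt_mul_sqrt {f g : Ω → ℝ} (hf : Measurable f) (hg : Measurable g)
    (hf0 : ∀ ω, 0 ≤ f ω) (hg0 : ∀ ω, 0 ≤ g ω) {C : ℝ} (hfC : ∀ ω, f ω ≤ C) (hgC : ∀ ω, g ω ≤ C)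
    {a b : ℝ} (ha : 0 ≤ a) (hb : 0 ≤ b) (hfa : ∫ ω, f ω ^ 2 ∂P ≤ a ^ 2)
    (hgb : ∫ ω, g ω ^ 2 ∂P ≤ b ^ 2) : ∫ ω, f ω * g ω ∂P ≤ a * b := by
  have h2 : ENNReal.ofReal 2 = 2 := by simp
  have hmf : MemLp f (ENNReal.ofReal 2) P := .of_bound hf.aestronglyMeasurable C
    (Eventually.of_forall fun ω => by rw [Real.norm_of_nonneg (hf0 ω)]; exact hfC ω)
  have hmg : MemLp g (ENNReal.ofReal 2) P := .of_bound hg.aestronglyMeasurable C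
    (Eventually.of_forall fun ω => by rw [Real.norm_of_nonneg (hg0 ω)]; exact hgC ω)
  have h := integral_mul_le_Lp_mul_Lq_of_nonneg Real.HolderConjugate.two_two
    (Eventually.of_forall hf0) (Eventually.of_forall hg0) hmf hmg
  simp only [Real.rpow_two, ← Real.sqrt_eq_rpow] at h
  refine h.trans (mul_le_mul ?_ ?_ (Real.sqrt_nonneg _) ha)
  · exact Real.sqrt_le_iff.2 ⟨ha, hfa⟩
  · exact Real.sqrt_le_iff.2 ⟨hb, hgb⟩

lemma integrable_of_bdd {E : Type*} [NormedAddCommGroup E] [MeasurableSpace E] [BorelSpace E]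
    [SecondCountableTopology E] {f : Ω → E} (hf : Measurable f) {C : ℝ} (hC : ∀ ω, ‖f ω‖ ≤ C) :
    Integrable f P :=
  .of_bound hf.aestronglyMeasurable C (Eventually.of_forall hC)

/-- By Cauchy–Schwarz the expectation is at most `A² + 8 A D + 3 D²`. Thus bounds on the square root
of the fourth moment add up along increments, and `n` comparable increments give a fourth moment of
order `n²`. -/
lemma fourth_moment_add_le {S d : Ω → ℂ} (hS : Measurable S) (hd : Measurable d) {C : ℝ}
    (hSC : ∀ ω, ‖S ω‖ ≤ C) (hdC : ∀ ω, ‖d ω‖ ≤ C)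
    (h0 : ∫ ω, ‖S ω‖ ^ 2 * (conj (S ω) * d ω).re ∂P = 0) {A D : ℝ} (hA : 0 ≤ A) (hD : 0 ≤ D)
    (hSA : ∫ ω, ‖S ω‖ ^ 4 ∂P ≤ A ^ 2) (hdD : ∫ ω, ‖d ω‖ ^ 4 ∂P ≤ D ^ 2) :
    ∫ ω, ‖S ω + d ω‖ ^ 4 ∂P ≤ (A + 4 * D) ^ 2 := by
  obtain ⟨ω₀⟩ : Nonempty Ω := P.nonempty_of_neZero
  have hC : 0 ≤ C := (norm_nonneg _).trans (hSC ω₀)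
  have hp : ∀ ω, ‖S ω‖ ^ 2 ≤ C ^ 2 := fun ω => by gcongr; exact hSC ω
  have hq : ∀ ω, ‖d ω‖ ^ 2 ≤ C ^ 2 := fun ω => by gcongr; exact hdC ω
  have i1 : Integrable (fun ω => ‖S ω‖ ^ 4) P := integrable_of_bdd (C := C ^ 4) (by fun_prop)
    fun ω => by rw [norm_pow, norm_norm]; gcongr; exact hSC ω
  have i4 : Integrable (fun ω => ‖d ω‖ ^ 4) P := integrable_of_bdd (C := C ^ 4) (by fun_prop)
    fun ω => by rw [norm_pow, norm_norm]; gcongr; exact hdC ω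
  have i3 : Integrable (fun ω => ‖S ω‖ ^ 2 * ‖d ω‖ ^ 2) P :=
    integrable_of_bdd (C := C ^ 2 * C ^ 2) (by fun_prop) fun ω => by
      rw [Real.norm_of_nonneg (by positivity)]
      exact mul_le_mul (hp ω) (hq ω) (by positivity) (by positivity)
  have i2 : Integrable (fun ω => ‖S ω‖ ^ 2 * (conj (S ω) * d ω).re) P :=
    integrable_of_bdd (C := C ^ 2 * (C * C))
      ((hS.norm.pow_const 2).mul
        (Complex.measurable_re.comp ((Complex.continuous_conj.measurable.comp hS).mul hd)))
      fun ω => by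
        rw [norm_mul, Real.norm_of_nonneg (by positivity : 0 ≤ ‖S ω‖ ^ 2)]
        refine mul_le_mul (hp ω) ?_ (norm_nonneg _) (by positivity)
        refine (Complex.abs_re_le_norm _).trans ?_
        rw [norm_mul, RCLike.norm_conj]
        exact mul_le_mul (hSC ω) (hdC ω) (norm_nonneg _) hC
  have i5 : Integrable (fun ω => ‖S ω + d ω‖ ^ 4) P :=
    integrable_of_bdd (C := (C + C) ^ 4) (by fun_prop) fun ω => by
      rw [norm_pow, norm_norm]
      gcongr
      exact (norm_add_le _ _).trans (add_le_add (hSC ω) (hdC ω))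
  have h3 : ∫ ω, ‖S ω‖ ^ 2 * ‖d ω‖ ^ 2 ∂P ≤ A * D :=
    integral_mul_le_sqrt_mul_sqrt (by fun_prop) (by fun_prop) (fun _ => by positivity)
      (fun _ => by positivity) hp hq hA hD (by simpa only [← pow_mul] using hSA)
      (by simpa only [← pow_mul] using hdD)
  have h : ∫ ω, ‖S ω + d ω‖ ^ 4 ∂P ≤ ∫ ω, (‖S ω‖ ^ 4 + 4 * (‖S ω‖ ^ 2 * (conj (S ω) * d ω).re) +
      8 * (‖S ω‖ ^ 2 * ‖d ω‖ ^ 2) + 3 * ‖d ω‖ ^ 4) ∂P :=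
    integral_mono i5 (((i1.add (i2.const_mul 4)).add (i3.const_mul 8)).add (i4.const_mul 3))
      fun ω => norm_add_pow_four_le (S ω) (d ω)
  have e1 : ∫ ω, (‖S ω‖ ^ 4 + 4 * (‖S ω‖ ^ 2 * (conj (S ω) * d ω).re) +
      8 * (‖S ω‖ ^ 2 * ‖d ω‖ ^ 2) + 3 * ‖d ω‖ ^ 4) ∂P =
      ∫ ω, (‖S ω‖ ^ 4 + 4 * (‖S ω‖ ^ 2 * (conj (S ω) * d ω).re) +
      8 * (‖S ω‖ ^ 2 * ‖d ω‖ ^ 2)) ∂P + ∫ ω, 3 * ‖d ω‖ ^ 4 ∂P :=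
    integral_add ((i1.add (i2.const_mul 4)).add (i3.const_mul 8)) (i4.const_mul 3)
  rw [e1, integral_add_three i1 (i2.const_mul 4) (i3.const_mul 8), integral_const_mul,
    integral_const_mul, integral_const_mul, h0] at h
  nlinarith [mul_nonneg hA hD, sq_nonneg D]

variable {X Y : Type*} [MeasurableSpace X] [MeasurableSpace Y] {ν : Measure X} {π : Measure Y}
  [IsProbabilityMeasure ν] [IsProbabilityMeasure π]

/-- The induction step on the number of coordinates: `S` depends on the later ones only, and the
increment has mean zero in the coordinate being peeled off, so Fubini kills the linear term. -/
lemma fourth_moment_prod_le {S : Y → ℂ} {d : X × Y → ℂ} (hS : Measurable S) (hd : Measurable d)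
    {C : ℝ} (hSC : ∀ y, ‖S y‖ ≤ C) (hdC : ∀ p, ‖d p‖ ≤ C) (h0 : ∀ y, ∫ x, d (x, y) ∂ν = 0)
    {A D : ℝ} (hA : 0 ≤ A) (hD : 0 ≤ D) (hSA : ∫ y, ‖S y‖ ^ 4 ∂π ≤ A ^ 2)
    (hdD : ∫ p, ‖d p‖ ^ 4 ∂(ν.prod π) ≤ D ^ 2) :
    ∫ p, ‖S p.2 + d p‖ ^ 4 ∂(ν.prod π) ≤ (A + 4 * D) ^ 2 := by
  obtain ⟨x₀⟩ : Nonempty X := ν.nonempty_of_neZero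
  obtain ⟨y₀⟩ : Nonempty Y := π.nonempty_of_neZero
  have hC : 0 ≤ C := (norm_nonneg _).trans (hSC y₀)
  have hSm : Measurable fun p : X × Y => S p.2 := hS.comp measurable_snd
  have hi : Integrable (fun p : X × Y => ‖S p.2‖ ^ 2 * (conj (S p.2) * d p).re) (ν.prod π) := by
    refine integrable_of_bdd (C := C ^ 2 * (C * C)) ?_ fun p => ?_
    · exact (hSm.norm.pow_const 2).mul (Complex.measurable_re.comp
        ((Complex.continuous_conj.measurable.comp hSm).mul hd))
    · rw [norm_mul, norm_pow, norm_norm]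
      refine mul_le_mul (by gcongr; exact hSC _) ?_ (norm_nonneg _) (by positivity)
      refine (Complex.abs_re_le_norm _).trans ?_
      rw [norm_mul, RCLike.norm_conj]
      exact mul_le_mul (hSC _) (hdC p) (norm_nonneg _) hC
  have hz : ∫ p, ‖S p.2‖ ^ 2 * (conj (S p.2) * d p).re ∂(ν.prod π) = 0 := by
    rw [integral_prod_symm _ hi]
    refine integral_eq_zero_of_ae (Eventually.of_forall fun y => ?_)
    have hdi : Integrable (fun x => d (x, y)) ν :=
      integrable_of_bdd (hd.comp measurable_prodMk_right) fun x => hdC (x, y)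
    simp only [Pi.zero_apply]
    rw [integral_const_mul]
    have h1 : ∫ x, (conj (S y) * d (x, y)).re ∂ν = (∫ x, conj (S y) * d (x, y) ∂ν).re :=
      integral_re (hdi.const_mul _)
    rw [h1, integral_const_mul, h0, mul_zero, Complex.zero_re, mul_zero]
  have hs : ∫ p : X × Y, ‖S p.2‖ ^ 4 ∂(ν.prod π) ≤ A ^ 2 := by
    rw [integral_fun_snd (μ := ν) (ν := π) (fun y => ‖S y‖ ^ 4), probReal_univ, one_smul]
    exact hSA
  exact fourth_moment_add_le hSm hd (fun p => hSC p.2) hdC hz hA hD hs hdD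

lemma norm_linear_le {E : Type*} {n : ℕ} {h : E → ℂ} {m : ℝ} (hm : ∀ x, ‖h x‖ ≤ m)
    (u : Fin n → ℂ) (x : Fin n → E) : ‖∑ j, u j * h (x j)‖ ≤ (∑ j, ‖u j‖) * m := by
  rw [Finset.sum_mul]
  refine norm_sum_le_of_le _ fun j _ => ?_
  rw [norm_mul]
  gcongr
  exact hm _

/-- The centred quadratic form of the entries `h (x i)`. -/
def centredForm {E : Type*} {n : ℕ} (h : E → ℂ) (v : ℝ) (B : Matrix (Fin n) (Fin n) ℂ) (x : Fin n → E) : ℂ :=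
  ∑ i, ∑ j, B i j * (conj (h (x i)) * h (x j)) - (v : ℂ) * ∑ i, B i i

/-- The three terms added in coordinate `x` are centred in `x` when `h` has mean zero and `‖h‖²` has
mean `v`. -/
lemma centredForm_cons {E : Type*} {n : ℕ} (h : E → ℂ) (v : ℝ) (B : Matrix (Fin (n + 1)) (Fin (n + 1)) ℂ)
    (x : E) (y : Fin n → E) : centredForm h v B (Fin.cons x y) =
      centredForm h v (B.submatrix Fin.succ Fin.succ) y +
        (conj (h x) * (∑ j : Fin n, B 0 j.succ * h (y j)) +
          h x * (∑ i : Fin n, B i.succ 0 * conj (h (y i))) +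
            B 0 0 * ((‖h x‖ ^ 2 - v : ℝ) : ℂ)) := by
  simp only [centredForm, Fin.sum_univ_succ, Fin.cons_zero, Fin.cons_succ, submatrix_apply,
    Finset.sum_add_distrib, Finset.mul_sum]
  push_cast
  rw [← Complex.conj_mul']
  have e1 : ∀ i : Fin n, B 0 i.succ * (conj (h x) * h (y i)) = conj (h x) * (B 0 i.succ * h (y i)) :=
    fun i => by ring
  have e2 : ∀ i : Fin n, B i.succ 0 * (conj (h (y i)) * h x) = h x * (B i.succ 0 * conj (h (y i))) :=
    fun i => by ring
  simp only [e1, e2, mul_add, Finset.mul_sum]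
  ring

lemma norm_centredForm_le {E : Type*} {n : ℕ} {h : E → ℂ} {m : ℝ} (hm : ∀ x, ‖h x‖ ≤ m)
    (v : ℝ) (B : Matrix (Fin n) (Fin n) ℂ) (x : Fin n → E) :
    ‖centredForm h v B x‖ ≤ (∑ i, ∑ j, ‖B i j‖ * (m * m)) + ‖(v : ℂ) * ∑ i, B i i‖ := by
  refine (norm_sub_le _ _).trans (add_le_add ?_ le_rfl)
  refine norm_sum_le_of_le _ fun i _ => norm_sum_le_of_le _ fun j _ => ?_
  rw [norm_mul, norm_mul, RCLike.norm_conj]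
  gcongr
  · exact (norm_nonneg _).trans (hm (x i))
  · exact hm _
  · exact hm _

variable {E : Type*} [MeasurableSpace E] {ρ : Measure E} [IsProbabilityMeasure ρ]

lemma integral_pi_succ {F : Type*} [NormedAddCommGroup F] [NormedSpace ℝ F] (n : ℕ)
    (f : (Fin (n + 1) → E) → F) :
    ∫ x, f x ∂(Measure.pi fun _ => ρ) =
      ∫ p : E × (Fin n → E), f (Fin.cons p.1 p.2) ∂(ρ.prod (Measure.pi fun _ => ρ)) := by
  have h := (measurePreserving_piFinSuccAbove (fun _ : Fin (n + 1) => ρ) 0).symm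
  rw [← h.integral_comp' f]
  refine integral_congr_ae (Eventually.of_forall fun p => ?_)
  simp only [MeasurableEquiv.piFinSuccAbove_symm_apply, Fin.insertNthEquiv, Equiv.coe_fn_mk,
    Fin.insertNth_zero']

lemma measurable_cons (n : ℕ) :
    Measurable fun p : E × (Fin n → E) => (Fin.cons p.1 p.2 : Fin (n + 1) → E) := by
  refine measurable_pi_iff.2 fun i => ?_
  refine Fin.cases ?_ (fun i => ?_) i
  · simpa using measurable_fst
  · simp only [Fin.cons_succ]
    fun_prop

/-- A fourth moment bound under bounded differences. -/
theorem fourth_moment_bddDiff (n : ℕ) {f : (Fin n → E) → ℂ} (hf : Measurable f) {C δ : ℝ}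
    (hC : ∀ x, ‖f x‖ ≤ C) (hδ0 : 0 ≤ δ) (hδ : ∀ x k y, ‖f (Function.update x k y) - f x‖ ≤ δ) :
    ∫ x, ‖f x - ∫ z, f z ∂(Measure.pi fun _ => ρ)‖ ^ 4 ∂(Measure.pi fun _ => ρ) ≤
      (4 * n * δ ^ 2) ^ 2 := by
  induction n with
  | zero =>
    have h : ∀ x : Fin 0 → E, f x - ∫ z, f z ∂(Measure.pi fun _ => ρ) = 0 := fun x => by
      have : ∀ z, f z = f x := fun z => congrArg f (Subsingleton.elim z x)
      simp [this]
    simp [h]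
  | succ n ih =>
    obtain ⟨e₀⟩ : Nonempty E := ρ.nonempty_of_neZero
    set π : Measure (Fin n → E) := Measure.pi fun _ => ρ
    have hfc : Measurable fun p : E × (Fin n → E) => f (Fin.cons p.1 p.2) :=
      hf.comp (measurable_cons n)
    have hC0 : 0 ≤ C := (norm_nonneg _).trans (hC fun _ => e₀)
    -- Averaging out the first coordinate preserves the bound and the bounded differences. So `f`
    -- minus its mean splits into the centred `g`, treated by induction, and `f - g`, an increment
    -- of size at most `δ`.
    set g : (Fin n → E) → ℂ := fun y => ∫ x, f (Fin.cons x y) ∂ρ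
    have hi : ∀ y : Fin n → E, Integrable (fun x => f (Fin.cons x y)) ρ := fun y =>
      integrable_of_bdd (hfc.comp measurable_prodMk_right) fun x => hC _
    have hgm : Measurable g := (hfc.stronglyMeasurable.integral_prod_left (μ := ρ)).measurable
    have hgC : ∀ y, ‖g y‖ ≤ C := fun y =>
      (norm_integral_le_of_norm_le_const (Eventually.of_forall fun x => hC _)).trans (by simp)
    have hgδ : ∀ x k y, ‖g (Function.update x k y) - g x‖ ≤ δ := fun x k y => by
      rw [← integral_sub (hi _) (hi _)]
      refine (norm_integral_le_of_norm_le_const (Eventually.of_forall fun z => ?_)).trans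
        (b := δ * ρ.real Set.univ) (by simp)
      simp only [Fin.cons_update]
      exact hδ _ _ _
    have hint : ∫ z, f z ∂(Measure.pi fun _ => ρ) = ∫ y, g y ∂π := by
      rw [integral_pi_succ, integral_prod_symm]
      exact integrable_of_bdd hfc fun p => hC _
    set c₀ := ∫ y, g y ∂π
    have hc₀ : ‖c₀‖ ≤ C :=
      (norm_integral_le_of_norm_le_const (Eventually.of_forall fun x => hgC _)).trans (by simp)
    have hd : ∀ p : E × (Fin n → E), ‖f (Fin.cons p.1 p.2) - g p.2‖ ≤ δ := fun p => by
      have : f (Fin.cons p.1 p.2) - g p.2 =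
          ∫ x, (f (Fin.cons p.1 p.2) - f (Fin.cons x p.2)) ∂ρ := by
        rw [integral_sub (integrable_const _) (hi _)]
        simp [g]
      rw [this]
      refine (norm_integral_le_of_norm_le_const (Eventually.of_forall fun z => ?_)).trans
        (b := δ * ρ.real Set.univ) (by simp)
      have := hδ (Fin.cons z p.2) 0 p.1
      rwa [Fin.update_cons_zero] at this
    have hdm : Measurable fun p : E × (Fin n → E) => f (Fin.cons p.1 p.2) - g p.2 :=
      hfc.sub (hgm.comp measurable_snd)
    have key := fourth_moment_prod_le (ν := ρ) (π := π) (S := fun y => g y - c₀)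
      (d := fun p => f (Fin.cons p.1 p.2) - g p.2) (hgm.sub_const _) hdm (C := C + C + δ)
      (fun y => (norm_sub_le _ _).trans (by linarith [hgC y]))
      (fun p => (hd p).trans (by linarith)) (fun y => by
        have := integral_sub (hi y) (integrable_const (g y))
        refine this.trans ?_
        simp [g]) (A := 4 * n * δ ^ 2) (D := δ ^ 2) (by positivity) (by positivity)
      (ih hgm hgC hgδ) (by
        refine (integral_mono (integrable_of_bdd (C := δ ^ 4) (by fun_prop) fun p => ?_)
          (integrable_const (δ ^ 4)) fun p => ?_).trans_eq ?_
        · rw [norm_pow, norm_norm]; gcongr; exact hd p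
        · simp only; gcongr; exact hd p
        · simp; ring)
    rw [integral_pi_succ, hint]
    refine (le_of_eq ?_).trans (key.trans_eq ?_)
    · simp only [π]
      refine integral_congr_ae (Eventually.of_forall fun p => ?_)
      simp only
      congr 2
      ring
    · push_cast; ring

/-- The increment of coordinate `j` has fourth moment at most `(m² |u_j|²)²`, and the square roots
of these bounds sum to a multiple of `nsq u`. -/
lemma fourth_moment_linear (n : ℕ) {h : E → ℂ} (hh : Measurable h) {m : ℝ} (hm0 : 0 ≤ m)
    (hm : ∀ x, ‖h x‖ ≤ m) (h0 : ∫ x, h x ∂ρ = 0) (u : Fin n → ℂ) :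
    ∫ x, ‖∑ j, u j * h (x j)‖ ^ 4 ∂(Measure.pi fun _ => ρ) ≤ (4 * m ^ 2 * nsq u) ^ 2 := by
  induction n with
  | zero => simp; positivity
  | succ n ih =>
    have hSm : Measurable fun y : Fin n → E => ∑ j, u j.succ * h (y j) := by fun_prop
    have hd : ∀ p : E × (Fin n → E), ‖u 0 * h p.1‖ ≤ ‖u 0‖ * m := fun p => by
      rw [norm_mul]; gcongr; exact hm _
    have key := fourth_moment_prod_le (ν := ρ) (π := Measure.pi fun _ : Fin n => ρ)
      (S := fun y => ∑ j, u j.succ * h (y j)) (d := fun p => u 0 * h p.1) hSm (by fun_prop)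
      (C := (∑ j : Fin n, ‖u j.succ‖) * m + ‖u 0‖ * m)
      (fun y => (norm_linear_le hm _ y).trans (le_add_of_nonneg_right (by positivity)))
      (fun p => (hd p).trans (le_add_of_nonneg_left (by positivity)))
      (fun y => by rw [integral_const_mul, h0, mul_zero])
      (A := 4 * m ^ 2 * nsq fun j : Fin n => u j.succ) (D := (‖u 0‖ * m) ^ 2)
      (by have := nsq_nonneg fun j : Fin n => u j.succ
          positivity) (by positivity) (ih _) (by
        refine (integral_mono (integrable_of_bdd (C := (‖u 0‖ * m) ^ 4) (by fun_prop) fun p => ?_)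
          (integrable_const ((‖u 0‖ * m) ^ 4)) fun p => ?_).trans_eq ?_
        · rw [norm_pow, norm_norm]; gcongr; exact hd p
        · simp only; gcongr; exact hd p
        · simp; ring)
    rw [integral_pi_succ]
    refine (le_of_eq ?_).trans (key.trans_eq ?_)
    · refine integral_congr_ae (Eventually.of_forall fun p => ?_)
      simp only [Fin.sum_univ_succ, Fin.cons_zero, Fin.cons_succ]
      rw [add_comm]
    · simp only [nsq, Fin.sum_univ_succ]; ring

lemma measurable_centredForm {n : ℕ} {h : E → ℂ} (hh : Measurable h) (v : ℝ)
    (B : Matrix (Fin n) (Fin n) ℂ) : Measurable (centredForm h v B) := by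
  unfold centredForm
  have hc : Measurable fun x => conj (h x) := Complex.continuous_conj.measurable.comp hh
  fun_prop

/-- The fourth moment of a centred quadratic form in bounded independent variables. -/
theorem fourth_moment_centredForm (n : ℕ) {h : E → ℂ} (hh : Measurable h) {m : ℝ} (hm0 : 0 ≤ m)
    (hm : ∀ x, ‖h x‖ ≤ m) (h0 : ∫ x, h x ∂ρ = 0) {τ : ℝ} (hτ : 0 ≤ τ)
    (B : Matrix (Fin n) (Fin n) ℂ) (hrow : ∀ i, ∑ j, ‖B i j‖ ^ 2 ≤ τ ^ 2)
    (hcol : ∀ j, ∑ i, ‖B i j‖ ^ 2 ≤ τ ^ 2) :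
    ∫ x, ‖centredForm h (∫ x, ‖h x‖ ^ 2 ∂ρ) B x‖ ^ 4 ∂(Measure.pi fun _ => ρ) ≤
      (120 * n * (m ^ 4 * τ ^ 2)) ^ 2 := by
  set v := ∫ x, ‖h x‖ ^ 2 ∂ρ
  have hcm : Measurable fun x => conj (h x) := Complex.continuous_conj.measurable.comp hh
  have hc0 : ∫ x, conj (h x) ∂ρ = 0 := by rw [integral_conj, h0, map_zero]
  have hhi : Integrable h ρ := integrable_of_bdd hh hm
  have hhi2 : Integrable (fun x => ‖h x‖ ^ 2) ρ := integrable_of_bdd (C := m ^ 2) (by fun_prop)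
    fun x => by rw [norm_pow, norm_norm]; gcongr; exact hm x
  have hv0 : 0 ≤ v := integral_nonneg fun x => by positivity
  have hvm : v ≤ m ^ 2 := by
    refine (integral_mono hhi2 (integrable_const (m ^ 2)) fun x => ?_).trans_eq (by simp)
    simp only; gcongr; exact hm x
  induction n with
  | zero => simp [centredForm]
  | succ n ih =>
    set π : Measure (Fin n → E) := Measure.pi fun _ => ρ
    set U : (Fin n → E) → ℂ := fun y => ∑ j : Fin n, B 0 j.succ * h (y j)
    set W : (Fin n → E) → ℂ := fun y => ∑ i : Fin n, B i.succ 0 * conj (h (y i))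
    have hUm : Measurable U := by fun_prop
    have hWm : Measurable W := by fun_prop
    set cu := (∑ j : Fin n, ‖B 0 j.succ‖) * m
    set cw := (∑ j : Fin n, ‖B j.succ 0‖) * m
    have hU : ∀ y, ‖U y‖ ≤ cu := norm_linear_le hm _
    have hW : ∀ y, ‖W y‖ ≤ cw := norm_linear_le (h := fun x => conj (h x))
      (fun x => by rw [RCLike.norm_conj]; exact hm x) _
    have hB : ∀ i j, ‖B i j‖ ≤ τ := fun i j => le_of_sq_le_sq ((Finset.single_le_sum
      (f := fun j => ‖B i j‖ ^ 2) (fun _ _ => sq_nonneg _) (Finset.mem_univ j)).trans (hrow i)) hτ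
    have hnU : nsq (fun j : Fin n => B 0 j.succ) ≤ τ ^ 2 := by
      refine le_trans ?_ (hrow 0)
      rw [nsq, Fin.sum_univ_succ]
      exact le_add_of_nonneg_left (by positivity)
    have hnW : nsq (fun j : Fin n => B j.succ 0) ≤ τ ^ 2 := by
      refine le_trans ?_ (hcol 0)
      rw [nsq, Fin.sum_univ_succ]
      exact le_add_of_nonneg_left (by positivity)
    have mU : ∫ y, ‖U y‖ ^ 4 ∂π ≤ (4 * m ^ 2 * τ ^ 2) ^ 2 := by
      refine (fourth_moment_linear n hh hm0 hm h0 _).trans ?_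
      have := nsq_nonneg fun j : Fin n => B 0 j.succ
      gcongr
    have mW : ∫ y, ‖W y‖ ^ 4 ∂π ≤ (4 * m ^ 2 * τ ^ 2) ^ 2 := by
      refine (fourth_moment_linear n hcm hm0 (fun x => by rw [RCLike.norm_conj]; exact hm x)
        hc0 _).trans ?_
      have := nsq_nonneg fun j : Fin n => B j.succ 0
      gcongr
    set d : E × (Fin n → E) → ℂ := fun p => conj (h p.1) * U p.2 + h p.1 * W p.2 +
      B 0 0 * ((‖h p.1‖ ^ 2 - v : ℝ) : ℂ)
    have hdm : Measurable d := by
      have : Measurable fun p : E × (Fin n → E) => conj (h p.1) := hcm.comp measurable_fst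
      fun_prop
    have hv : ∀ x, ‖((‖h x‖ ^ 2 - v : ℝ) : ℂ)‖ ≤ m ^ 2 := fun x => by
      rw [Complex.norm_real, Real.norm_eq_abs, abs_le]
      have h1 : ‖h x‖ ^ 2 ≤ m ^ 2 := by gcongr; exact hm x
      have h2 := sq_nonneg ‖h x‖
      constructor <;> linarith
    have hd1 : ∀ p, ‖d p‖ ≤ m * ‖U p.2‖ + m * ‖W p.2‖ + τ * m ^ 2 := fun p => by
      refine (norm_add₃_le).trans ?_
      rw [norm_mul, norm_mul, norm_mul, RCLike.norm_conj]
      gcongr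
      · exact hm _
      · exact hm _
      · exact hB 0 0
      · exact hv _
    have hd : ∀ p, ‖d p‖ ≤ m * cu + m * cw + τ * m ^ 2 := fun p => by
      refine (hd1 p).trans ?_
      gcongr
      · exact hU _
      · exact hW _
    have iU : Integrable (fun p : E × (Fin n → E) => ‖U p.2‖ ^ 4) (ρ.prod π) :=
      integrable_of_bdd (C := cu ^ 4) (by fun_prop) fun p => by
        rw [norm_pow, norm_norm]; gcongr; exact hU _
    have iW : Integrable (fun p : E × (Fin n → E) => ‖W p.2‖ ^ 4) (ρ.prod π) :=
      integrable_of_bdd (C := cw ^ 4) (by fun_prop) fun p => by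
        rw [norm_pow, norm_norm]; gcongr; exact hW _
    -- The three terms contribute `27 · 16`, `27 · 16` and `27`, and `891 ≤ 30²`. The `120` of the
    -- statement is `4 · 30`.
    have hdD : ∫ p, ‖d p‖ ^ 4 ∂(ρ.prod π) ≤ (30 * (m ^ 4 * τ ^ 2)) ^ 2 := by
      have three : ∀ a b c : ℝ, (a + b + c) ^ 4 ≤ 27 * (a ^ 4 + b ^ 4 + c ^ 4) := fun a b c => by
        have h1 : (a + b + c) ^ 2 ≤ 3 * (a ^ 2 + b ^ 2 + c ^ 2) := by
          nlinarith [sq_nonneg (a - b), sq_nonneg (b - c), sq_nonneg (a - c)]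
        have h2 : (a ^ 2 + b ^ 2 + c ^ 2) ^ 2 ≤ 3 * (a ^ 4 + b ^ 4 + c ^ 4) := by
          nlinarith [sq_nonneg (a ^ 2 - b ^ 2), sq_nonneg (b ^ 2 - c ^ 2),
            sq_nonneg (a ^ 2 - c ^ 2)]
        calc (a + b + c) ^ 4 = ((a + b + c) ^ 2) ^ 2 := by ring
          _ ≤ (3 * (a ^ 2 + b ^ 2 + c ^ 2)) ^ 2 := by gcongr
          _ ≤ _ := by nlinarith
      have h1 : ∫ p, ‖d p‖ ^ 4 ∂(ρ.prod π) ≤ ∫ p : E × (Fin n → E),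
          (27 * m ^ 4 * ‖U p.2‖ ^ 4 + 27 * m ^ 4 * ‖W p.2‖ ^ 4 + 27 * (τ * m ^ 2) ^ 4) ∂(ρ.prod π) := by
        refine integral_mono (integrable_of_bdd (C := (m * cu + m * cw + τ * m ^ 2) ^ 4)
          (by fun_prop) fun p => ?_) (((iU.const_mul _).add (iW.const_mul _)).add
            (integrable_const _)) fun p => ?_
        · rw [norm_pow, norm_norm]; gcongr; exact hd p
        · simp only
          calc ‖d p‖ ^ 4 ≤ (m * ‖U p.2‖ + m * ‖W p.2‖ + τ * m ^ 2) ^ 4 := by gcongr; exact hd1 p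
            _ ≤ _ := three _ _ _
            _ = _ := by ring
      have eU : ∫ p : E × (Fin n → E), ‖U p.2‖ ^ 4 ∂(ρ.prod π) = ∫ y, ‖U y‖ ^ 4 ∂π := by
        have := integral_fun_snd (μ := ρ) (ν := π) (fun y => ‖U y‖ ^ 4)
        rw [this]; simp
      have eW : ∫ p : E × (Fin n → E), ‖W p.2‖ ^ 4 ∂(ρ.prod π) = ∫ y, ‖W y‖ ^ 4 ∂π := by
        have := integral_fun_snd (μ := ρ) (ν := π) (fun y => ‖W y‖ ^ 4)
        rw [this]; simp
      rw [integral_add_three (iU.const_mul _) (iW.const_mul _) (integrable_const _),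
        integral_const_mul, integral_const_mul, eU, eW] at h1
      simp only [integral_const, probReal_univ, one_smul] at h1
      refine h1.trans ?_
      have m4 : 0 ≤ 27 * m ^ 4 := by positivity
      nlinarith [mul_le_mul_of_nonneg_left mU m4, mul_le_mul_of_nonneg_left mW m4,
        mul_nonneg (pow_nonneg hm0 8) (pow_nonneg hτ 4)]
    have key := fourth_moment_prod_le (ν := ρ) (π := π)
      (S := centredForm h v (B.submatrix Fin.succ Fin.succ)) (d := d)
      (measurable_centredForm hh v _) hdm
      (C := ((∑ i, ∑ j, ‖B.submatrix Fin.succ Fin.succ i j‖ * (m * m)) +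
        ‖(v : ℂ) * ∑ i, B.submatrix Fin.succ Fin.succ i i‖) + (m * cu + m * cw + τ * m ^ 2))
      (fun y => (norm_centredForm_le hm v _ y).trans (le_add_of_nonneg_right (by positivity)))
      (fun p => (hd p).trans (le_add_of_nonneg_left (by positivity)))
      (fun y => by
        have i1 : Integrable (fun x => conj (h x) * U y) ρ :=
          (integrable_of_bdd hcm fun x => by rw [RCLike.norm_conj]; exact hm x).mul_const _
        have i2 : Integrable (fun x => h x * W y) ρ := hhi.mul_const _
        have i3 : Integrable (fun x => B 0 0 * ((‖h x‖ ^ 2 - v : ℝ) : ℂ)) ρ :=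
          ((hhi2.sub (integrable_const v)).ofReal).const_mul _
        have := integral_add_three i1 i2 i3
        rw [integral_mul_const, integral_mul_const, hc0, h0, integral_const_mul,
          integral_complex_ofReal, integral_sub hhi2 (integrable_const _)] at this
        refine this.trans ?_
        simp [v])
      (A := 120 * n * (m ^ 4 * τ ^ 2)) (D := 30 * (m ^ 4 * τ ^ 2)) (by positivity)
      (by positivity) (ih _ (fun i => ?_) fun j => ?_) hdD
    · rw [integral_pi_succ]
      refine (le_of_eq ?_).trans (key.trans_eq ?_)
      · refine integral_congr_ae (Eventually.of_forall fun p => ?_)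
        simp only [centredForm_cons]
        rfl
      · push_cast; ring
    · refine le_trans ?_ (hrow i.succ)
      rw [Fin.sum_univ_succ]
      exact le_add_of_nonneg_left (by positivity)
    · refine le_trans ?_ (hcol j.succ)
      rw [Fin.sum_univ_succ]
      exact le_add_of_nonneg_left (by positivity)

end FourthMoment

/-! ### Truncation -/

section Truncation

variable {μ : Measure ℂ}

lemma integrable_norm_sq_of_integral_eq_one (h1 : ∫ x, ‖x‖ ^ 2 ∂μ = 1) :
    Integrable (fun x : ℂ => ‖x‖ ^ 2) μ := by
  by_contra h
  rw [integral_undef h] at h1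
  exact zero_ne_one h1

/-- Cut at a level `n` and subtract the mean of the cut variable. That mean tends to zero, and
dominated convergence needs only the second moment. -/
lemma exists_truncation [IsProbabilityMeasure μ] (h0 : ∫ x, x ∂μ = 0) (h1 : ∫ x, ‖x‖ ^ 2 ∂μ = 1) {ε : ℝ} (hε : 0 < ε) :
    ∃ (h : ℂ → ℂ) (m : ℝ), 0 ≤ m ∧ Measurable h ∧ (∀ x, ‖h x‖ ≤ m) ∧ ∫ x, h x ∂μ = 0 ∧
      ∫ x, ‖x - h x‖ ^ 2 ∂μ ≤ ε ∧ |∫ x, ‖h x‖ ^ 2 ∂μ - 1| ≤ ε := by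
  have hsq := integrable_norm_sq_of_integral_eq_one h1
  have hid : Integrable (fun x : ℂ => x) μ := by
    refine Integrable.mono' ((integrable_const (1 : ℝ)).add hsq) measurable_id.aestronglyMeasurable
      (Eventually.of_forall fun x => ?_)
    simp only [Pi.add_apply]
    nlinarith [sq_nonneg (‖x‖ - 1), norm_nonneg x]
  set y : ℕ → ℂ → ℂ := fun n x => if ‖x‖ ≤ n then x else 0
  have hym : ∀ n, Measurable (y n) := fun n =>
    Measurable.ite (measurableSet_le measurable_norm measurable_const) measurable_id
      measurable_const
  have hyn : ∀ n x, ‖y n x‖ ≤ n := fun n x => by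
    by_cases h : ‖x‖ ≤ n <;> simp [y, h]
  have hyx : ∀ n x, ‖y n x‖ ≤ ‖x‖ := fun n x => by
    by_cases h : ‖x‖ ≤ n <;> simp [y, h]
  have hxy : ∀ n x, ‖x - y n x‖ ≤ ‖x‖ := fun n x => by
    by_cases h : ‖x‖ ≤ n <;> simp [y, h]
  have hyev : ∀ x, ∀ᶠ n in atTop, y n x = x := fun x => by
    obtain ⟨n, hn⟩ := exists_nat_ge ‖x‖
    filter_upwards [eventually_ge_atTop n] with k hk
    have : (n : ℝ) ≤ k := by exact_mod_cast hk
    simp [y, hn.trans this]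
  set e : ℕ → ℂ := fun n => ∫ x, y n x ∂μ
  have hylim : ∀ x, Tendsto (fun n => y n x) atTop (𝓝 x) := fun x =>
    tendsto_const_nhds.congr' ((hyev x).mono fun n hn => hn.symm)
  have he : Tendsto e atTop (𝓝 0) := by
    rw [← h0]
    exact tendsto_integral_of_dominated_convergence (fun x => ‖x‖)
      (fun n => (hym n).aestronglyMeasurable) hid.norm
      (fun n => Eventually.of_forall fun x => hyx n x) (Eventually.of_forall hylim)
  have hen : ∀ n, ‖e n‖ ≤ n := fun n =>
    (norm_integral_le_of_norm_le_const (Eventually.of_forall (hyn n))).trans (by simp)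
  set I := ∫ x, ‖x‖ ∂μ
  have heI : ∀ n, ‖e n‖ ≤ I := fun n => (norm_integral_le_integral_norm _).trans
    (integral_mono (integrable_of_bdd (hym n) (hyn n)).norm hid.norm (hyx n))
  have hdom : Integrable (fun x : ℂ => 2 * ‖x‖ ^ 2 + 2 * I ^ 2) μ :=
    (hsq.const_mul 2).add (integrable_const _)
  have hbd : ∀ a b r t : ℝ, 0 ≤ r → r ≤ a + b → a ≤ t → 0 ≤ t → 0 ≤ b → b ≤ I →
      r ^ 2 ≤ 2 * t ^ 2 + 2 * I ^ 2 := fun a b r t hr h1 h2 ht hb h3 => by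
    have : r ^ 2 ≤ (t + I) ^ 2 := by gcongr; linarith
    nlinarith [sq_nonneg (t - I)]
  have l1 : Tendsto (fun n => ∫ x, ‖x - (y n x - e n)‖ ^ 2 ∂μ) atTop (𝓝 (∫ _x : ℂ, (0 : ℝ) ∂μ)) := by
    refine tendsto_integral_of_dominated_convergence _
      (fun n => ((measurable_id.sub ((hym n).sub_const _)).norm.pow_const 2).aestronglyMeasurable)
      hdom (fun n => Eventually.of_forall fun x => ?_) (Eventually.of_forall fun x => ?_)
    · rw [norm_pow, norm_norm]
      refine hbd ‖x - y n x‖ ‖e n‖ _ _ (norm_nonneg _) ?_ (hxy n x) (norm_nonneg _)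
        (norm_nonneg _) (heI n)
      rw [← sub_add]
      exact norm_add_le _ _
    · have := ((hylim x).sub he).const_sub x
      simpa using this.norm.pow 2
  have l2 : Tendsto (fun n => ∫ x, ‖y n x - e n‖ ^ 2 ∂μ) atTop (𝓝 (∫ x, ‖x‖ ^ 2 ∂μ)) := by
    refine tendsto_integral_of_dominated_convergence _
      (fun n => (((hym n).sub_const _).norm.pow_const 2).aestronglyMeasurable)
      hdom (fun n => Eventually.of_forall fun x => ?_) (Eventually.of_forall fun x => ?_)
    · rw [norm_pow, norm_norm]
      exact hbd ‖y n x‖ ‖e n‖ _ _ (norm_nonneg _) (norm_sub_le _ _) (hyx n x) (norm_nonneg _)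
        (norm_nonneg _) (heI n)
    · have := (hylim x).sub he
      simpa using this.norm.pow 2
  rw [integral_zero] at l1
  rw [h1] at l2
  obtain ⟨n, hn1, hn2⟩ := ((l1.eventually (ge_mem_nhds hε)).and
    (l2.eventually (Metric.closedBall_mem_nhds 1 hε))).exists
  refine ⟨fun x => y n x - e n, n + n, by positivity, (hym n).sub_const _, fun x =>
    (norm_sub_le _ _).trans (add_le_add (hyn n x) (hen n)), ?_, hn1, ?_⟩
  · rw [integral_sub (integrable_of_bdd (hym n) (hyn n)) (integrable_const _)]
    simp [e]
  · rwa [Real.dist_eq] at hn2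

end Truncation

/-! ### Quadratic forms of bounded matrices -/

section BoundedForm

variable {N : ℕ}

/-- The operator norm of `B` is at most `τ`, in the form in which it is used. -/
structure BoundedForm (τ : ℝ) (B : Matrix (Fin N) (Fin N) ℂ) : Prop where
  op : ∀ y, nsq (B *ᵥ y) ≤ τ ^ 2 * nsq y
  row : ∀ i, ∑ j, ‖B i j‖ ^ 2 ≤ τ ^ 2
  col : ∀ j, ∑ i, ‖B i j‖ ^ 2 ≤ τ ^ 2

lemma BoundedForm.norm_trace_le {τ : ℝ} (hτ : 0 ≤ τ) {B : Matrix (Fin N) (Fin N) ℂ}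
    (hB : BoundedForm τ B) : ‖∑ i, B i i‖ ≤ N * τ := by
  refine (norm_sum_le_of_le _ fun i _ => ?_).trans_eq (b := ∑ _i : Fin N, τ) (by simp)
  exact le_of_sq_le_sq ((Finset.single_le_sum (f := fun j => ‖B i j‖ ^ 2)
    (fun _ _ => sq_nonneg _) (Finset.mem_univ i)).trans (hB.row i)) hτ

lemma BoundedForm.norm_dotProduct_le {τ : ℝ} (hτ : 0 ≤ τ) {B : Matrix (Fin N) (Fin N) ℂ}
    (hB : BoundedForm τ B) (x y : Fin N → ℂ) : ‖star x ⬝ᵥ B *ᵥ y‖ ≤ τ * (√(nsq x) * √(nsq y)) := by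
  refine (CDMA.norm_dotProduct_le _ _).trans ?_
  have h : √(nsq (B *ᵥ y)) ≤ τ * √(nsq y) := by
    rw [← Real.sqrt_sq hτ, ← Real.sqrt_mul (sq_nonneg τ)]
    exact Real.sqrt_le_sqrt (hB.op y)
  rw [nsq_star]
  calc _ ≤ √(nsq x) * (τ * √(nsq y)) := by gcongr
    _ = _ := by ring

/-- Weighting by `η` linearizes the product, so that means or averages can be taken termwise; the
large weight `1 / η` falls on the truncation error, which will be of order `η²`. -/
lemma sqrt_mul_sqrt_le {a b η : ℝ} (ha : 0 ≤ a) (hb : 0 ≤ b) (hη : 0 < η) :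
    √a * √b ≤ η * a / 2 + b / (2 * η) := by
  have h1 := Real.sq_sqrt ha
  have h2 := Real.sq_sqrt hb
  have h3 : η * a / 2 + b / (2 * η) - √a * √b = (η * √a - √b) ^ 2 / (2 * η) := by
    field_simp
    nlinarith
  have h4 : 0 ≤ (η * √a - √b) ^ 2 / (2 * η) := by positivity
  linarith

lemma form_eq_centredForm (B : Matrix (Fin N) (Fin N) ℂ) (h : ℂ → ℂ) (v : ℝ) (x : Fin N → ℂ) :
    star (fun i => h (x i)) ⬝ᵥ B *ᵥ (fun i => h (x i)) =
      centredForm h v B x + (v : ℂ) * ∑ i, B i i := by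
  simp only [centredForm, dotProduct, mulVec, sub_add_cancel, Finset.mul_sum]
  refine Finset.sum_congr rfl fun i _ => Finset.sum_congr rfl fun j _ => ?_
  simp only [Pi.star_apply, starRingEnd_apply]
  ring

/-- With `z = h(x)` and `w = x - z`, `x^* B x - z^* B z = x^* B w + w^* B z`. What remains is the
centred form of `z` and the deviation of `v` from 1. The bound is deterministic, so it serves both
in mean and almost surely. -/
lemma norm_form_sub_trace_le {τ : ℝ} (hτ : 0 ≤ τ) {B : Matrix (Fin N) (Fin N) ℂ}
    (hB : BoundedForm τ B) (h : ℂ → ℂ) (v : ℝ) (x : Fin N → ℂ) {η : ℝ} (hη : 0 < η) :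
    ‖((1 / (N : ℝ) : ℝ) : ℂ) * (star x ⬝ᵥ B *ᵥ x) - ((1 / (N : ℝ) : ℝ) : ℂ) * ∑ i, B i i‖ ≤
      τ * (η * (1 / N * nsq x + 1 / N * nsq fun i => h (x i)) / 2 +
        (1 / N * nsq fun i => x i - h (x i)) / η) +
      ‖((1 / (N : ℝ) : ℝ) : ℂ) * centredForm h v B x‖ + |v - 1| * τ := by
  set z : Fin N → ℂ := fun i => h (x i)
  set w : Fin N → ℂ := fun i => x i - h (x i)
  have hw : w = x - z := rfl
  set r : ℂ := ((1 / (N : ℝ) : ℝ) : ℂ)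
  have hr : ‖r‖ = 1 / (N : ℝ) := by
    rw [Complex.norm_real, Real.norm_of_nonneg (by positivity)]
  have e : r * (star x ⬝ᵥ B *ᵥ x) - r * ∑ i, B i i =
      r * (star x ⬝ᵥ B *ᵥ w + star w ⬝ᵥ B *ᵥ z) + r * centredForm h v B x +
        (v - 1) * (r * ∑ i, B i i) := by
    have h1 := form_eq_centredForm B h v x
    have h2 : star x ⬝ᵥ B *ᵥ w + star w ⬝ᵥ B *ᵥ z = star x ⬝ᵥ B *ᵥ x - star z ⬝ᵥ B *ᵥ z := by
      rw [hw, star_sub, mulVec_sub, dotProduct_sub, sub_dotProduct]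
      ring
    rw [h2, h1]
    ring
  rw [e]
  refine norm_add₃_le.trans (add_le_add (add_le_add ?_ le_rfl) ?_)
  · rw [norm_mul, hr]
    have h1 := hB.norm_dotProduct_le hτ x w
    have h2 := hB.norm_dotProduct_le hτ w z
    have h3 := sqrt_mul_sqrt_le (nsq_nonneg x) (nsq_nonneg w) hη
    have h4 := sqrt_mul_sqrt_le (nsq_nonneg z) (nsq_nonneg w) hη
    have h5 : ‖star x ⬝ᵥ B *ᵥ w + star w ⬝ᵥ B *ᵥ z‖ ≤
        τ * (η * (nsq x + nsq z) / 2 + nsq w / η) := by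
      calc _ ≤ _ := norm_add_le _ _
        _ ≤ τ * (√(nsq x) * √(nsq w)) + τ * (√(nsq w) * √(nsq z)) := add_le_add h1 h2
        _ = τ * (√(nsq x) * √(nsq w) + √(nsq z) * √(nsq w)) := by ring
        _ ≤ τ * ((η * nsq x / 2 + nsq w / (2 * η)) + (η * nsq z / 2 + nsq w / (2 * η))) := by
          gcongr
        _ = _ := by ring
    calc _ ≤ 1 / (N : ℝ) * (τ * (η * (nsq x + nsq z) / 2 + nsq w / η)) := by gcongr
      _ = _ := by ring
  · rw [norm_mul, norm_mul, hr, ← Complex.ofReal_one, ← Complex.ofReal_sub, Complex.norm_real,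
      Real.norm_eq_abs]
    have h1 := hB.norm_trace_le hτ
    gcongr
    rcases Nat.eq_zero_or_pos N with rfl | hN
    · simpa using hτ
    · have hN' : (0 : ℝ) < N := by exact_mod_cast hN
      calc _ ≤ 1 / (N : ℝ) * (N * τ) := by gcongr
        _ = τ := by field_simp

variable {μ : Measure ℂ} [IsProbabilityMeasure μ]

lemma integrable_comp_eval {f : ℂ → ℝ} (hf : Integrable f μ) (i : Fin N) :
    Integrable (fun x : Fin N → ℂ => f (x i)) (Measure.pi fun _ => μ) :=
  (measurePreserving_eval (fun _ : Fin N => μ) i).integrable_comp_of_integrable hf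

lemma integral_avg {f : ℂ → ℝ} (hf : Integrable f μ) (hN : N ≠ 0) :
    ∫ x : Fin N → ℂ, 1 / (N : ℝ) * ∑ i, f (x i) ∂(Measure.pi fun _ => μ) = ∫ x, f x ∂μ := by
  rw [integral_const_mul, integral_finsetSum _ fun i _ => integrable_comp_eval hf i]
  have h : ∀ i : Fin N, ∫ x : Fin N → ℂ, f (x i) ∂(Measure.pi fun _ => μ) = ∫ x, f x ∂μ :=
    fun i => integral_comp_eval (μ := fun _ : Fin N => μ) hf.aestronglyMeasurable
  simp only [h, Finset.sum_const, Finset.card_univ, Fintype.card_fin, nsmul_eq_mul]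
  have : (N : ℝ) ≠ 0 := by exact_mod_cast hN
  field_simp

lemma fourth_moment_scaled_centredForm {h : ℂ → ℂ} (hh : Measurable h) {m : ℝ} (hm0 : 0 ≤ m)
    (hm : ∀ x, ‖h x‖ ≤ m) (h0 : ∫ x, h x ∂μ = 0) {τ : ℝ} (hτ : 0 ≤ τ)
    {B : Matrix (Fin N) (Fin N) ℂ} (hB : BoundedForm τ B) :
    ∫ x, ‖((1 / (N : ℝ) : ℝ) : ℂ) * centredForm h (∫ x, ‖h x‖ ^ 2 ∂μ) B x‖ ^ 4
      ∂(Measure.pi fun _ => μ) ≤ (120 * (m ^ 4 * τ ^ 2)) ^ 2 * (1 / (N : ℝ) ^ 2) := by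
  simp only [norm_mul, mul_pow, Complex.norm_real, Real.norm_of_nonneg
    (by positivity : 0 ≤ 1 / (N : ℝ))]
  rw [integral_const_mul]
  have h := fourth_moment_centredForm N hh hm0 hm h0 hτ B hB.row hB.col
  rcases Nat.eq_zero_or_pos N with rfl | hN
  · simp
  · have hN' : (0 : ℝ) < N := by exact_mod_cast hN
    calc _ ≤ (1 / (N : ℝ)) ^ 4 * (120 * N * (m ^ 4 * τ ^ 2)) ^ 2 := by gcongr
      _ = _ := by field_simp

/-- Normalized quadratic forms concentrate in mean around normalized traces, uniformly in the
matrix. -/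
theorem lintegral_form_sub_trace_le (h0 : ∫ x, x ∂μ = 0) (h1 : ∫ x, ‖x‖ ^ 2 ∂μ = 1) {τ : ℝ}
    (hτ : 0 ≤ τ) {ε : ℝ} (hε : 0 < ε) :
    ∃ N₀ : ℕ, ∀ N ≥ N₀, ∀ B : Matrix (Fin N) (Fin N) ℂ, BoundedForm τ B →
      ∫⁻ x, ‖((1 / (N : ℝ) : ℝ) : ℂ) * (star x ⬝ᵥ B *ᵥ x) -
        ((1 / (N : ℝ) : ℝ) : ℂ) * ∑ i, B i i‖ₑ ∂(Measure.pi fun _ => μ) ≤ ENNReal.ofReal ε := by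
  -- All contributions except the fourth moment add up to at most `(4 τ + 1) η`; the fourth moment
  -- takes the other half of `ε`.
  set η := min 1 (ε / (2 * (4 * τ + 1)))
  have hη : 0 < η := by positivity
  have hη1 : η ≤ 1 := min_le_left _ _
  have hη2 : (4 * τ + 1) * η ≤ ε / 2 := by
    have : η ≤ ε / (2 * (4 * τ + 1)) := min_le_right _ _
    rw [le_div_iff₀ (by positivity)] at this
    linarith
  obtain ⟨h, m, hm0, hh, hm, hh0, hε1, hε2⟩ := exists_truncation h0 h1 (ε := η ^ 2) (by positivity)
  set v := ∫ x, ‖h x‖ ^ 2 ∂μ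
  have hv : v ≤ 2 := by
    have := (abs_le.1 hε2).2
    nlinarith
  set Q := (120 * (m ^ 4 * τ ^ 2)) ^ 2 / η ^ 3
  obtain ⟨N₀, hN₀⟩ := exists_nat_ge (2 * Q / ε)
  refine ⟨N₀ + 1, fun N hN B hB => ?_⟩
  have hN1 : N ≠ 0 := by omega
  have hN2 : (1 : ℝ) ≤ N := by exact_mod_cast (by omega : 1 ≤ N)
  have hN3 : 2 * Q / ε ≤ N := hN₀.trans (by exact_mod_cast (by omega : N₀ ≤ N))
  set π : Measure (Fin N → ℂ) := Measure.pi fun _ => μ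
  set Z : (Fin N → ℂ) → ℝ := fun x => ‖((1 / (N : ℝ) : ℝ) : ℂ) * centredForm h v B x‖
  have hsq := integrable_norm_sq_of_integral_eq_one h1
  have ih2 : Integrable (fun x => ‖h x‖ ^ 2) μ := integrable_of_bdd (C := m ^ 2) (by fun_prop)
    fun x => by rw [norm_pow, norm_norm]; gcongr; exact hm x
  have id2 : Integrable (fun x => ‖x - h x‖ ^ 2) μ := by
    refine Integrable.mono' ((hsq.const_mul 2).add (ih2.const_mul 2))
      ((measurable_id.sub hh).norm.pow_const 2).aestronglyMeasurable
      (Eventually.of_forall fun x => ?_)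
    rw [norm_pow, norm_norm]
    have := norm_sub_le x (h x)
    have h0 := norm_nonneg (x - h x)
    simp only [Pi.add_apply]
    nlinarith [sq_nonneg (‖x‖ - ‖h x‖)]
  have hZ : ∫ x, Z x ^ 4 ∂π ≤ (120 * (m ^ 4 * τ ^ 2)) ^ 2 * (1 / (N : ℝ) ^ 2) :=
    fourth_moment_scaled_centredForm hh hm0 hm hh0 hτ hB
  have hZm : Measurable Z := ((measurable_centredForm hh v B).const_mul _).norm
  have iZ : Integrable (fun x => Z x ^ 4) π := by
    refine integrable_of_bdd (C := (‖((1 / (N : ℝ) : ℝ) : ℂ)‖ * ((∑ i, ∑ j, ‖B i j‖ * (m * m)) +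
      ‖(v : ℂ) * ∑ i, B i i‖)) ^ 4) (by fun_prop) fun x => ?_
    rw [norm_pow, norm_norm, norm_mul]
    gcongr
    exact norm_centredForm_le hm v B x
  have hτe : ∀ x, ‖((1 / (N : ℝ) : ℝ) : ℂ) * (star x ⬝ᵥ B *ᵥ x) -
      ((1 / (N : ℝ) : ℝ) : ℂ) * ∑ i, B i i‖ ≤
      (τ * η / 2) * (1 / N * nsq x) + (τ * η / 2) * (1 / N * nsq fun i => h (x i)) +
        ((τ / η) * (1 / N * nsq fun i => x i - h (x i)) + (1 / η ^ 3) * Z x ^ 4 +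
          (η + η ^ 2 * τ)) := fun x => by
    have b1 := norm_form_sub_trace_le hτ hB h v x hη
    -- Trades the first moment for the fourth, which is the one controlled.
    have b2 : Z x ≤ η + 1 / η ^ 3 * Z x ^ 4 := by
      have hZ0 : 0 ≤ Z x := norm_nonneg _
      rcases le_total (Z x) η with h | h
      · exact h.trans (le_add_of_nonneg_right (by positivity))
      · refine le_trans ?_ (le_add_of_nonneg_left hη.le)
        rw [one_div, ← div_eq_inv_mul, le_div_iff₀ (by positivity)]
        calc Z x * η ^ 3 ≤ Z x * Z x ^ 3 := by gcongr
          _ = _ := by ring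
    have b3 : |v - 1| * τ ≤ η ^ 2 * τ := by gcongr
    change _ ≤ _ + Z x + _ at b1
    refine b1.trans ?_
    have : τ * (η * (1 / N * nsq x + 1 / N * nsq fun i => h (x i)) / 2 +
        (1 / N * nsq fun i => x i - h (x i)) / η) = (τ * η / 2) * (1 / N * nsq x) +
        (τ * η / 2) * (1 / N * nsq fun i => h (x i)) +
        (τ / η) * (1 / N * nsq fun i => x i - h (x i)) := by ring
    rw [this]
    linarith
  have j1 : Integrable (fun x : Fin N → ℂ => (τ * η / 2) * (1 / N * nsq x)) π :=
    ((integrable_finsetSum _ fun i _ => integrable_comp_eval hsq i).const_mul _).const_mul _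
  have j2 : Integrable (fun x : Fin N → ℂ => (τ * η / 2) * (1 / N * nsq fun i => h (x i))) π :=
    ((integrable_finsetSum _ fun i _ => integrable_comp_eval ih2 i).const_mul _).const_mul _
  have j3 : Integrable (fun x : Fin N → ℂ => (τ / η) * (1 / N * nsq fun i => x i - h (x i))) π :=
    ((integrable_finsetSum _ fun i _ => integrable_comp_eval id2 i).const_mul _).const_mul _
  have j4 := iZ.const_mul (1 / η ^ 3)
  have j5 : Integrable (fun x : Fin N → ℂ => (τ / η) * (1 / N * nsq fun i => x i - h (x i)) +
      (1 / η ^ 3) * Z x ^ 4 + (η + η ^ 2 * τ)) π := (j3.add j4).add (integrable_const _)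
  have jall := (j1.add j2).add j5
  calc _ ≤ ∫⁻ x, ENNReal.ofReal ((τ * η / 2) * (1 / N * nsq x) +
        (τ * η / 2) * (1 / N * nsq fun i => h (x i)) +
        ((τ / η) * (1 / N * nsq fun i => x i - h (x i)) + (1 / η ^ 3) * Z x ^ 4 +
          (η + η ^ 2 * τ))) ∂π := by
        refine lintegral_mono fun x => ?_
        rw [← ofReal_norm]
        exact ENNReal.ofReal_le_ofReal (hτe x)
    _ = ENNReal.ofReal (∫ x, ((τ * η / 2) * (1 / N * nsq x) +
        (τ * η / 2) * (1 / N * nsq fun i => h (x i)) +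
        ((τ / η) * (1 / N * nsq fun i => x i - h (x i)) + (1 / η ^ 3) * Z x ^ 4 +
          (η + η ^ 2 * τ))) ∂π) :=
        (ofReal_integral_eq_lintegral_ofReal jall (Eventually.of_forall fun x =>
          (norm_nonneg _).trans (hτe x))).symm
    _ ≤ ENNReal.ofReal ε := by
      refine ENNReal.ofReal_le_ofReal ?_
      have e1 : ∫ x : Fin N → ℂ, 1 / (N : ℝ) * nsq x ∂π = 1 := (integral_avg hsq hN1).trans h1
      have e2 : ∫ x : Fin N → ℂ, 1 / (N : ℝ) * (nsq fun i => h (x i)) ∂π = v :=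
        integral_avg ih2 hN1
      have e3 : ∫ x : Fin N → ℂ, 1 / (N : ℝ) * (nsq fun i => x i - h (x i)) ∂π ≤ η ^ 2 :=
        (integral_avg id2 hN1).trans_le hε1
      have hQ : 1 / η ^ 3 * ∫ x, Z x ^ 4 ∂π ≤ ε / 2 := by
        calc _ ≤ 1 / η ^ 3 * ((120 * (m ^ 4 * τ ^ 2)) ^ 2 * (1 / (N : ℝ) ^ 2)) := by gcongr
          _ = Q / (N : ℝ) ^ 2 := by simp only [Q]; ring
          _ ≤ ε / 2 := by
            rw [div_le_iff₀ hε] at hN3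
            rw [div_le_iff₀ (by positivity)]
            nlinarith [mul_le_mul_of_nonneg_left (le_self_pow₀ hN2 (n := 2) (by norm_num)) hε.le]
      rw [integral_add_three j1 j2 j5,
        integral_add_three j3 j4 (integrable_const _), integral_const_mul (τ * η / 2),
        integral_const_mul (τ * η / 2), integral_const_mul (τ / η), integral_const_mul (1 / η ^ 3),
        e1, e2, integral_const, probReal_univ, one_smul]
      have k1 : τ * η / 2 * v ≤ τ * η := by
        have : 0 ≤ τ * η := by positivity
        nlinarith
      have k2 : τ / η * ∫ x : Fin N → ℂ, 1 / (N : ℝ) * (nsq fun i => x i - h (x i)) ∂π ≤ τ * η := by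
        calc _ ≤ τ / η * η ^ 2 := by gcongr
          _ = _ := by field_simp
      have k3 : η ^ 2 * τ ≤ τ * η := by nlinarith [mul_nonneg hτ hη.le]
      have k4 : 0 ≤ τ * η := by positivity
      linarith

end BoundedForm

/-! ### The defect of the resolvent trace -/

section Block

variable {L N : ℕ}

/-- Extending `y` by zero outside block `m` realizes the action of the block as part of that of `R`.
-/
lemma nsq_block_mulVec_le (R : Matrix (Fin L × Fin N) (Fin L × Fin N) ℂ) (l m : Fin L)
    (y : Fin N → ℂ) :
    nsq (block R l m *ᵥ y) ≤ nsq (R *ᵥ fun p => if p.1 = m then y p.2 else 0) := by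
  have h : ∀ i, (block R l m *ᵥ y) i = (R *ᵥ fun p => if p.1 = m then y p.2 else 0) (l, i) :=
    fun i => by
      simp only [block, mulVec, dotProduct, of_apply, Fintype.sum_prod_type, mul_ite, mul_zero]
      rw [Finset.sum_eq_single m]
      · simp
      · intro b _ hb; simp [hb]
      · simp
  unfold nsq
  simp only [h]
  rw [Fintype.sum_prod_type]
  exact Finset.single_le_sum
    (f := fun l => ∑ i, ‖(R *ᵥ fun p => if p.1 = m then y p.2 else 0) (l, i)‖ ^ 2)
    (fun _ _ => Finset.sum_nonneg fun _ _ => sq_nonneg _) (Finset.mem_univ l)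

lemma nsq_ite_eq (m : Fin L) (y : Fin N → ℂ) :
    nsq (fun p : Fin L × Fin N => if p.1 = m then y p.2 else 0) = nsq y := by
  unfold nsq
  rw [Fintype.sum_prod_type, Finset.sum_eq_single m]
  · simp
  · intro b _ hb; simp [hb]
  · simp

lemma boundedForm_block_inv {D : Matrix (Fin L × Fin N) (Fin L × Fin N) ℂ} {τ : ℝ}
    (hD : D.IsHermitian) (hτ : 0 < τ) (h : ∀ v, τ * nsq v ≤ qf D v) (l m : Fin L) :
    BoundedForm (1 / τ) (block D⁻¹ l m) where
  op y := by
    refine (nsq_block_mulVec_le _ l m y).trans ?_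
    rw [← nsq_ite_eq m y]
    exact nsq_inv_mulVec_le hD hτ h _
  row i := by
    refine le_trans ?_ (sum_norm_sq_inv_row_le hD hτ h (l, i))
    rw [Fintype.sum_prod_type]
    exact Finset.single_le_sum (f := fun m => ∑ j, ‖D⁻¹ (l, i) (m, j)‖ ^ 2)
      (fun _ _ => Finset.sum_nonneg fun _ _ => sq_nonneg _) (Finset.mem_univ m)
  col j := by
    refine le_trans ?_ (sum_norm_sq_inv_col_le hD hτ h (m, j))
    rw [Fintype.sum_prod_type]
    exact Finset.single_le_sum (f := fun l => ∑ i, ‖D⁻¹ (l, i) (m, j)‖ ^ 2)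
      (fun _ _ => Finset.sum_nonneg fun _ _ => sq_nonneg _) (Finset.mem_univ l)

end Block

/-! ### Continuity in gains and signatures, used for measurability -/

section Continuity

variable {L N : ℕ} {κ : Type*} [Fintype κ]

lemma continuous_cov (σ : ℝ) : Continuous fun p : (κ → Fin L → ℂ) × (κ → Fin N → ℂ) =>
    cov σ p.1 p.2 := by
  unfold cov
  have h : ∀ k, Continuous fun p : (κ → Fin L → ℂ) × (κ → Fin N → ℂ) => bvec (p.1 k) (p.2 k) := by
    unfold bvec
    fun_prop
  have hs : Continuous fun p : (κ → Fin L → ℂ) × (κ → Fin N → ℂ) =>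
      ∑ k, vecMulVec (bvec (p.1 k) (p.2 k)) (star (bvec (p.1 k) (p.2 k))) :=
    continuous_finsetSum _ fun k _ => (h k).matrix_vecMulVec (h k).star
  exact (hs.const_smul ((1 / (N : ℝ) : ℝ) : ℂ)).add continuous_const

lemma continuous_cov_inv {σ : ℝ} (hσ : 0 < σ) :
    Continuous fun p : (κ → Fin L → ℂ) × (κ → Fin N → ℂ) => (cov σ p.1 p.2)⁻¹ := by
  simp only [inv_def, Ring.inverse_eq_inv']
  have h := continuous_cov (L := L) (N := N) (κ := κ) σ
  refine Continuous.smul (h.matrix_det.inv₀ fun p => ?_) h.matrix_adjugate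
  exact ((isUnit_iff_isUnit_det _).1 (cov_posDef hσ p.1 p.2).isUnit).ne_zero

lemma continuous_resTrace {σ : ℝ} (hσ : 0 < σ) :
    Continuous fun p : (κ → Fin L → ℂ) × (κ → Fin N → ℂ) => resTrace σ p.1 p.2 := by
  refine continuous_matrix fun l m => ?_
  simp only [resTrace, blockTrace, of_apply]
  refine continuous_const.mul (continuous_finsetSum _ fun i _ => ?_)
  exact (continuous_cov_inv hσ).matrix_elem _ _

lemma continuous_defect {σ : ℝ} (hσ : 0 < σ) (l m : Fin L) :
    Continuous fun p : (κ → Fin L → ℂ) × (κ → Fin N → ℂ) =>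
      defect σ N p.1 (resTrace σ p.1 p.2) l m := by
  have hT := continuous_resTrace (L := L) (N := N) (κ := κ) hσ
  simp only [defect, Matrix.sub_apply, Matrix.smul_apply, Matrix.sum_apply, rankOneTerm_apply,
    smul_eq_mul]
  refine (continuous_const.sub (continuous_const.mul (hT.matrix_elem _ _))).sub
    (continuous_const.mul (continuous_finsetSum _ fun k _ => ?_))
  have hk : Continuous fun p : (κ → Fin L → ℂ) × (κ → Fin N → ℂ) => p.1 k := by fun_prop
  have hv := hT.matrix_mulVec hk
  refine Continuous.div (((continuous_apply l).comp hv).mul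
    (Complex.continuous_conj.comp ((continuous_apply m).comp hk)))
    (continuous_const.add (hk.star.dotProduct hv)) fun p => ?_
  exact denom_ne_zero (resTrace_posSemidef hσ _ _) _

end Continuity

/-! ### Concentration and mean of the defect for fixed gains -/

section Concentration

variable {L N : ℕ} {κ : Type*} [Fintype κ] {σ : ℝ}

lemma norm_defect_le (hσ : 0 < σ) {a : κ → Fin L → ℂ} {M : ℝ} (hM : 0 ≤ M)
    (ha : ∀ k l, ‖a k l‖ ≤ M) (x : κ → Fin N → ℂ) (l m : Fin L) :
    ‖defect σ N a (resTrace σ a x) l m‖ ≤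
      1 + 1 + 1 / N * (Fintype.card κ * (L * (1 / σ ^ 2 * M) * M)) := by
  have hτ : 0 ≤ 1 / σ ^ 2 := by positivity
  simp only [defect, Matrix.sub_apply, Matrix.smul_apply, Matrix.sum_apply, smul_eq_mul]
  refine (norm_sub_le _ _).trans (add_le_add ((norm_sub_le _ _).trans (add_le_add ?_ ?_)) ?_)
  · rw [one_apply]; split_ifs <;> simp
  · rw [norm_mul, Complex.norm_real, Real.norm_of_nonneg (by positivity)]
    calc _ ≤ σ ^ 2 * (1 / σ ^ 2) := by gcongr; exact norm_resTrace_le hσ a x l m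
      _ = 1 := by field_simp
  · rw [norm_mul, Complex.norm_real, Real.norm_of_nonneg (by positivity)]
    gcongr
    refine (norm_sum_le_of_le _ fun k _ => norm_rankOneTerm_le (resTrace_posSemidef hσ a x) hτ hM
      (norm_resTrace_le hσ a x) (ha k) l m).trans_eq ?_
    simp

lemma norm_defect_sub_le {a : κ → Fin L → ℂ} {M τ δ : ℝ} (hM : 0 ≤ M)
    (ha : ∀ k l, ‖a k l‖ ≤ M) {A B : Matrix (Fin L) (Fin L) ℂ} (hA : A.PosSemidef)
    (hB : B.PosSemidef) (hτ : 0 ≤ τ) (hδ : 0 ≤ δ) (hBτ : ∀ l m, ‖B l m‖ ≤ τ)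
    (hAB : ∀ l m, ‖A l m - B l m‖ ≤ δ) (l m : Fin L) :
    ‖defect σ N a A l m - defect σ N a B l m‖ ≤
      (σ ^ 2 + Fintype.card κ / N * lipConst L τ M) * δ := by
  have e : defect σ N a A l m - defect σ N a B l m = -(((σ ^ 2 : ℝ) : ℂ) * (A l m - B l m)) -
      ((1 / (N : ℝ) : ℝ) : ℂ) * ∑ k, (rankOneTerm A (a k) l m - rankOneTerm B (a k) l m) := by
    simp only [defect, Matrix.sub_apply, Matrix.smul_apply, Matrix.sum_apply, smul_eq_mul,
      Finset.sum_sub_distrib]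
    ring
  rw [e]
  refine (norm_sub_le _ _).trans ?_
  rw [norm_neg, norm_mul, norm_mul, Complex.norm_real, Complex.norm_real,
    Real.norm_of_nonneg (by positivity), Real.norm_of_nonneg (by positivity), add_mul]
  refine add_le_add (by gcongr; exact hAB l m) ?_
  have := norm_sum_le_of_le Finset.univ fun k _ =>
    norm_rankOneTerm_sub_le hA hB hτ hM hδ hBτ (ha k) hAB l m
  rw [Finset.sum_const, Finset.card_univ, nsmul_eq_mul] at this
  calc _ ≤ 1 / (N : ℝ) * (Fintype.card κ * (lipConst L τ M * δ)) := by gcongr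
    _ = _ := by ring

lemma norm_resTrace_sub_update_signature_le [DecidableEq κ] (hσ : 0 < σ) (a : κ → Fin L → ℂ)
    (x : κ → Fin N → ℂ) (k : κ) (y : Fin N → ℂ) (l m : Fin L) :
    ‖resTrace σ a (Function.update x k y) l m - resTrace σ a x l m‖ ≤ 2 / (N * σ ^ 2) := by
  refine (norm_resTrace_sub_le hσ {k} (fun j hj => ?_) l m).trans_eq (by simp)
  rw [Function.update_of_ne (by simpa using hj)]

variable {μ : Measure ℂ} [IsProbabilityMeasure μ]

/-- The law of `K` independent signatures of length `N`. -/
def sigLaw (μ : Measure ℂ) (K N : ℕ) : Measure (Fin K → Fin N → ℂ) :=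
  Measure.pi fun _ => Measure.pi fun _ => μ

instance (K N : ℕ) : IsProbabilityMeasure (sigLaw μ K N) := by
  unfold sigLaw; infer_instance

/-- Conditioning on all signatures except the `k`-th. -/
lemma lintegral_sigLaw_le {K N : ℕ} {F : (Fin K → Fin N → ℂ) → ℝ≥0∞} (hF : Measurable F)
    (k : Fin K) {C : ℝ≥0∞}
    (h : ∀ x, ∫⁻ y, F (Function.update x k y) ∂(Measure.pi fun _ => μ) ≤ C) :
    ∫⁻ x, F x ∂(sigLaw μ K N) ≤ C := by
  have := lintegral_le_of_lmarginal_le (μ := fun _ : Fin K => Measure.pi fun _ : Fin N => μ)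
    {k} (f := F) (g := fun _ => C) hF measurable_const fun x => by
      rw [lmarginal_singleton, lmarginal_singleton]
      simpa using h x
  simpa [sigLaw] using this

/-- One signature moves the traces by `2 / (N σ²)` and, by the Lipschitz bound, the defect by
`O(1/N)`. With `K = O(N)` coordinates, `fourth_moment_bddDiff` gives order `N⁻²`. -/
lemma fourth_moment_defect {K : ℕ} (hσ : 0 < σ) {a : Fin K → Fin L → ℂ} {M : ℝ} (hM : 0 ≤ M)
    (ha : ∀ k l, ‖a k l‖ ≤ M) {c' : ℝ} (hK : (K : ℝ) ≤ c' * N) (l m : Fin L) :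
    ∫⁻ x, ENNReal.ofReal (‖defect σ N a (resTrace σ a x) l m -
        ∫ z, defect σ N a (resTrace σ a z) l m ∂(sigLaw μ K N)‖ ^ 4) ∂(sigLaw μ K N) ≤
      ENNReal.ofReal ((4 * c' * ((σ ^ 2 + c' * lipConst L (1 / σ ^ 2) M) * (2 / σ ^ 2)) ^ 2) ^ 2 *
        (1 / (N : ℝ) ^ 2)) := by
  have hτ : 0 ≤ 1 / σ ^ 2 := by positivity
  have hl := lipConst_nonneg L hτ hM
  set f : (Fin K → Fin N → ℂ) → ℂ := fun x => defect σ N a (resTrace σ a x) l m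
  have hfm : Measurable f :=
    ((continuous_defect (L := L) (N := N) (κ := Fin K) hσ l m).comp
      (continuous_const.prodMk continuous_id)).measurable
  have hfC := fun x => norm_defect_le (N := N) hσ hM ha x l m
  set δ := (σ ^ 2 + (K : ℝ) / N * lipConst L (1 / σ ^ 2) M) * (2 / (N * σ ^ 2))
  have hδ0 : 0 ≤ δ := by positivity
  have hδ : ∀ x k y, ‖f (Function.update x k y) - f x‖ ≤ δ := fun x k y => by
    have := norm_defect_sub_le (σ := σ) (N := N) hM ha
      (resTrace_posSemidef hσ a (Function.update x k y)) (resTrace_posSemidef hσ a x) hτ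
      (by positivity : 0 ≤ 2 / (N * σ ^ 2)) (norm_resTrace_le hσ a x)
      (norm_resTrace_sub_update_signature_le hσ a x k y) l m
    rwa [Fintype.card_fin] at this
  have key := fourth_moment_bddDiff (ρ := Measure.pi fun _ : Fin N => μ) K hfm hfC hδ0 hδ
  change ∫ x, ‖f x - ∫ z, f z ∂(sigLaw μ K N)‖ ^ 4 ∂(sigLaw μ K N) ≤ _ at key
  have hI : ‖∫ z, f z ∂(sigLaw μ K N)‖ ≤ _ :=
    (norm_integral_le_of_norm_le_const (Eventually.of_forall hfC)).trans_eq
      (by rw [probReal_univ, mul_one])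
  rw [← ofReal_integral_eq_lintegral_ofReal (integrable_of_bdd
    ((hfm.sub_const _).norm.pow_const 4) fun x => by
      rw [norm_pow, norm_norm]
      exact pow_le_pow_left₀ (norm_nonneg _)
        ((norm_sub_le _ _).trans (add_le_add (hfC x) hI)) 4)
    (Eventually.of_forall fun x => by positivity)]
  refine ENNReal.ofReal_le_ofReal (key.trans ?_)
  rcases Nat.eq_zero_or_pos N with h0 | hN
  · have : δ = 0 := by simp [δ, h0]
    rw [this]
    simp [h0]
  · have hN' : (0 : ℝ) < N := by exact_mod_cast hN
    have hc' : 0 ≤ c' := by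
      have : (0 : ℝ) ≤ c' * N := (Nat.cast_nonneg K).trans hK
      exact nonneg_of_mul_nonneg_left this hN'
    have h1 : (K : ℝ) / N ≤ c' := by rwa [div_le_iff₀ hN']
    have h2 : δ ≤ (σ ^ 2 + c' * lipConst L (1 / σ ^ 2) M) * (2 / σ ^ 2) * (1 / N) := by
      calc δ ≤ (σ ^ 2 + c' * lipConst L (1 / σ ^ 2) M) * (2 / (N * σ ^ 2)) := by
            simp only [δ]; gcongr
        _ = _ := by ring
    set G := (σ ^ 2 + c' * lipConst L (1 / σ ^ 2) M) * (2 / σ ^ 2)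
    calc (4 * (K : ℝ) * δ ^ 2) ^ 2 ≤ (4 * (c' * N) * (G * (1 / N)) ^ 2) ^ 2 := by gcongr
      _ = _ := by field_simp

/-- Inserting the exact identity for `1` into the defect leaves only the differences between user
forms and traces. -/
lemma norm_defect_le_sum [DecidableEq κ] (hσ : 0 < σ) (hN : N ≠ 0) {a : κ → Fin L → ℂ} {M : ℝ}
    (hM : 0 ≤ M) (ha : ∀ k l, ‖a k l‖ ≤ M) (x : κ → Fin N → ℂ) (l m : Fin L) :
    ‖defect σ N a (resTrace σ a x) l m‖ ≤ ∑ k, 1 / N * lipConst L (1 / σ ^ 2) M *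
      ∑ l, ∑ m, ‖userForm σ a x k l m - resTrace σ a x l m‖ := by
  have h := one_eq_resTrace_add hσ hN a x
  have e : defect σ N a (resTrace σ a x) l m = ((1 / (N : ℝ) : ℝ) : ℂ) *
      ∑ k, (rankOneTerm (userForm σ a x k) (a k) l m - rankOneTerm (resTrace σ a x) (a k) l m) := by
    rw [defect, h]
    simp only [Matrix.sub_apply, Matrix.add_apply, Matrix.smul_apply, Matrix.sum_apply,
      smul_eq_mul, Finset.sum_sub_distrib]
    ring
  rw [e, norm_mul, Complex.norm_real, Real.norm_of_nonneg (by positivity)]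
  simp only [mul_assoc]
  rw [← Finset.mul_sum]
  gcongr
  refine norm_sum_le_of_le _ fun k _ => ?_
  set f : Fin L → Fin L → ℝ := fun l m => ‖userForm σ a x k l m - resTrace σ a x l m‖
  have hf : ∀ l m, 0 ≤ f l m := fun _ _ => norm_nonneg _
  exact norm_rankOneTerm_sub_le (userForm_posSemidef hσ a x k) (resTrace_posSemidef hσ a x)
    (by positivity) hM (Finset.sum_nonneg fun l _ => Finset.sum_nonneg fun m _ => hf l m)
    (norm_resTrace_le hσ a x) (ha k) (fun l m =>
      (Finset.single_le_sum (f := f l) (fun m _ => hf l m) (Finset.mem_univ m)).trans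
      (Finset.single_le_sum (f := fun l => ∑ m, f l m)
        (fun l _ => Finset.sum_nonneg fun m _ => hf l m) (Finset.mem_univ l))) l m

lemma userForm_apply [DecidableEq κ] (a : κ → Fin L → ℂ) (x : κ → Fin N → ℂ) (k : κ)
    (l m : Fin L) : userForm σ a x k l m = ((1 / (N : ℝ) : ℝ) : ℂ) *
      (star (x k) ⬝ᵥ block (cov σ (Function.update a k 0) x)⁻¹ l m *ᵥ x k) := rfl

lemma resTrace_apply (a : κ → Fin L → ℂ) (x : κ → Fin N → ℂ) (l m : Fin L) :
    resTrace σ a x l m = ((1 / (N : ℝ) : ℝ) : ℂ) * ∑ i, block (cov σ a x)⁻¹ l m i i := rfl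

lemma measurable_userForm {K : ℕ} (hσ : 0 < σ) (a : Fin K → Fin L → ℂ) (k : Fin K) (l m : Fin L) :
    Measurable fun x : Fin K → Fin N → ℂ => userForm σ a x k l m := by
  have hg : Continuous fun x : Fin K → Fin N → ℂ => (Function.update a k 0, x) :=
    continuous_const.prodMk continuous_id
  have h : Continuous fun x : Fin K → Fin N → ℂ => (cov σ (Function.update a k 0) x)⁻¹ := by
    have := (continuous_cov_inv (L := L) (N := N) (κ := Fin K) hσ).comp hg
    simpa only [Function.comp_def] using this
  have hk : Continuous fun x : Fin K → Fin N → ℂ => x k := continuous_apply k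
  have hb : Continuous fun x : Fin K → Fin N → ℂ =>
      block (cov σ (Function.update a k 0) x)⁻¹ l m := continuous_matrix fun i j => by
    simp only [block, of_apply]
    exact h.matrix_elem (l, i) (m, j)
  simp only [userForm_apply]
  exact (continuous_const.mul (hk.star.dotProduct (hb.matrix_mulVec hk))).measurable

/-- Two errors: the form against the trace of the resolvent without user `k`, where only `x k` is
integrated, and the rank one cost of putting user `k` back. -/
lemma lintegral_userForm_sub_le {K : ℕ} (hσ : 0 < σ) {ε : ℝ}
    (hε : ∀ B : Matrix (Fin N) (Fin N) ℂ, BoundedForm (1 / σ ^ 2) B →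
      ∫⁻ x, ‖((1 / (N : ℝ) : ℝ) : ℂ) * (star x ⬝ᵥ B *ᵥ x) -
        ((1 / (N : ℝ) : ℝ) : ℂ) * ∑ i, B i i‖ₑ ∂(Measure.pi fun _ => μ) ≤ ENNReal.ofReal ε)
    (a : Fin K → Fin L → ℂ) (k : Fin K) (l m : Fin L) :
    ∫⁻ x, ‖userForm σ a x k l m - resTrace σ a x l m‖ₑ ∂(sigLaw μ K N) ≤
      ENNReal.ofReal ε + ENNReal.ofReal (1 / (N * σ ^ 2)) := by
  have hm1 := measurable_userForm (N := N) hσ a k l m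
  have hm2 : Measurable fun x : Fin K → Fin N → ℂ => resTrace σ (Function.update a k 0) x l m :=
    (((continuous_resTrace (L := L) (N := N) (κ := Fin K) hσ).comp
      (continuous_const.prodMk continuous_id)).matrix_elem l m).measurable
  have hm3 : Measurable fun x : Fin K → Fin N → ℂ =>
      ‖userForm σ a x k l m - resTrace σ (Function.update a k 0) x l m‖ₑ := (hm1.sub hm2).enorm
  calc _ ≤ ∫⁻ x, (‖userForm σ a x k l m - resTrace σ (Function.update a k 0) x l m‖ₑ +
        ENNReal.ofReal (1 / (N * σ ^ 2))) ∂(sigLaw μ K N) := by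
        refine lintegral_mono fun x => ?_
        have h := norm_resTrace_sub_update_le hσ a x k l m
        rw [← sub_add_sub_cancel _ (resTrace σ (Function.update a k 0) x l m)]
        refine (enorm_add_le _ _).trans ?_
        gcongr
        rw [← ofReal_norm]
        exact ENNReal.ofReal_le_ofReal h
    _ = ∫⁻ x, ‖userForm σ a x k l m - resTrace σ (Function.update a k 0) x l m‖ₑ
          ∂(sigLaw μ K N) + ENNReal.ofReal (1 / (N * σ ^ 2)) := by
        rw [lintegral_add_right _ measurable_const, lintegral_const, measure_univ, mul_one]
    _ ≤ _ := by
        gcongr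
        refine lintegral_sigLaw_le (F := fun x =>
          ‖userForm σ a x k l m - resTrace σ (Function.update a k 0) x l m‖ₑ) hm3 k fun x => ?_
        simp only [userForm_apply, resTrace_apply, cov_update_zero, Function.update_self]
        exact hε _ (boundedForm_block_inv (cov_isHermitian σ _ x) (by positivity)
          (cov_coercive σ _ x) l m)

/-- The expected defect tends to zero, uniformly in bounded gain vectors. -/
theorem norm_integral_defect_le (h0 : ∫ x, x ∂μ = 0) (h1 : ∫ x, ‖x‖ ^ 2 ∂μ = 1) (hσ : 0 < σ)
    {M c' : ℝ} (hM : 0 ≤ M) (hc' : 0 ≤ c') {ε : ℝ} (hε : 0 < ε) :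
    ∃ N₀ : ℕ, ∀ N ≥ N₀, ∀ K : ℕ, (K : ℝ) ≤ c' * N → ∀ a : Fin K → Fin L → ℂ,
      (∀ k l, ‖a k l‖ ≤ M) → ∀ l m,
        ‖∫ x, defect σ N a (resTrace σ a x) l m ∂(sigLaw μ K N)‖ ≤ ε := by
  have hτ : 0 ≤ 1 / σ ^ 2 := by positivity
  set Λ := lipConst L (1 / σ ^ 2) M
  have hΛ : 0 ≤ Λ := lipConst_nonneg L hτ hM
  set G := c' * Λ * ((L : ℝ) * L)
  have hG : 0 ≤ G := by positivity
  -- Each of the two errors costs `ε'`, and summing over users and entries multiplies by at most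
  -- `G`; the `+ 1` avoids division by zero.
  set ε' := ε / (2 * (G + 1))
  have hε' : 0 < ε' := by positivity
  obtain ⟨N₁, hN₁⟩ := lintegral_form_sub_trace_le h0 h1 hτ hε'
  obtain ⟨N₂, hN₂⟩ := exists_nat_ge (1 / (ε' * σ ^ 2))
  refine ⟨max N₁ (N₂ + 1), fun N hN K hK a ha l m => ?_⟩
  have hN0 : N ≠ 0 := by have := le_of_max_le_right hN; omega
  have hN' : (0 : ℝ) < N := by exact_mod_cast Nat.pos_of_ne_zero hN0
  have hN3 : 1 / (N * σ ^ 2) ≤ ε' := by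
    have h2 : (N₂ : ℝ) ≤ N := by
      have := le_of_max_le_right hN
      exact_mod_cast (by omega : N₂ ≤ N)
    have h3 := hN₂.trans h2
    rw [div_le_iff₀ (by positivity)] at h3 ⊢
    linarith
  have hb := fun k l m => lintegral_userForm_sub_le (μ := μ) hσ (hN₁ N (le_of_max_le_left hN)) a k
    (l : Fin L) m
  have hm1 := fun k l m => measurable_userForm (N := N) hσ a k l m
  have hm2 : ∀ l m, Measurable fun x : Fin K → Fin N → ℂ => resTrace σ a x l m := fun l m =>
    (((continuous_resTrace (L := L) (N := N) (κ := Fin K) hσ).comp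
      (continuous_const.prodMk continuous_id)).matrix_elem l m).measurable
  have key : ‖∫ x, defect σ N a (resTrace σ a x) l m ∂(sigLaw μ K N)‖ₑ ≤ ENNReal.ofReal ε := by
    calc _ ≤ ∫⁻ x, ‖defect σ N a (resTrace σ a x) l m‖ₑ ∂(sigLaw μ K N) :=
          enorm_integral_le_lintegral_enorm _
      _ ≤ ∫⁻ x, ∑ k, ENNReal.ofReal (1 / N * Λ) *
            ∑ l, ∑ m, ‖userForm σ a x k l m - resTrace σ a x l m‖ₑ ∂(sigLaw μ K N) := by
          refine lintegral_mono fun x => ?_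
          rw [← ofReal_norm]
          refine (ENNReal.ofReal_le_ofReal (norm_defect_le_sum hσ hN0 hM ha x l m)).trans_eq ?_
          rw [ENNReal.ofReal_sum_of_nonneg fun k _ => by positivity]
          refine Finset.sum_congr rfl fun k _ => ?_
          rw [ENNReal.ofReal_mul (by positivity), ENNReal.ofReal_sum_of_nonneg fun k _ => by
            positivity]
          congr 1
          refine Finset.sum_congr rfl fun l _ => ?_
          rw [ENNReal.ofReal_sum_of_nonneg fun k _ => by positivity]
          exact Finset.sum_congr rfl fun m _ => ofReal_norm _
      _ = ∑ k, ENNReal.ofReal (1 / N * Λ) *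
            ∑ l, ∑ m, ∫⁻ x, ‖userForm σ a x k l m - resTrace σ a x l m‖ₑ ∂(sigLaw μ K N) := by
          have hmm : ∀ k l m, Measurable fun x : Fin K → Fin N → ℂ =>
              ‖userForm σ a x k l m - resTrace σ a x l m‖ₑ :=
            fun k l m => ((hm1 k l m).sub (hm2 l m)).enorm
          rw [lintegral_finsetSum _ fun k _ => (Finset.measurable_sum _ fun l _ =>
            Finset.measurable_sum _ fun m _ => hmm k l m).const_mul _]
          refine Finset.sum_congr rfl fun k _ => ?_
          rw [lintegral_const_mul _ (Finset.measurable_sum _ fun l _ =>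
            Finset.measurable_sum _ fun m _ => hmm k l m), lintegral_finsetSum _ fun l _ =>
            Finset.measurable_sum _ fun m _ => hmm k l m]
          congr 1
          refine Finset.sum_congr rfl fun l _ => ?_
          rw [lintegral_finsetSum _ fun m _ => hmm k l m]
      _ ≤ ∑ _k : Fin K, ENNReal.ofReal (1 / N * Λ) * ∑ _l : Fin L, ∑ _m : Fin L,
            ENNReal.ofReal (ε' + ε') := by
          gcongr with k _ l _ m _
          refine (hb k l m).trans ?_
          rw [ENNReal.ofReal_add hε'.le hε'.le]
          gcongr
      _ = ENNReal.ofReal (K * (1 / N * Λ * (L * (L * (ε' + ε'))))) := by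
          simp only [Finset.sum_const, Finset.card_univ, Fintype.card_fin, nsmul_eq_mul]
          rw [ENNReal.ofReal_mul (p := (K : ℝ)) (by positivity),
            ENNReal.ofReal_mul (p := 1 / (N : ℝ) * Λ) (by positivity),
            ENNReal.ofReal_mul (p := (L : ℝ)) (by positivity),
            ENNReal.ofReal_mul (p := (L : ℝ)) (by positivity), ENNReal.ofReal_natCast,
            ENNReal.ofReal_natCast]
      _ ≤ ENNReal.ofReal ε := by
          refine ENNReal.ofReal_le_ofReal ?_
          calc (K : ℝ) * (1 / N * Λ * (L * (L * (ε' + ε')))) ≤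
              c' * N * (1 / N * Λ * (L * (L * (ε' + ε')))) := by gcongr
            _ = G * (2 * ε') := by simp only [G]; field_simp; ring
            _ ≤ (G + 1) * (2 * ε') := by gcongr; linarith
            _ = ε := by simp only [ε']; field_simp
  rw [← ofReal_norm] at key
  exact (ENNReal.ofReal_le_ofReal_iff hε.le).1 key

end Concentration

/-! ### Almost sure convergence -/

section General

variable {Ω : Type*} [MeasurableSpace Ω] {P : Measure Ω}

/-- Restrict the array along the injective reindexing `(k, i) ↦ (i, k)`, then curry the product
measure. -/
lemma map_signatures_eq_sigLaw [IsProbabilityMeasure P] {s : ℕ → ℕ → Ω → ℂ}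
    (hs_meas : ∀ i j, Measurable (s i j)) (hs_indep : iIndepFun (fun p : ℕ × ℕ => s p.1 p.2) P)
    (hs_ident : ∀ i j, IdentDistrib (s i j) (s 0 0) P P) (K N : ℕ) :
    P.map (fun ω (k : Fin K) (i : Fin N) => s i k ω) = sigLaw (P.map (s 0 0)) K N := by
  have : IsProbabilityMeasure (P.map (s 0 0)) :=
    Measure.isProbabilityMeasure_map (hs_meas 0 0).aemeasurable
  have hinj : Function.Injective fun p : Fin K × Fin N => ((p.2 : ℕ), (p.1 : ℕ)) := by
    rintro ⟨k, i⟩ ⟨k', i'⟩ h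
    simp only [Prod.mk.injEq] at h
    exact Prod.ext (Fin.ext h.2) (Fin.ext h.1)
  have h1 := (iIndepFun_iff_map_fun_eq_pi_map fun p => (hs_meas _ _).aemeasurable).1
    (hs_indep.precomp hinj)
  simp only [(hs_ident _ _).map_eq] at h1
  rw [← Measure.infinitePi_eq_pi] at h1
  have h2 := congrArg (Measure.map (MeasurableEquiv.curry (Fin K) (Fin N) ℂ)) h1
  rw [Measure.infinitePi_map_curry (fun _ _ => P.map (s 0 0)), Measure.map_map
    (MeasurableEquiv.measurable _) (by fun_prop)] at h2
  rw [sigLaw, ← Measure.infinitePi_eq_pi]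
  simp only [← Measure.infinitePi_eq_pi]
  exact h2

/-- Independence freezes `X`, here the gains, so bounds uniform in deterministic gains carry over to
random ones. -/
lemma lintegral_indepFun_le [IsProbabilityMeasure P] {A B : Type*} [MeasurableSpace A]
    [MeasurableSpace B] {X : Ω → A} {Y : Ω → B} (hX : Measurable X) (hY : Measurable Y)
    (h : IndepFun X Y P) {F : A × B → ℝ≥0∞} (hF : Measurable F) {C : ℝ≥0∞}
    (hC : ∀ a, ∫⁻ b, F (a, b) ∂(P.map Y) ≤ C) : ∫⁻ ω, F (X ω, Y ω) ∂P ≤ C := by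
  have : IsProbabilityMeasure (P.map X) := Measure.isProbabilityMeasure_map hX.aemeasurable
  have : IsProbabilityMeasure (P.map Y) := Measure.isProbabilityMeasure_map hY.aemeasurable
  have h1 := (indepFun_iff_map_prod_eq_prod_map_map hX.aemeasurable hY.aemeasurable).1 h
  rw [← lintegral_map hF (hX.prodMk hY), h1, lintegral_prod _ hF.aemeasurable]
  refine (lintegral_mono hC).trans_eq ?_
  rw [lintegral_const, measure_univ, mul_one]

/-- The expectations are summable, so the series converges almost surely and its terms vanish. The
shift by `N₀` is there because the bound only holds eventually. -/
lemma ae_tendsto_zero_of_lintegral_le {Z : ℕ → Ω → ℝ≥0∞} {C : ℝ}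
    (h : ∀ᶠ N : ℕ in atTop, Measurable (Z N) ∧
      ∫⁻ ω, Z N ω ∂P ≤ ENNReal.ofReal (C * (1 / (N : ℝ) ^ 2))) :
    ∀ᵐ ω ∂P, Tendsto (fun N : ℕ => Z N ω) atTop (𝓝 0) := by
  obtain ⟨N₀, hN₀⟩ := eventually_atTop.1 h
  have hm : ∀ N, Measurable (Z (N + N₀)) := fun N : ℕ => (hN₀ _ (Nat.le_add_left _ _)).1
  have hC : ∀ N : ℕ, ∫⁻ ω, Z (N + N₀) ω ∂P ≤
      ENNReal.ofReal (|C| * (1 / ((N + N₀ : ℕ) : ℝ) ^ 2)) := fun N : ℕ =>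
    (hN₀ _ (Nat.le_add_left _ _)).2.trans
      (ENNReal.ofReal_le_ofReal (by gcongr; exact le_abs_self C))
  have hsum : Summable fun N : ℕ => |C| * (1 / ((N + N₀ : ℕ) : ℝ) ^ 2) :=
    ((summable_nat_add_iff N₀).2 (Real.summable_one_div_nat_pow.2 one_lt_two)).mul_left _
  have hfin : ∫⁻ ω, ∑' N, Z (N + N₀) ω ∂P ≠ ∞ := by
    rw [lintegral_tsum fun N : ℕ => (hm N).aemeasurable]
    refine ne_top_of_le_ne_top ?_ (ENNReal.tsum_le_tsum hC)
    rw [← ENNReal.ofReal_tsum_of_nonneg (fun N : ℕ => by positivity) hsum]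
    exact ENNReal.ofReal_ne_top
  filter_upwards [ae_lt_top (Measurable.tsum hm) hfin] with ω hω
  rw [← tendsto_add_atTop_iff_nat N₀]
  exact ENNReal.tendsto_atTop_zero_of_tsum_ne_top hω.ne

lemma tendsto_norm_of_tendsto_ofReal_pow {z : ℕ → ℂ}
    (h : Tendsto (fun N : ℕ => ENNReal.ofReal (‖z N‖ ^ 4)) atTop (𝓝 0)) :
    Tendsto (fun N : ℕ => ‖z N‖) atTop (𝓝 0) := by
  have h1 := (ENNReal.tendsto_toReal ENNReal.zero_ne_top).comp h
  have h2 : Tendsto (fun N : ℕ => ‖z N‖ ^ 4) atTop (𝓝 0) := by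
    refine h1.congr fun N : ℕ => ?_
    simp only [Function.comp]
    rw [ENNReal.toReal_ofReal (by positivity)]
  have h3 := h2.sqrt.sqrt
  simp only [Real.sqrt_zero] at h3
  refine h3.congr fun N : ℕ => ?_
  rw [show ‖z N‖ ^ 4 = (‖z N‖ ^ 2) ^ 2 by ring, Real.sqrt_sq (by positivity),
    Real.sqrt_sq (norm_nonneg _)]

lemma ae_tendsto_avg [IsProbabilityMeasure P] {y : ℕ → Ω → ℂ} (hy : ∀ i, Measurable (y i))
    (hindep : iIndepFun y P) (hident : ∀ i, IdentDistrib (y i) (y 0) P P) {f : ℂ → ℝ}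
    (hf : Measurable f) (hfi : Integrable f (P.map (y 0))) :
    ∀ᵐ ω ∂P, Tendsto (fun N : ℕ => 1 / (N : ℝ) * ∑ i : Fin N, f (y i ω)) atTop
      (𝓝 (∫ x, f x ∂(P.map (y 0)))) := by
  have h := strong_law_ae_real (μ := P) (fun i ω => f (y i ω)) (hfi.comp_measurable (hy 0))
    (fun i j hij => (hindep.indepFun hij).comp hf hf) (fun i => (hident i).comp hf)
  filter_upwards [h] with ω hω
  rw [integral_map (hy 0).aemeasurable hf.aestronglyMeasurable]
  refine hω.congr fun N : ℕ => ?_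
  rw [Finset.sum_range, div_eq_inv_mul, one_div]

end General

/-! ### Almost sure limits with random gains -/

section AlmostSure

variable {Ω : Type*} [MeasurableSpace Ω] {P : Measure Ω} [IsProbabilityMeasure P]
  {L : ℕ} {K : ℕ → ℕ} {c σ : ℝ} {μ : Measure ℂ} [IsProbabilityMeasure μ]
  {a : ∀ N, Ω → Fin (K N) → Fin L → ℂ} {x : ∀ N, Ω → Fin (K N) → Fin N → ℂ}

lemma eventually_le_mul_of_ratio (hK : Tendsto (fun N : ℕ => (K N : ℝ) / (N : ℝ)) atTop (𝓝 c)) :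
    ∀ᶠ N : ℕ in atTop, (K N : ℝ) ≤ (c + 1) * N := by
  filter_upwards [hK.eventually (ge_mem_nhds (lt_add_one c)), eventually_gt_atTop 0] with N hN h0
  rwa [div_le_iff₀ (by exact_mod_cast h0)] at hN

lemma eventually_pos_of_ratio (hc : 0 < c)
    (hK : Tendsto (fun N : ℕ => (K N : ℝ) / (N : ℝ)) atTop (𝓝 c)) :
    ∀ᶠ N : ℕ in atTop, 0 < K N := by
  filter_upwards [hK.eventually (lt_mem_nhds hc)] with N hN
  rcases Nat.eq_zero_or_pos (K N) with h | h
  · simp [h] at hN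
  · exact h

/-- Split the defect into its mean over the signatures, with the gains frozen, and the fluctuation
around it. -/
theorem ae_tendsto_defect (h0 : ∫ z, z ∂μ = 0) (h1 : ∫ z, ‖z‖ ^ 2 ∂μ = 1) (hc : 0 ≤ c)
    (hσ : 0 < σ) (hK : Tendsto (fun N : ℕ => (K N : ℝ) / (N : ℝ)) atTop (𝓝 c))
    (ha : ∀ N, Measurable (a N)) (hx : ∀ N, Measurable (x N))
    (hind : ∀ N, IndepFun (a N) (x N) P) (hlaw : ∀ N, P.map (x N) = sigLaw μ (K N) N)
    (M : ℕ) (l m : Fin L) :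
    ∀ᵐ ω ∂P, Tendsto (fun N : ℕ => defect σ N (fun k => cutoff M (a N ω k))
      (resTrace σ (fun k => cutoff M (a N ω k)) (x N ω)) l m) atTop (𝓝 0) := by
  have hM : (0 : ℝ) ≤ (M : ℝ) + 2 := by positivity
  set f : ∀ N, (Fin (K N) → Fin L → ℂ) × (Fin (K N) → Fin N → ℂ) → ℂ := fun N p =>
    defect σ N (fun k => cutoff M (p.1 k)) (resTrace σ (fun k => cutoff M (p.1 k)) p.2) l m
  have hf : ∀ N, Measurable (f N) := fun N : ℕ => by
    have hg : Continuous fun p : (Fin (K N) → Fin L → ℂ) × (Fin (K N) → Fin N → ℂ) =>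
        ((fun k => cutoff M (p.1 k)), p.2) := by
      refine Continuous.prodMk (continuous_pi fun k => ?_) continuous_snd
      exact (continuous_cutoff M).comp ((continuous_apply k).comp continuous_fst)
    exact ((continuous_defect (L := L) (N := N) (κ := Fin (K N)) hσ l m).comp hg).measurable
  set mean : ∀ N, (Fin (K N) → Fin L → ℂ) → ℂ := fun N b => ∫ z, f N (b, z) ∂(sigLaw μ (K N) N)
  have hmean : ∀ N, Measurable (mean N) := fun N : ℕ =>
    ((hf N).stronglyMeasurable.integral_prod_right (ν := sigLaw μ (K N) N)).measurable
  have hb : ∀ N (b : Fin (K N) → Fin L → ℂ) k l, ‖(fun k => cutoff M (b k)) k l‖ ≤ (M : ℝ) + 2 :=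
    fun N b k l => norm_cutoff_apply_le M (b k) l
  have hconc : ∀ᵐ ω ∂P, Tendsto (fun N : ℕ => ENNReal.ofReal
      (‖f N (a N ω, x N ω) - mean N (a N ω)‖ ^ 4)) atTop (𝓝 0) := by
    refine ae_tendsto_zero_of_lintegral_le ?_
      (C := (4 * (c + 1) * ((σ ^ 2 + (c + 1) * lipConst L (1 / σ ^ 2) (M + 2)) *
        (2 / σ ^ 2)) ^ 2) ^ 2)
    filter_upwards [eventually_le_mul_of_ratio hK] with N hN
    have hF : Measurable fun p : (Fin (K N) → Fin L → ℂ) × (Fin (K N) → Fin N → ℂ) =>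
        ENNReal.ofReal (‖f N p - mean N p.1‖ ^ 4) :=
      ((((hf N).sub ((hmean N).comp measurable_fst)).norm).pow_const 4).ennreal_ofReal
    refine ⟨hF.comp ((ha N).prodMk (hx N)), ?_⟩
    refine lintegral_indepFun_le (ha N) (hx N) (hind N) hF fun b => ?_
    rw [hlaw N]
    exact fourth_moment_defect hσ hM (hb N b) hN l m
  -- No exceptional set: the bound on the mean is uniform over the cut off gain arrays.
  have hm0 : ∀ ω, Tendsto (fun N : ℕ => mean N (a N ω)) atTop (𝓝 0) := fun ω => by
    rw [Metric.tendsto_atTop]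
    intro ε hε
    obtain ⟨N₀, hN₀⟩ := norm_integral_defect_le (L := L) h0 h1 hσ hM
      (by linarith : 0 ≤ c + 1) (half_pos hε)
    obtain ⟨N₁, hN₁⟩ := eventually_atTop.1 (eventually_le_mul_of_ratio hK)
    refine ⟨max N₀ N₁, fun N hN => ?_⟩
    rw [dist_zero_right]
    exact (hN₀ N (le_of_max_le_left hN) (K N) (hN₁ N (le_of_max_le_right hN)) _
      (hb N (a N ω)) l m).trans_lt (half_lt_self hε)
  filter_upwards [hconc] with ω hω
  have h2 := tendsto_zero_iff_norm_tendsto_zero.2 (tendsto_norm_of_tendsto_ofReal_pow hω)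
  have h3 := h2.add (hm0 ω)
  simp only [sub_add_cancel, add_zero] at h3
  exact h3

/-- The gain vectors with the one of user `0` replaced by zero. -/
def dropFirst {n : ℕ} (b : Fin n → Fin L → ℂ) : Fin n → Fin L → ℂ :=
  fun k => if (k : ℕ) = 0 then 0 else b k

lemma cov_dropFirst_update {n N : ℕ} (hn : 0 < n) (b : Fin n → Fin L → ℂ)
    (z : Fin n → Fin N → ℂ) (w : Fin N → ℂ) :
    cov σ (dropFirst b) (Function.update z ⟨0, hn⟩ w) = cov σ (dropFirst b) z := by
  refine cov_congr fun k => ?_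
  by_cases hk : (k : ℕ) = 0
  · simp [dropFirst, hk, bvec_zero]
  · rw [Function.update_of_ne fun h => hk (by rw [h])]

/-- The resolvent without the first user does not involve its signature. Integrating that signature
alone gives a fourth moment of order `N⁻²`. -/
lemma ae_tendsto_centredForm {y : ℕ → Ω → ℂ} (hc : 0 < c) (hσ : 0 < σ)
    (hK : Tendsto (fun N : ℕ => (K N : ℝ) / (N : ℝ)) atTop (𝓝 c))
    (ha : ∀ N, Measurable (a N)) (hx : ∀ N, Measurable (x N))
    (hind : ∀ N, IndepFun (a N) (x N) P) (hlaw : ∀ N, P.map (x N) = sigLaw μ (K N) N)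
    (hxy : ∀ N ω (k : Fin (K N)), (k : ℕ) = 0 → x N ω k = fun i : Fin N => y i ω)
    {h : ℂ → ℂ} {b : ℝ} (hb : 0 ≤ b) (hh : Measurable h) (hhb : ∀ z, ‖h z‖ ≤ b)
    (hh0 : ∫ z, h z ∂μ = 0) (l m : Fin L) :
    ∀ᵐ ω ∂P, Tendsto (fun N : ℕ => ‖((1 / (N : ℝ) : ℝ) : ℂ) * centredForm h (∫ z, ‖h z‖ ^ 2 ∂μ)
      (block (cov σ (dropFirst (a N ω)) (x N ω))⁻¹ l m) (fun i : Fin N => y i ω)‖) atTop (𝓝 0) := by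
  set v := ∫ z, ‖h z‖ ^ 2 ∂μ
  have key : ∀ᵐ ω ∂P, Tendsto (fun N : ℕ => ENNReal.ofReal (‖((1 / (N : ℝ) : ℝ) : ℂ) *
      centredForm h v (block (cov σ (dropFirst (a N ω)) (x N ω))⁻¹ l m)
        (fun i : Fin N => y i ω)‖ ^ 4)) atTop (𝓝 0) := by
    refine ae_tendsto_zero_of_lintegral_le (C := (120 * (b ^ 4 * (1 / σ ^ 2) ^ 2)) ^ 2) ?_
    filter_upwards [eventually_pos_of_ratio hc hK] with N hN
    set F : (Fin (K N) → Fin L → ℂ) × (Fin (K N) → Fin N → ℂ) → ℝ≥0∞ := fun p =>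
      ENNReal.ofReal (‖((1 / (N : ℝ) : ℝ) : ℂ) *
        centredForm h v (block (cov σ (dropFirst p.1) p.2)⁻¹ l m) (p.2 ⟨0, hN⟩)‖ ^ 4) with hFdef
    have hF : Measurable F := by
      have hg : Continuous fun p : (Fin (K N) → Fin L → ℂ) × (Fin (K N) → Fin N → ℂ) =>
          (dropFirst p.1, p.2) := by
        refine Continuous.prodMk (continuous_pi fun k => ?_) continuous_snd
        unfold dropFirst
        split_ifs
        · exact continuous_const
        · exact (continuous_apply k).comp continuous_fst
      have hinv := (continuous_cov_inv (L := L) (N := N) (κ := Fin (K N)) hσ).comp hg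
      have hent : ∀ i j, Measurable fun p : (Fin (K N) → Fin L → ℂ) × (Fin (K N) → Fin N → ℂ) =>
          block (cov σ (dropFirst p.1) p.2)⁻¹ l m i j := fun i j =>
        (hinv.matrix_elem (l, i) (m, j)).measurable
      have hcm : Measurable fun z => conj (h z) := Complex.continuous_conj.measurable.comp hh
      refine (Measurable.pow_const (Measurable.norm (Measurable.const_mul ?_ _)) 4).ennreal_ofReal
      unfold centredForm
      fun_prop
    have e : (fun ω => ENNReal.ofReal (‖((1 / (N : ℝ) : ℝ) : ℂ) *
        centredForm h v (block (cov σ (dropFirst (a N ω)) (x N ω))⁻¹ l m)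
          (fun i : Fin N => y i ω)‖ ^ 4)) = fun ω => F (a N ω, x N ω) := by
      funext ω
      simp only [F, hxy N ω ⟨0, hN⟩ rfl]
    rw [e]
    refine ⟨hF.comp ((ha N).prodMk (hx N)), ?_⟩
    refine lintegral_indepFun_le (ha N) (hx N) (hind N) hF fun α => ?_
    rw [hlaw N]
    refine lintegral_sigLaw_le (hF.comp measurable_prodMk_left) ⟨0, hN⟩ fun z => ?_
    simp only [F, Function.comp_apply, cov_dropFirst_update, Function.update_self]
    set B := block (cov σ (dropFirst α) z)⁻¹ l m
    have hB : BoundedForm (1 / σ ^ 2) B :=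
      boundedForm_block_inv (cov_isHermitian σ _ z) (by positivity) (cov_coercive σ _ z) l m
    rw [← ofReal_integral_eq_lintegral_ofReal (integrable_of_bdd
      (((measurable_centredForm hh v B).const_mul _).norm.pow_const 4)
      (C := (‖((1 / (N : ℝ) : ℝ) : ℂ)‖ * ((∑ i, ∑ j, ‖B i j‖ * (b * b)) +
        ‖(v : ℂ) * ∑ i, B i i‖)) ^ 4) fun w => by
          rw [norm_pow, norm_norm, norm_mul]
          gcongr
          exact norm_centredForm_le hhb v B w) (Eventually.of_forall fun w => by positivity)]
    exact ENNReal.ofReal_le_ofReal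
      (fourth_moment_scaled_centredForm hh hb hhb hh0 (by positivity) hB)
  filter_upwards [key] with ω hω
  exact tendsto_norm_of_tendsto_ofReal_pow hω

/-- Truncation reduces the difference to a vanishing centred form and averages along the first
column, to which the strong law applies; the resulting upper limit is arbitrarily small. -/
theorem ae_tendsto_blockForm_sub_resTrace {y : ℕ → Ω → ℂ} (h0 : ∫ z, z ∂μ = 0)
    (h1 : ∫ z, ‖z‖ ^ 2 ∂μ = 1) (hc : 0 < c) (hσ : 0 < σ)
    (hK : Tendsto (fun N : ℕ => (K N : ℝ) / (N : ℝ)) atTop (𝓝 c))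
    (ha : ∀ N, Measurable (a N)) (hx : ∀ N, Measurable (x N))
    (hind : ∀ N, IndepFun (a N) (x N) P) (hlaw : ∀ N, P.map (x N) = sigLaw μ (K N) N)
    (hxy : ∀ N ω (k : Fin (K N)), (k : ℕ) = 0 → x N ω k = fun i : Fin N => y i ω)
    (hy : ∀ i, Measurable (y i)) (hyind : iIndepFun y P)
    (hyid : ∀ i, IdentDistrib (y i) (y 0) P P) (hylaw : P.map (y 0) = μ) (l m : Fin L) :
    ∀ᵐ ω ∂P, Tendsto (fun N : ℕ => blockForm (cov σ (dropFirst (a N ω)) (x N ω))⁻¹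
      (fun i : Fin N => y i ω) l m - resTrace σ (dropFirst (a N ω)) (x N ω) l m) atTop (𝓝 0) := by
  set τ := 1 / σ ^ 2
  have hτ : 0 ≤ τ := by positivity
  have hsq := integrable_norm_sq_of_integral_eq_one h1
  have main : ∀ δ > 0, ∀ᵐ ω ∂P, ∀ᶠ N in atTop,
      ‖blockForm (cov σ (dropFirst (a N ω)) (x N ω))⁻¹ (fun i : Fin N => y i ω) l m -
        resTrace σ (dropFirst (a N ω)) (x N ω) l m‖ ≤ δ := by
    intro δ hδ
    -- The limit of the error bound is at most `(3/2 + 1 + 1) τ η`, below `4 τ η < δ`.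
    set η := min 1 (δ / (4 * τ + 1))
    have hη : 0 < η := by positivity
    have hη1 : η ≤ 1 := min_le_left _ _
    have hη2 : 4 * τ * η < δ := by
      have : η ≤ δ / (4 * τ + 1) := min_le_right _ _
      rw [le_div_iff₀ (by positivity)] at this
      linarith
    obtain ⟨h, b, hb, hh, hhb, hh0, hε1, hε2⟩ :=
      exists_truncation h0 h1 (ε := η ^ 2) (by positivity)
    have hcf := ae_tendsto_centredForm hc hσ hK ha hx hind hlaw hxy hb hh hhb hh0 l m
    set v := ∫ z, ‖h z‖ ^ 2 ∂μ
    have hv : v ≤ 2 := by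
      have := (abs_le.1 hε2).2
      nlinarith
    have ih2 : Integrable (fun z => ‖h z‖ ^ 2) μ := integrable_of_bdd (C := b ^ 2) (by fun_prop)
      fun z => by rw [norm_pow, norm_norm]; gcongr; exact hhb z
    have id2 : Integrable (fun z => ‖z - h z‖ ^ 2) μ := by
      refine Integrable.mono' ((hsq.const_mul 2).add (ih2.const_mul 2))
        ((measurable_id.sub hh).norm.pow_const 2).aestronglyMeasurable
        (Eventually.of_forall fun z => ?_)
      rw [norm_pow, norm_norm]
      have := norm_sub_le z (h z)
      have h0 := norm_nonneg (z - h z)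
      simp only [Pi.add_apply]
      nlinarith [sq_nonneg (‖z‖ - ‖h z‖)]
    rw [← hylaw] at hsq ih2 id2
    have s1 := ae_tendsto_avg hy hyind hyid (f := fun z => ‖z‖ ^ 2) (by fun_prop) hsq
    have s2 := ae_tendsto_avg hy hyind hyid (f := fun z => ‖h z‖ ^ 2) (by fun_prop) ih2
    have s3 := ae_tendsto_avg hy hyind hyid (f := fun z => ‖z - h z‖ ^ 2) (by fun_prop) id2
    rw [hylaw] at s1 s2 s3
    filter_upwards [hcf, s1, s2, s3] with ω w4 w1 w2 w3
    rw [h1] at w1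
    have hlim := ((((w1.add w2).const_mul η).div_const 2).add (w3.div_const η)).const_mul τ
      |>.add w4 |>.add_const (|v - 1| * τ)
    have hlt : τ * (η * (1 + v) / 2 + (∫ z, ‖z - h z‖ ^ 2 ∂μ) / η) + 0 + |v - 1| * τ < δ := by
      have k1 : (∫ z, ‖z - h z‖ ^ 2 ∂μ) / η ≤ η := by
        rw [div_le_iff₀ hη]; nlinarith
      have k2 : η * (1 + v) / 2 ≤ 3 / 2 * η := by nlinarith
      have k3 : |v - 1| ≤ η := hε2.trans (by nlinarith)
      calc _ ≤ τ * (3 / 2 * η + η) + 0 + η * τ := by gcongr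
        _ ≤ 4 * τ * η := by nlinarith [mul_nonneg hτ hη.le]
        _ < δ := hη2
    filter_upwards [hlim.eventually (ge_mem_nhds hlt)] with N hN
    refine le_trans ?_ hN
    exact norm_form_sub_trace_le hτ (boundedForm_block_inv (cov_isHermitian σ _ (x N ω))
      (by positivity : 0 < σ ^ 2) (cov_coercive σ _ (x N ω)) l m) h v (fun i : Fin N => y i ω) hη
  -- The truncation and its exceptional null set depend on `δ`, so countably many values are used.
  have main' : ∀ᵐ ω ∂P, ∀ n : ℕ, ∀ᶠ N in atTop,
      ‖blockForm (cov σ (dropFirst (a N ω)) (x N ω))⁻¹ (fun i : Fin N => y i ω) l m -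
        resTrace σ (dropFirst (a N ω)) (x N ω) l m‖ ≤ 1 / ((n : ℝ) + 1) :=
    ae_all_iff.2 fun n => main _ (by positivity)
  filter_upwards [main'] with ω hω
  rw [tendsto_zero_iff_norm_tendsto_zero, Metric.tendsto_nhds]
  intro ε hε
  obtain ⟨n, hn⟩ := exists_nat_one_div_lt hε
  filter_upwards [hω n] with N hN
  rw [dist_zero_right, norm_norm]
  exact hN.trans_lt hn

end AlmostSure

/-! ### The signal to interference ratio -/

section Assembly

variable {L : ℕ} {c σ : ℝ} {K : ℕ → ℕ}

lemma integral_empiricalDist (n : ℕ) (α : ℕ → Fin L → ℂ) {f : (Fin L → ℂ) → ℂ}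
    (hf : Continuous f) :
    ∫ x, f x ∂(empiricalDist n α : Measure (Fin L → ℂ)) = (n : ℂ)⁻¹ * ∑ k : Fin n, f (α k) := by
  have hi : ∀ k ∈ Finset.range n, Integrable f
      ((diracProba (α k)).toFiniteMeasure : Measure (Fin L → ℂ)) := fun k _ =>
    integrable_dirac' hf.stronglyMeasurable (by simp)
  rw [empiricalDist, FiniteMeasure.toMeasure_smul, integral_smul_nnreal_measure,
    FiniteMeasure.toMeasure_sum, integral_finsetSum_measure hi, Finset.sum_range, NNReal.smul_def,
    Complex.real_smul, NNReal.coe_inv, NNReal.coe_natCast, Complex.ofReal_inv, Complex.ofReal_natCast]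
  congr 1
  exact Finset.sum_congr rfl fun k _ => integral_dirac' _ _ hf.stronglyMeasurable

lemma averagesTendsto_of_tendsto_empiricalDist {H : ProbabilityMeasure (Fin L → ℂ)}
    (hK : Tendsto (fun N : ℕ => (K N : ℝ) / (N : ℝ)) atTop (𝓝 c)) {α : ℕ → ℕ → Fin L → ℂ}
    (h : Tendsto (fun N => empiricalDist (K N) (α N)) atTop (𝓝 H.toFiniteMeasure)) :
    AveragesTendsto c H fun N (k : Fin (K N)) => α N k := by
  intro f hf ⟨C, hC⟩
  have h1 := (FiniteMeasure.tendsto_iff_forall_integral_rclike_tendsto ℂ).1 h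
    (BoundedContinuousFunction.ofNormedAddCommGroup f hf C hC)
  simp only [BoundedContinuousFunction.coe_ofNormedAddCommGroup, integral_empiricalDist _ _ hf] at h1
  have h2 := ((Complex.continuous_ofReal.tendsto c).comp hK).mul h1
  refine h2.congr fun N => ?_
  simp only [Function.comp]
  rcases Nat.eq_zero_or_pos (K N) with h0 | h0
  · have : IsEmpty (Fin (K N)) := by rw [h0]; infer_instance
    simp
  · have : ((K N : ℕ) : ℂ) ≠ 0 := by exact_mod_cast h0.ne'
    push_cast
    rw [← mul_assoc]
    congr 1
    field_simp

lemma limitValue_eq {T : ℝ} (hT : 0 ≤ T) (γ : Fin L → ℂ) (A : Matrix (Fin L) (Fin L) ℂ) :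
    limitValue T γ A = star (gainVec T γ) ⬝ᵥ A *ᵥ gainVec T γ := by
  have h : (T : ℂ) = (Real.sqrt T : ℂ) * Real.sqrt T := by
    rw [← Complex.ofReal_mul, Real.mul_self_sqrt hT]
  simp only [limitValue, gainVec, dotProduct, mulVec, Pi.star_apply, star_mul', Finset.mul_sum,
    RCLike.star_def, Complex.conj_ofReal]
  refine Finset.sum_congr rfl fun l _ => Finset.sum_congr rfl fun m _ => ?_
  rw [h]
  ring

lemma userBeta_eq (N : ℕ) (T : ℕ → ℝ) (γ : ℕ → Fin L → ℂ) (s : ℕ → ℕ → ℂ) (k : ℕ) :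
    userBeta N T γ s k = bvec (gainVec (T k) (γ k)) (fun i : Fin N => s i k) := by
  funext p
  simp only [userBeta, beta, bvec, gainVec, mul_assoc]

lemma interference_add_eq_cov {n : ℕ} (N : ℕ) (σ : ℝ) (T : ℕ → ℝ) (γ : ℕ → Fin L → ℂ)
    (s : ℕ → ℕ → ℂ) :
    interference N n T γ s + ((σ ^ 2 : ℝ) : ℂ) • (1 : Matrix (Fin L × Fin N) (Fin L × Fin N) ℂ) =
      cov σ (dropFirst fun k : Fin n => gainVec (T k) (γ k)) (fun k (i : Fin N) => s i k) := by
  rw [interference, cov]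
  congr 2
  · push_cast
    rfl
  · set g : ℕ → Matrix (Fin L × Fin N) (Fin L × Fin N) ℂ := fun k =>
      if k = 0 then 0 else vecMulVec (userBeta N T γ s k) (star (userBeta N T γ s k))
    have h1 : ∀ k : Fin n, vecMulVec
        (bvec (dropFirst (fun k : Fin n => gainVec (T k) (γ k)) k) (fun i : Fin N => s i k))
        (star (bvec (dropFirst (fun k : Fin n => gainVec (T k) (γ k)) k)
          (fun i : Fin N => s i k))) = g k := fun k => by
      by_cases hk : (k : ℕ) = 0
      · simp [g, dropFirst, hk, bvec_zero]
      · simp only [g, dropFirst, hk, if_false, userBeta_eq]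
    rw [Finset.sum_congr rfl fun k _ => h1 k, ← Finset.sum_range]
    have h2 : ∀ k ∈ Finset.Ico 1 n,
        vecMulVec (userBeta N T γ s k) (star (userBeta N T γ s k)) = g k := fun k hk => by
      have : k ≠ 0 := Nat.one_le_iff_ne_zero.1 (Finset.mem_Ico.1 hk).1
      simp only [g, this, if_false]
    rw [Finset.sum_congr rfl h2]
    refine Finset.sum_subset (fun k hk => Finset.mem_range.2 (Finset.mem_Ico.1 hk).2)
      fun k hk hk' => ?_
    have : k = 0 := by
      by_contra h
      exact hk' (Finset.mem_Ico.2 ⟨Nat.one_le_iff_ne_zero.2 h, Finset.mem_range.1 hk⟩)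
    simp [this]

lemma sir_eq {n : ℕ} (N : ℕ) (σ : ℝ) (T : ℕ → ℝ) (γ : ℕ → Fin L → ℂ) (s : ℕ → ℕ → ℂ) :
    sir N n σ T γ s = star (gainVec (T 0) (γ 0)) ⬝ᵥ
      blockForm (cov σ (dropFirst fun k : Fin n => gainVec (T k) (γ k))
        (fun k (i : Fin N) => s i k))⁻¹ (fun i : Fin N => s i 0) *ᵥ gainVec (T 0) (γ 0) := by
  rw [sir, interference_add_eq_cov, userBeta_eq, ← bvec_dotProduct_mulVec]
  push_cast
  rfl

lemma tendsto_sir_sub {B : ℕ → Matrix (Fin L) (Fin L) ℂ} {A : Matrix (Fin L) (Fin L) ℂ}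
    (hB : Tendsto B atTop (𝓝 A)) {v : ℕ → Fin L → ℂ} {M : ℝ} (hv : ∀ᶠ N in atTop, ‖v N‖ ≤ M) :
    Tendsto (fun N => star (v N) ⬝ᵥ B N *ᵥ v N - star (v N) ⬝ᵥ A *ᵥ v N) atTop (𝓝 0) := by
  have hM : ∀ᶠ N in atTop, 0 ≤ M := hv.mono fun N h => (norm_nonneg _).trans h
  have hδ : Tendsto (fun N => ∑ l, ∑ m, ‖(B N - A) l m‖) atTop (𝓝 0) := by
    have : Tendsto (fun N => ∑ l, ∑ m, ‖(B N - A) l m‖) atTop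
        (𝓝 (∑ l, ∑ m, ‖(A - A) l m‖)) :=
      tendsto_finsetSum _ fun l _ => tendsto_finsetSum _ fun m _ =>
        (tendsto_entry (hB.sub_const A) l m).norm
    simpa using this
  have hb : Tendsto (fun N => (L : ℝ) * (M * (L * ((∑ l, ∑ m, ‖(B N - A) l m‖) * M)))) atTop
      (𝓝 0) := by
    simpa using (((hδ.mul_const M).const_mul (L : ℝ)).const_mul M).const_mul (L : ℝ)
  refine squeeze_zero_norm' ?_ hb
  filter_upwards [hv, hM] with N hN hM
  rw [← dotProduct_sub, ← sub_mulVec]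
  refine norm_star_dotProduct_mulVec_le (fun l m => ?_) (fun l => (norm_le_pi_norm _ l).trans hN)
    (by positivity) hM
  exact (Finset.single_le_sum (f := fun m => ‖(B N - A) l m‖) (fun _ _ => norm_nonneg _)
    (Finset.mem_univ m)).trans (Finset.single_le_sum (f := fun l => ∑ m, ‖(B N - A) l m‖)
      (fun _ _ => by positivity) (Finset.mem_univ l))

/-- The two systems differ only at users altered by the cutoff, counted by `tailFun`, and possibly
at user `0`, which accounts for the `+ 1`. -/
lemma norm_resTrace_cutoff_sub_le {n N : ℕ} (hσ : 0 < σ) (M : ℕ) (α : Fin n → Fin L → ℂ)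
    (x : Fin n → Fin N → ℂ) (l m : Fin L) :
    ‖resTrace σ (fun k => cutoff M (α k)) x l m - resTrace σ (dropFirst α) x l m‖ ≤
      (∑ k, tailFun M (α k) + 1) * (2 / σ ^ 2 * (1 / (N : ℝ))) := by
  classical
  set S₁ := Finset.univ.filter fun k => cutoff M (α k) ≠ α k
  set S₀ := Finset.univ.filter fun k : Fin n => (k : ℕ) = 0
  have h := norm_resTrace_sub_le hσ (S₁ ∪ S₀) (a := fun k => cutoff M (α k)) (a' := dropFirst α)
    (x := x) (x' := x) (fun k hk => by
      simp only [S₁, S₀, Finset.mem_union, Finset.mem_filter, Finset.mem_univ, true_and, not_or,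
        not_not] at hk
      simp only [dropFirst, hk.1, if_neg hk.2]) l m
  have h1 : (S₁.card : ℝ) ≤ ∑ k, tailFun M (α k) := by
    rw [Finset.card_eq_sum_ones, Nat.cast_sum, Nat.cast_one]
    refine (Finset.sum_le_sum fun k hk => one_le_tailFun (Finset.mem_filter.1 hk).2).trans ?_
    exact Finset.sum_le_univ_sum_of_nonneg fun k => tailFun_nonneg M _
  have h0 : S₀.card ≤ 1 := Finset.card_le_one.2 fun i hi j hj => Fin.ext
    ((Finset.mem_filter.1 hi).2.trans (Finset.mem_filter.1 hj).2.symm)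
  have hu : ((S₁ ∪ S₀).card : ℝ) ≤ ∑ k, tailFun M (α k) + 1 := by
    have : ((S₁ ∪ S₀).card : ℝ) ≤ S₁.card + S₀.card := by exact_mod_cast Finset.card_union_le _ _
    have h0' : (S₀.card : ℝ) ≤ 1 := by exact_mod_cast h0
    linarith
  refine h.trans ?_
  rw [show (2 : ℝ) / (N * σ ^ 2) = 2 / σ ^ 2 * (1 / (N : ℝ)) by
    rw [div_mul_div_comm, mul_one, mul_comm]]
  gcongr

end Assembly

/-- Almost surely the quadratic forms of the first signature converge to a solution of the fixed
point equation. -/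
theorem ae_exists_isSolution_tendsto {Ω : Type*} [MeasurableSpace Ω] {P : Measure Ω}
    [IsProbabilityMeasure P] {L : ℕ} {c σ : ℝ} (hc : 0 < c) (hσ : 0 < σ) {s : ℕ → ℕ → Ω → ℂ}
    (hs_meas : ∀ i j, Measurable (s i j)) (hs_indep : iIndepFun (fun p : ℕ × ℕ => s p.1 p.2) P)
    (hs_ident : ∀ i j, IdentDistrib (s i j) (s 0 0) P P) (hs_mean : ∫ ω, s 0 0 ω ∂P = 0)
    (hs_var : ∫ ω, ‖s 0 0 ω‖ ^ 2 ∂P = 1) {K : ℕ → ℕ}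
    (hK : Tendsto (fun N : ℕ => (K N : ℝ) / (N : ℝ)) atTop (𝓝 c))
    {α : ℕ → ℕ → Ω → Fin L → ℂ} (hα : ∀ N, ∀ k < K N, Measurable (α N k))
    (h_indep : ∀ N, IndepFun (fun ω (k : Fin (K N)) => α N k ω)
      (fun ω (k : Fin (K N)) (i : Fin N) => s i k ω) P)
    {H : ProbabilityMeasure (Fin L → ℂ)}
    (hH : ∀ᵐ ω ∂P, Tendsto (fun N => empiricalDist (K N) (fun k => α N k ω)) atTop
      (𝓝 H.toFiniteMeasure)) :
    ∀ᵐ ω ∂P, ∃ A, IsSolution c σ H A ∧ Tendsto (fun N =>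
      blockForm (cov σ (dropFirst fun k : Fin (K N) => α N k ω) (fun k (i : Fin N) => s i k ω))⁻¹
        (fun i : Fin N => s i 0 ω)) atTop (𝓝 A) := by
  have hμ : IsProbabilityMeasure (P.map (s 0 0)) :=
    Measure.isProbabilityMeasure_map (hs_meas 0 0).aemeasurable
  have h0 : ∫ z, z ∂(P.map (s 0 0)) = 0 := by
    rw [integral_map (hs_meas 0 0).aemeasurable (by fun_prop), hs_mean]
  have h1 : ∫ z, ‖z‖ ^ 2 ∂(P.map (s 0 0)) = 1 := by
    rw [integral_map (hs_meas 0 0).aemeasurable (by fun_prop), hs_var]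
  have ha : ∀ N, Measurable fun ω (k : Fin (K N)) => α N k ω := fun N =>
    measurable_pi_lambda _ fun k => hα N k k.2
  have hx : ∀ N, Measurable fun ω (k : Fin (K N)) (i : Fin N) => s i k ω := fun N =>
    measurable_pi_lambda _ fun k => measurable_pi_lambda _ fun i => hs_meas i k
  have hlaw := fun N => map_signatures_eq_sigLaw hs_meas hs_indep hs_ident (K N) N
  have hinj : Function.Injective fun i : ℕ => (i, 0) := fun i j h => (Prod.mk.inj h).1
  have hdef : ∀ᵐ ω ∂P, ∀ (M : ℕ) (l m : Fin L), Tendsto (fun N : ℕ => defect σ N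
      (fun k : Fin (K N) => cutoff M (α N k ω)) (resTrace σ (fun k : Fin (K N) => cutoff M (α N k ω))
        (fun k (i : Fin N) => s i k ω)) l m) atTop (𝓝 0) :=
    ae_all_iff.2 fun M => ae_all_iff.2 fun l => ae_all_iff.2 fun m =>
      ae_tendsto_defect h0 h1 hc.le hσ hK ha hx h_indep hlaw M l m
  have hquad : ∀ᵐ ω ∂P, ∀ l m : Fin L, Tendsto (fun N : ℕ =>
      blockForm (cov σ (dropFirst fun k : Fin (K N) => α N k ω) (fun k (i : Fin N) => s i k ω))⁻¹
        (fun i : Fin N => s i 0 ω) l m - resTrace σ (dropFirst fun k : Fin (K N) => α N k ω)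
          (fun k (i : Fin N) => s i k ω) l m) atTop (𝓝 0) :=
    ae_all_iff.2 fun l => ae_all_iff.2 fun m =>
      ae_tendsto_blockForm_sub_resTrace (y := fun i => s i 0) h0 h1 hc hσ hK ha hx h_indep hlaw
        (fun N ω k hk => by simp only [hk]) (fun i => hs_meas i 0) (hs_indep.precomp hinj)
        (fun i => hs_ident i 0) rfl l m
  filter_upwards [hH, hdef, hquad] with ω hHω hdω hqω
  obtain ⟨A, hA, hlim⟩ := exists_isSolution_tendsto (C := 2 / σ ^ 2) (τ := 1 / σ ^ 2)
    (Ah := fun M N => resTrace σ (fun k : Fin (K N) => cutoff M (α N k ω))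
      (fun k (i : Fin N) => s i k ω))
    (B := fun N => resTrace σ (dropFirst fun k : Fin (K N) => α N k ω)
      (fun k (i : Fin N) => s i k ω)) hc.le hσ
    (averagesTendsto_of_tendsto_empiricalDist hK hHω) (fun M N => resTrace_posSemidef hσ _ _)
    (fun N => resTrace_posSemidef hσ _ _) (fun M N l m => norm_resTrace_le hσ _ _ l m)
    (fun N l m => norm_resTrace_le hσ _ _ l m) (fun M l m => hdω M l m)
    (fun M N l m => norm_resTrace_cutoff_sub_le hσ M _ _ l m)
  refine ⟨A, hA, tendsto_of_entry fun l m => ?_⟩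
  simpa using (hqω l m).add (tendsto_entry hlim l m)

end CDMA
end

/-! ### The main theorem -/

theorem theorem1p1 {Ω : Type*} [MeasurableSpace Ω] (P : Measure Ω) [IsProbabilityMeasure P]
    (L : ℕ) (c σ : ℝ) (hc : 0 < c) (hσ : 0 < σ)
    (s : ℕ → ℕ → Ω → ℂ)
    (hs_meas : ∀ i j, Measurable (s i j))
    (hs_indep : iIndepFun (fun p : ℕ × ℕ => s p.1 p.2) P)
    (hs_ident : ∀ i j, IdentDistrib (s i j) (s 0 0) P P)
    (hs_mean : ∫ ω, s 0 0 ω ∂P = 0)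
    (hs_var : ∫ ω, ‖s 0 0 ω‖ ^ 2 ∂P = 1)
    (K : ℕ → ℕ)
    (hK : Tendsto (fun N : ℕ => (K N : ℝ) / (N : ℝ)) atTop (𝓝 c))
    -- powers `T N k` and gains `γ N k l` of the users `k < K N` in the `N`-th system
    (T : ℕ → ℕ → Ω → ℝ) (γ : ℕ → ℕ → Fin L → Ω → ℂ)
    (hT_meas : ∀ N, ∀ k < K N, Measurable (T N k))
    (hT_nonneg : ∀ N, ∀ k < K N, ∀ ω, 0 ≤ T N k ω)
    (hγ_meas : ∀ N, ∀ k < K N, ∀ l, Measurable (γ N k l))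
    (h_indep : ∀ N, IndepFun
      (fun ω => fun k : Fin (K N) => (T N k ω, fun l : Fin L => γ N k l ω))
      (fun ω => fun p : Fin N × Fin (K N) => s p.1 p.2 ω) P)
    (H : ProbabilityMeasure (Fin L → ℂ))
    (hH : ∀ᵐ ω ∂P, Tendsto
      (fun N => CDMA.empiricalDist (K N)
        (fun k => CDMA.gainVec (T N k ω) (fun l => γ N k l ω)))
      atTop (𝓝 H.toFiniteMeasure)) :
    ∃ A : Matrix (Fin L) (Fin L) ℂ,
      CDMA.IsSolution c σ H A ∧
      (∀ B : Matrix (Fin L) (Fin L) ℂ, CDMA.IsSolution c σ H B → B = A) ∧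
      ∀ᵐ ω ∂P,
        -- the first user's power and gains do not vary with `N`, or converge
        (∀ (T₁ : ℝ) (γ₁ : Fin L → ℂ),
          Tendsto (fun N => T N 0 ω) atTop (𝓝 T₁) →
          (∀ l, Tendsto (fun N => γ N 0 l ω) atTop (𝓝 (γ₁ l))) →
          Tendsto
            (fun N => CDMA.sir N (K N) σ (fun k => T N k ω) (fun k l => γ N k l ω)
              (fun i k => s i k ω))
            atTop (𝓝 (CDMA.limitValue T₁ γ₁ A))) ∧
        -- they vary with `N` and the vectors `√T γ` of the first user stay bounded
        ((∃ M : ℝ, ∀ N, ‖CDMA.gainVec (T N 0 ω) (fun l => γ N 0 l ω)‖ ≤ M) →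
          Tendsto
            (fun N => CDMA.sir N (K N) σ (fun k => T N k ω) (fun k l => γ N k l ω)
                (fun i k => s i k ω) -
              CDMA.limitValue (T N 0 ω) (fun l => γ N 0 l ω) A)
            atTop (𝓝 0)) := by
  have hgain : Continuous fun p : ℝ × (Fin L → ℂ) => CDMA.gainVec p.1 p.2 := by
    unfold CDMA.gainVec
    fun_prop
  have hα : ∀ N, ∀ k < K N, Measurable fun ω => CDMA.gainVec (T N k ω) fun l => γ N k l ω :=
    fun N k hk => hgain.measurable.comp
      ((hT_meas N k hk).prodMk (measurable_pi_lambda _ fun l => hγ_meas N k hk l))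
  have hind : ∀ N, IndepFun
      (fun ω (k : Fin (K N)) => CDMA.gainVec (T N k ω) fun l => γ N k l ω)
      (fun ω (k : Fin (K N)) (i : Fin N) => s i k ω) P := fun N =>
    (h_indep N).comp
      (φ := fun q (k : Fin (K N)) => CDMA.gainVec (q k).1 (q k).2)
      (ψ := fun q (k : Fin (K N)) (i : Fin N) => q (i, k))
      (measurable_pi_lambda _ fun k => hgain.measurable.comp (measurable_pi_apply k))
      (by fun_prop)
  have hae := CDMA.ae_exists_isSolution_tendsto hc hσ hs_meas hs_indep hs_ident hs_mean hs_var hK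
    (α := fun N k ω => CDMA.gainVec (T N k ω) fun l => γ N k l ω) hα hind hH
  -- An almost sure event is nonempty, so one realization provides the solution.
  obtain ⟨ω₀, A, hA, -⟩ := hae.exists
  refine ⟨A, hA, fun B hB => CDMA.IsSolution.unique hc.le hσ hB hA, ?_⟩
  have hpos := CDMA.eventually_pos_of_ratio hc hK
  filter_upwards [hae] with ω ⟨A', hA', hlim⟩
  -- The limit for `ω` is a priori random; uniqueness identifies it with `A`.
  rw [CDMA.IsSolution.unique hc.le hσ hA' hA] at hlim
  have main : ∀ M : ℝ, (∀ᶠ N in atTop, ‖CDMA.gainVec (T N 0 ω) (fun l => γ N 0 l ω)‖ ≤ M) →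
      Tendsto (fun N => CDMA.sir N (K N) σ (fun k => T N k ω) (fun k l => γ N k l ω)
        (fun i k => s i k ω) - CDMA.limitValue (T N 0 ω) (fun l => γ N 0 l ω) A) atTop (𝓝 0) := by
    intro M hM
    refine (CDMA.tendsto_sir_sub hlim hM).congr' ?_
    -- The power of user `0` is known to be nonnegative only when `0 < K N`, which holds eventually.
    filter_upwards [hpos] with N hN
    rw [CDMA.sir_eq, CDMA.limitValue_eq (hT_nonneg N 0 hN ω)]
  refine ⟨fun T₁ γ₁ hT₁ hγ₁ => ?_, fun ⟨M, hM⟩ => main M (Eventually.of_forall hM)⟩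
  have hγ' : Tendsto (fun N l => γ N 0 l ω) atTop (𝓝 γ₁) := tendsto_pi_nhds.2 hγ₁
  have hv := (hgain.tendsto (T₁, γ₁)).comp (hT₁.prodMk_nhds hγ')
  -- Convergent gain vectors are eventually bounded, so the convergent case reduces to the bounded
  -- one and continuity of the limit expression.
  have h1 := main (‖CDMA.gainVec T₁ γ₁‖ + 1)
    (hv.norm.eventually (ge_mem_nhds (lt_add_one _)))
  have hlv : Continuous fun p : ℝ × (Fin L → ℂ) => CDMA.limitValue p.1 p.2 A := by
    unfold CDMA.limitValue
    fun_prop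
  have h2 := h1.add ((hlv.tendsto (T₁, γ₁)).comp (hT₁.prodMk_nhds hγ'))
  simpa [Function.comp_def] using h2
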